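/- Identify $\mathbb R^2$ with $\mathbb C$ and let $\mathbb R^2_+=\mathbb R\times(0,\infty)$, $B_r^+(0)=B_r(0)\cap\mathbb R^2_+$, and $S=\{w_1+iw_2: w_1>0,\ 0<w_2<\pi\}$. The map $F(w)=-1/\cosh w$ is a (conformal) bijection $F:S\to\mathbb R^2_+$; define $$u(z)=\Im\Big(\frac{\pi i}{2}-F^{-1}(z)\Big),\qquad z\in\mathbb R^2_+ .$$ Let $\dot W^{1,2}(\mathbb R^2)$ be the completion of $C_0^\infty(\mathbb R^2)$ with respect to $\|\nabla\zeta\|_{L^2(\mathbb R^2)}$ (its elements being regarded as functions determined up to a constant), let $\dot W^{1,2}(\Omega)$ be the set of restrictions to $\Omega$ of functions in $\dot W^{1,2}(\mathbb R^2)$, and let $\dot W^{1,2}_*(\mathbb R^2_+;0)$ be the space of all $v\in\bigcap_{r>0}\dot W^{1,2}(\mathbb R^2_+\setminus B_r(0))$ with $$\sup_{r>0}\frac{\|\nabla v\|^2_{L^2(\mathbb R^2_+\setminus B_r(0))}}{\log(\frac1r+2)}<\infty .$$ Consider the mixed boundary value problem $$\Delta v=0\ \text{ in }\mathbb R^2_+,\qquad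 v=\tfrac{\pi}{2}\ \text{ on }(-1,0)\times\{0\},\qquad v=-\tfrac{\pi}{2}\ \text{ on }(0,1)\times\{0\},$$ $$\frac{\partial v}{\partial x_2}=0\ \text{ on }(-\infty,-1)\times\{0\}\text{ and }(1,\infty)\times\{0\},$$ where for $v\in\dot W^{1,2}_*(\mathbb R^2_+;0)$ the Dirichlet conditions are understood in the sense of traces and the equation together with the Neumann conditions is understood weakly, i.e. $\int_{\mathbb R^2_+}\nabla v\cdot\nabla\zeta\,dx=0$ for every $\zeta\in C_0^\infty(\mathbb R^2)$ whose support does not meet $[-1,1]\times\{0\}$. Then the function $u$ is harmonic in $\mathbb R^2_+$ and is the unique solution of this problem in $\dot W^{1,2}_*(\mathbb R^2_+;0)$ (uniqueness as functions on $\mathbb R^2_+$ up to null sets). It satisfies $|u|\le\frac\pi2$ in $\mathbb R^2_+$ and $u(x)\to0$ as $|x|\to\infty$, $x \in \mathbb R^2_+$. Moreover $u(x_1,x_2)=-u(-x_1,x_2)$ for every $x\in\mathbb R^2_+$. Furthermore, there is a constant $C$ such that $$\Big|\nabla u(x)-\frac{x^\perp}{|x|^2}\Big|\le C|x|\qquad\text{for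 all }x\in B^+_{1/2}(0),$$ where $x^\perp=(-x_2,x_1)$. -/

import Mathlib

open MeasureTheory Filter Topology
open scoped ContDiff

namespace NeelWall

/-! The plane `ℝ²` is identified with `ℂ` (with its Euclidean norm and Lebesgue measure `volume`);
gradients of real functions on the plane are complex numbers `∂₁f + i ∂₂f`. -/

/-- The open upper half-plane. -/
def halfPlane : Set ℂ := {z | 0 < z.im}

/-- The half-strip `{w₁ + i w₂ | w₁ > 0, 0 < w₂ < π}`. -/
def strip : Set ℂ := {w | 0 < w.re ∧ 0 < w.im ∧ w.im < Real.pi}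

/-- `F(w) = -1 / cosh w`. -/
noncomputable def F (w : ℂ) : ℂ := -1 / Complex.cosh w

lemma neg_inv_im (c : ℂ) : (-1 / c).im = c.im / Complex.normSq c := by
  simp [neg_div]

lemma cosh_im (w : ℂ) : (Complex.cosh w).im = Real.sinh w.re * Real.sin w.im := by
  conv_lhs => rw [← Complex.re_add_im w]
  rw [Complex.cosh_add, Complex.cosh_mul_I, Complex.sinh_mul_I]
  simp [← Complex.ofReal_cosh, ← Complex.ofReal_sinh, ← Complex.ofReal_cos, ← Complex.ofReal_sin]

lemma cosh_im_pos {w : ℂ} (hw : w ∈ strip) : 0 < (Complex.cosh w).im := by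
  rw [cosh_im]
  exact mul_pos (Real.sinh_pos_iff.2 hw.1) (Real.sin_pos_of_pos_of_lt_pi hw.2.1 hw.2.2)

/-- `F` maps the half-strip bijectively onto the upper half-plane. -/
theorem bijOn_F : Set.BijOn F strip halfPlane := by
  refine ⟨fun w hw => ?_, fun a ha b hb hab => ?_, fun z hz => ?_⟩
  · have h := cosh_im_pos hw
    change 0 < (-1 / Complex.cosh w).im
    rw [neg_inv_im]
    refine div_pos h (Complex.normSq_pos.2 fun h0 => ?_)
    simp [h0] at h
  · have hca : Complex.cosh a ≠ 0 := fun h0 => by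
      have h := cosh_im_pos ha
      simp [h0] at h
    have hcb : Complex.cosh b ≠ 0 := fun h0 => by
      have h := cosh_im_pos hb
      simp [h0] at h
    have h : Complex.cosh a = Complex.cosh b := by
      unfold F at hab
      field_simp at hab
      exact neg_injective hab.symm
    rw [← Complex.cos_mul_I, ← Complex.cos_mul_I, Complex.cos_eq_cos_iff] at h
    obtain ⟨k, hk | hk⟩ := h
    · have h1 := congrArg Complex.im hk
      have h2 := congrArg Complex.re hk
      simp at h1 h2
      have hk0 : k = 0 := by
        have hpi := Real.pi_pos
        have hu : (k : ℝ) < 1 := by nlinarith [ha.2.1, ha.2.2, hb.2.1, hb.2.2]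
        have hl : (-1 : ℝ) < k := by nlinarith [ha.2.1, ha.2.2, hb.2.1, hb.2.2]
        have hu' : k < 1 := by exact_mod_cast hu
        have hl' : -1 < k := by exact_mod_cast hl
        omega
      subst hk0
      simp at hk
      exact hk.symm
    · have h1 := congrArg Complex.im hk
      simp at h1
      linarith [ha.1, hb.1]
  · have hz' : 0 < z.im := hz
    have hz0 : z ≠ 0 := fun h0 => by simp [h0] at hz'
    have him : 0 < (-1 / z).im := by
      rw [neg_inv_im]
      exact div_pos hz' (Complex.normSq_pos.2 hz0)
    obtain ⟨y, hy⟩ := Complex.cos_surjective (-1 / z)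
    obtain ⟨x, hx⟩ : ∃ x, Complex.cosh x = -1 / z :=
      ⟨y * Complex.I, by rw [Complex.cosh_mul_I, hy]⟩
    have key : ∀ w : ℂ, Complex.cosh w = -1 / z → 0 < w.re → ∃ v ∈ strip, F v = z := by
      intro w hw hre
      set t := toIocMod Real.two_pi_pos (-Real.pi) w.im with ht
      have htm := toIocMod_mem_Ioc Real.two_pi_pos (-Real.pi) w.im
      rw [← ht] at htm
      have hti : t = w.im - toIocDiv Real.two_pi_pos (-Real.pi) w.im • (2 * Real.pi) := rfl
      have hv : Complex.cosh (w - (toIocDiv Real.two_pi_pos (-Real.pi) w.im : ℤ) *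
          (2 * Real.pi * Complex.I)) = -1 / z := by
        rw [← hw, ← Complex.cos_mul_I, ← Complex.cos_mul_I, Complex.cos_eq_cos_iff]
        refine ⟨-toIocDiv Real.two_pi_pos (-Real.pi) w.im, Or.inl ?_⟩
        push_cast
        ring_nf
        simp
      refine ⟨_, ⟨?_, ?_, ?_⟩, by rw [F, hv]; field_simp⟩
      · simpa using hre
      all_goals
        have him2 := him
        rw [← hv, cosh_im] at him2
        have e1 : (w - (toIocDiv Real.two_pi_pos (-Real.pi) w.im : ℤ) *
          (2 * Real.pi * Complex.I)).im = t := by rw [hti]; simp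
        have e2 : (w - (toIocDiv Real.two_pi_pos (-Real.pi) w.im : ℤ) *
          (2 * Real.pi * Complex.I)).re = w.re := by simp
        rw [e1, e2] at him2
        rw [e1]
        have hs : 0 < Real.sin t := pos_of_mul_pos_right him2 (Real.sinh_pos_iff.2 hre).le
      · by_contra! hcon
        linarith [Real.sin_nonpos_of_nonpos_of_neg_pi_le hcon htm.1.le]
      · have h2 : t ≤ Real.pi := by linarith [htm.2]
        refine lt_of_le_of_ne h2 fun h => ?_
        simp [h] at hs
    rcases lt_trichotomy x.re 0 with h | h | h
    · exact key (-x) (by rw [Complex.cosh_neg, hx]) (by simpa using h)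
    · rw [← hx, cosh_im, h] at him
      simp at him
    · exact key x hx h

/-- The inverse of `F : strip → halfPlane` (only its values on `halfPlane` matter). -/
noncomputable def Finv : ℂ → ℂ := Function.invFunOn F strip

/-- `u = Im f` with `f(z) = πi/2 - F⁻¹(z)`. -/
noncomputable def potential (z : ℂ) : ℝ := (Real.pi * Complex.I / 2 - Finv z).im

/-- `x^⊥ = (-x₂, x₁)`. -/
def perp (z : ℂ) : ℂ := ⟨-z.im, z.re⟩

/-- `φ ∈ C_c^∞(ℝ²)`. -/
def IsTest (φ : ℂ → ℝ) : Prop := ContDiff ℝ ∞ φ ∧ HasCompactSupport φ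

/-- `u ∈ L¹_loc(Ω)` has the weak gradient `G ∈ L¹_loc(Ω)` in the open set `Ω`. -/
def IsWeakGradientOn (Ω : Set ℂ) (u : ℂ → ℝ) (G : ℂ → ℂ) : Prop :=
  LocallyIntegrableOn u Ω ∧ LocallyIntegrableOn G Ω ∧
    ∀ φ : ℂ → ℝ, IsTest φ → tsupport φ ⊆ Ω →
      ∫ z in Ω, u z • gradient φ z = - ∫ z in Ω, φ z • G z

/-- `w` (a function, determined up to a constant) represents an element of the completion
`Ẇ^{1,2}(ℝ²)` of `C_c^∞(ℝ²)` with respect to `‖∇φ‖_{L²}`: its weak gradient is the `L²`-limit of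
gradients of functions in `C_c^∞(ℝ²)`. -/
def MemHomSobolev (w : ℂ → ℝ) : Prop :=
  ∃ G : ℂ → ℂ, IsWeakGradientOn Set.univ w G ∧ MemLp G 2 volume ∧
    ∃ φ : ℕ → ℂ → ℝ, (∀ n, IsTest (φ n)) ∧
      Tendsto (fun n => eLpNorm (fun z => gradient (φ n) z - G z) 2 volume) atTop (𝓝 0)

/-- `u ∈ Ẇ^{1,2}(Ω)`: on `Ω`, the function `u` is the restriction of some element of
`Ẇ^{1,2}(ℝ²)`. -/
def MemHomSobolevOn (Ω : Set ℂ) (u : ℂ → ℝ) : Prop :=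
  ∃ w : ℂ → ℝ, MemHomSobolev w ∧ w =ᵐ[volume.restrict Ω] u

/-- `Ω_r = ℝ²₊ ∖ B_r(0)`. -/
def outer (r : ℝ) : Set ℂ := halfPlane \ Metric.ball 0 r

/-- `u`, with weak gradient `G`, belongs to `Ẇ_*^{1,2}(ℝ²₊; 0)`. -/
def MemWStar (u : ℂ → ℝ) (G : ℂ → ℂ) : Prop :=
  IsWeakGradientOn halfPlane u G ∧
  (∀ r : ℝ, 0 < r → MemHomSobolevOn (outer r) u) ∧
  ∃ C : ℝ, ∀ r : ℝ, 0 < r →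
    eLpNorm G 2 (volume.restrict (outer r)) ^ 2 ≤ ENNReal.ofReal (C * Real.log (1 / r + 2))

/-- `u`, with weak gradient `G` in the half-plane, has the constant trace `c` on `J × {0}`
(`J` open), the trace being expressed by the Gauss–Green formula
`∫_{ℝ²₊} ∇(uζ) dx = -(0, ∫_J c ζ(x₁, 0) dx₁)` for all `ζ ∈ C_c^∞(ℝ²)` whose support meets the
boundary line only in `J × {0}`. -/
def HasTraceOn (u : ℂ → ℝ) (G : ℂ → ℂ) (J : Set ℝ) (c : ℝ) : Prop :=
  ∀ ζ : ℂ → ℝ, IsTest ζ → (∀ t : ℝ, (t : ℂ) ∈ tsupport ζ → t ∈ J) →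
    ∫ z in halfPlane, (u z • gradient ζ z + ζ z • G z) =
      -(((∫ t in J, c * ζ (t : ℂ) : ℝ) : ℂ) * Complex.I)

/-- Weak form of `Δu = 0` in `ℝ²₊` together with `∂u/∂x₂ = 0` on `(-∞, -1) × {0}` and
`(1, ∞) × {0}`: `∫_{ℝ²₊} ∇u · ∇ζ dx = 0` for all `ζ ∈ C_c^∞(ℝ²)` whose support does not meet
`[-1, 1] × {0}`. -/
def IsWeaklyHarmonicNeumann (G : ℂ → ℂ) : Prop :=
  ∀ ζ : ℂ → ℝ, IsTest ζ → (∀ t : ℝ, (t : ℂ) ∈ tsupport ζ → t < -1 ∨ 1 < t) →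
    ∫ z in halfPlane, inner ℝ (G z) (gradient ζ z) = 0

/-- `u` is a solution in `Ẇ_*^{1,2}(ℝ²₊; 0)` of the mixed boundary value problem: `Δu = 0` in
`ℝ²₊`, `u = π/2` on `(-1, 0) × {0}`, `u = -π/2` on `(0, 1) × {0}`, `∂u/∂x₂ = 0` on
`(-∞, -1) × {0}` and `(1, ∞) × {0}`. -/
def IsSolution (u : ℂ → ℝ) : Prop :=
  ∃ G : ℂ → ℂ, MemWStar u G ∧
    HasTraceOn u G (Set.Ioo (-1) 0) (Real.pi / 2) ∧
    HasTraceOn u G (Set.Ioo 0 1) (-(Real.pi / 2)) ∧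
    IsWeaklyHarmonicNeumann G

end NeelWall

namespace NeelWall

section

open Complex ComplexConjugate

/-! ### Gradients of real functions on the plane -/

/-! Everything is read in the coordinate w = w₁ + i w₂ = F⁻¹(z). Since |cosh w ± 1| = cosh w₁ ± cos
w₂, both coordinates have closed forms, cosh w₁ = `ellA z` and cos w₂ = `ellB z`, continuous on all
of ℂ ∖ {0} and even under conjugation. Hence u = arcsin (`ellB`), which gives the bound, the decay
and the oddness. The asymptotics at 0 follow from an exact formula for (F⁻¹)′ + 1/z
(`norm_deriv_Finv_add_inv_le`).

Existence. On (-1,0) and (0,1) the coordinate w₂ equals 0 and π, so u = π/2 - w₂ has the right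
Dirichlet data. On |t| ≥ 1 the conjugate function w₁ vanishes, and its vanishing tangential
derivative is the Neumann condition for u. Both facts reduce to a Gauss–Green formula without
boundary term (`setIntegral_halfPlane_product_eq_zero`). The energy of u outside B_r is the area of
its image in the strip, which lies in a rectangle of length 2 log(1/r + 2)
(`lintegral_deriv_Finv_le`). Membership in the completion is shown for the even reflection of u, cut
off at 0 and flattened near its critical values (`memHomSobolev_cutoff_mul_reflPotential`).

Uniqueness. Let d be the difference of two solutions and H its gradient. Zero traces make H weakly
curl-free up to the Dirichlet part, even against test functions that are a nonzero constant near 0;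
the Neumann condition makes H divergence-free. These equations are conformally invariant and move to
the strip. Testing with a(w₁) sin(n w₂) and b(w₁) cos(n w₂) shows that the sine coefficients P of
the first component and the cosine coefficients Q of the second satisfy P′ = nQ and Q′ = nP on
(0,∞), with P(0) = 0. Thus P + Q is a multiple of exp(nx) and P - Q of exp(-nx). The logarithmic
energy bound becomes linear growth in the strip and kills the first; P(0) = 0 kills the second
(`sinCoeff_cosCoeff_succ`). The mode n = 0 would survive any growth argument; it is removed by the
test functions that do not vanish at 0 (`cosCoeff_zero`). Completeness of the trigonometric system
gives H = 0, and moving test functions along segments to the Dirichlet part gives d = 0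
(`IsHomogeneousSolution.ae_eq_zero`). -/

lemma inner_eq (a b : ℂ) : inner ℝ a b = a.re * b.re + a.im * b.im := by
  rw [Complex.inner]; simp [Complex.mul_re]; ring

lemma gradient_re (f : ℂ → ℝ) (z : ℂ) : (gradient f z).re = fderiv ℝ f z 1 := by
  have := inner_gradient_left (𝕜 := ℝ) (f := f) (x := z) (y := (1 : ℂ))
  rw [inner_eq] at this
  simpa using this

lemma gradient_im (f : ℂ → ℝ) (z : ℂ) : (gradient f z).im = fderiv ℝ f z I := by
  have := inner_gradient_left (𝕜 := ℝ) (f := f) (x := z) (y := I)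
  rw [inner_eq] at this
  simpa using this

lemma gradient_mul {f g : ℂ → ℝ} {z : ℂ} (hf : DifferentiableAt ℝ f z)
    (hg : DifferentiableAt ℝ g z) :
    gradient (fun z => f z * g z) z = f z • gradient g z + g z • gradient f z := by
  apply Complex.ext <;>
    simp [gradient_re, gradient_im, fderiv_fun_mul hf hg]

lemma gradient_comp_real {θ : ℝ → ℝ} {f : ℂ → ℝ} {z : ℂ} (hθ : DifferentiableAt ℝ θ (f z))
    (hf : DifferentiableAt ℝ f z) :
    gradient (fun z => θ (f z)) z = deriv θ (f z) • gradient f z := by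
  have h : fderiv ℝ (fun z => θ (f z)) z = deriv θ (f z) • fderiv ℝ f z := by
    have := (hθ.hasDerivAt.hasFDerivAt.comp z hf.hasFDerivAt).fderiv
    simp only [Function.comp_def] at this
    rw [this]
    ext v
    simp [mul_comm]
  apply Complex.ext <;> simp [gradient_re, gradient_im, h]

lemma hasFDerivAt_real_of_hasDerivAt {f : ℂ → ℂ} {f' z : ℂ} (hf : HasDerivAt f f' z) :
    HasFDerivAt f (f' • (1 : ℂ →L[ℝ] ℂ)) z :=
  hf.complexToReal_fderiv

/-- The differential of a holomorphic map is multiplication by f′, and its real adjoint is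
multiplication by the conjugate of f′. -/
lemma gradient_comp_holomorphic {ψ : ℂ → ℝ} {f : ℂ → ℂ} {f' z : ℂ} (hf : HasDerivAt f f' z)
    (hψ : DifferentiableAt ℝ ψ (f z)) :
    gradient (fun z => ψ (f z)) z = conj f' * gradient ψ (f z) := by
  have h := (hψ.hasFDerivAt.comp z (hasFDerivAt_real_of_hasDerivAt hf)).fderiv
  simp only [Function.comp_def] at h
  have key : ∀ v : ℂ, fderiv ℝ ψ (f z) v = v.re * fderiv ℝ ψ (f z) 1 +
      v.im * fderiv ℝ ψ (f z) I := by
    intro v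
    have : v = v.re • (1 : ℂ) + v.im • I := by simp
    conv_lhs => rw [this]
    simp only [map_add, map_smul, smul_eq_mul]
  apply Complex.ext
  · rw [gradient_re, h]
    simp only [ContinuousLinearMap.comp_apply, smul_apply,
      one_apply_eq_self, smul_eq_mul, mul_one, mul_re, conj_re, conj_im,
      gradient_re, gradient_im]
    rw [key]; ring
  · rw [gradient_im, h]
    simp only [ContinuousLinearMap.comp_apply, smul_apply,
      one_apply_eq_self, smul_eq_mul, mul_im, conj_re, conj_im,
      gradient_re, gradient_im]
    rw [key]; simp; ring

lemma gradient_reCLM (z : ℂ) : gradient (fun z : ℂ => z.re) z = 1 := by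
  have : fderiv ℝ (fun z : ℂ => z.re) z = reCLM := reCLM.fderiv
  apply Complex.ext <;> simp [gradient_re, gradient_im, this]

lemma gradient_imCLM (z : ℂ) : gradient (fun z : ℂ => z.im) z = I := by
  have : fderiv ℝ (fun z : ℂ => z.im) z = imCLM := imCLM.fderiv
  apply Complex.ext <;> simp [gradient_re, gradient_im, this]

lemma gradient_re_comp {f : ℂ → ℂ} {f' z : ℂ} (hf : HasDerivAt f f' z) :
    gradient (fun z => (f z).re) z = conj f' := by
  have := gradient_comp_holomorphic (ψ := fun z => z.re) hf reCLM.differentiableAt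
  rw [this, gradient_reCLM, mul_one]

lemma gradient_im_comp {f : ℂ → ℂ} {f' z : ℂ} (hf : HasDerivAt f f' z) :
    gradient (fun z => (f z).im) z = conj f' * I := by
  have := gradient_comp_holomorphic (ψ := fun z => z.im) hf imCLM.differentiableAt
  rw [this, gradient_imCLM]

lemma ContDiff.continuous_gradient {f : ℂ → ℝ} (hf : ContDiff ℝ 1 f) :
    Continuous (gradient f) :=
  (InnerProductSpace.toDual ℝ ℂ).symm.continuous.comp (hf.continuous_fderiv one_ne_zero)

lemma tsupport_gradient_subset (f : ℂ → ℝ) : tsupport (gradient f) ⊆ tsupport f := by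
  refine closure_minimal (fun z hz => ?_) isClosed_closure
  apply support_fderiv_subset ℝ (f := f)
  intro h
  exact hz (by rw [gradient, h]; simp)

lemma gradient_eq_zero_of_notMem {f : ℂ → ℝ} {z : ℂ} (hz : z ∉ tsupport f) :
    gradient f z = 0 := by
  by_contra h
  exact hz (tsupport_gradient_subset f (subset_tsupport _ h))

lemma norm_gradient_eq (f : ℂ → ℝ) (z : ℂ) : ‖gradient f z‖ = ‖fderiv ℝ f z‖ :=
  (InnerProductSpace.toDual ℝ ℂ).symm.norm_map _

/-! ### Test functions -/

lemma IsTest.contDiff_one {f : ℂ → ℝ} (hf : IsTest f) : ContDiff ℝ 1 f :=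
  hf.1.of_le (by norm_cast)

lemma IsTest.differentiable {f : ℂ → ℝ} (hf : IsTest f) : Differentiable ℝ f :=
  hf.contDiff_one.differentiable one_ne_zero

lemma IsTest.continuous_gradient {f : ℂ → ℝ} (hf : IsTest f) : Continuous (gradient f) :=
  ContDiff.continuous_gradient hf.contDiff_one

lemma IsTest.hasCompactSupport_gradient {f : ℂ → ℝ} (hf : IsTest f) :
    HasCompactSupport (gradient f) :=
  hf.2.mono' ((subset_tsupport _).trans (tsupport_gradient_subset f))

lemma IsTest.fderiv_apply {f : ℂ → ℝ} (hf : IsTest f) (v : ℂ) :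
    IsTest (fun z => fderiv ℝ f z v) :=
  ⟨(hf.1.fderiv_right (m := ∞) (by norm_cast)).clm_apply contDiff_const, hf.2.fderiv_apply ℝ v⟩

lemma tsupport_fderiv_apply_subset' (f : ℂ → ℝ) (v : ℂ) :
    tsupport (fun z => fderiv ℝ f z v) ⊆ tsupport f :=
  tsupport_fderiv_apply_subset ℝ v

lemma IsTest.mul_left {f g : ℂ → ℝ} (hf : IsTest f) (hg : ContDiff ℝ ∞ g) :
    IsTest (fun z => g z * f z) :=
  ⟨hg.mul hf.1, hf.2.mul_left⟩

lemma IsTest.integral_gradient {f : ℂ → ℝ} (hf : IsTest f) : ∫ z, gradient f z = 0 := by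
  have hi : Integrable (gradient f) :=
    hf.continuous_gradient.integrable_of_hasCompactSupport hf.hasCompactSupport_gradient
  have key : ∀ v : ℂ, ∫ z, fderiv ℝ f z v = 0 := by
    intro v
    have h1 := (hf.fderiv_apply v).1.continuous.integrable_of_hasCompactSupport (μ := volume)
      (hf.fderiv_apply v).2
    have := integral_mul_fderiv_eq_neg_fderiv_mul_of_integrable (μ := (volume : Measure ℂ))
      (f := fun _ => (1 : ℝ)) (g := f) (v := v) (by simp) (by simpa using h1)
      (by simpa using hf.1.continuous.integrable_of_hasCompactSupport hf.2)
      (fun x _ => by fun_prop) (fun x _ => hf.differentiable x)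
    simpa using this
  apply Complex.ext
  · have := reCLM.integral_comp_comm hi
    simp only [reCLM_apply] at this
    rw [← this]
    simpa [gradient_re] using key 1
  · have := imCLM.integral_comp_comm hi
    simp only [imCLM_apply] at this
    rw [← this]
    simpa [gradient_im] using key I

/-! ### Elliptic coordinates -/

/-- `(|z - 1| + |z + 1|) / (2 |z|)`, which equals `cosh w₁` for `z = F(w)`. -/
noncomputable def ellA (z : ℂ) : ℝ := (‖z - 1‖ + ‖z + 1‖) / (2 * ‖z‖)

/-- `(|z - 1| - |z + 1|) / (2 |z|)`, which equals `cos w₂` for `z = F(w)`. -/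
noncomputable def ellB (z : ℂ) : ℝ := (‖z - 1‖ - ‖z + 1‖) / (2 * ‖z‖)

/-- The coordinate `w₁` as a function of `z = F(w)`. -/
noncomputable def coordX (z : ℂ) : ℝ := Real.arcosh (ellA z)

/-- The coordinate `w₂` as a function of `z = F(w)`. -/
noncomputable def coordY (z : ℂ) : ℝ := Real.arccos (ellB z)

lemma cosh_re (w : ℂ) : (cosh w).re = Real.cosh w.re * Real.cos w.im := by
  conv_lhs => rw [← Complex.re_add_im w]
  rw [Complex.cosh_add, Complex.cosh_mul_I, Complex.sinh_mul_I]
  simp [← Complex.ofReal_cosh, ← Complex.ofReal_sinh, ← Complex.ofReal_cos, ← Complex.ofReal_sin]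

/-- Focal-distance identity for the confocal ellipses and hyperbolas traced by cosh. Both sides are
nonnegative, so it suffices to compare squares. Together with its companion for cosh w - 1 it makes
the two coordinates explicit. -/
lemma norm_cosh_add_one (w : ℂ) : ‖cosh w + 1‖ = Real.cosh w.re + Real.cos w.im := by
  have h0 : 0 ≤ Real.cosh w.re + Real.cos w.im := by
    linarith [Real.one_le_cosh w.re, Real.neg_one_le_cos w.im]
  rw [← abs_of_nonneg h0, ← abs_norm, ← sq_eq_sq_iff_abs_eq_abs, ← normSq_eq_norm_sq, normSq_apply]
  simp only [add_re, one_re, add_im, one_im, cosh_re, cosh_im]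
  have h1 := Real.cosh_sq w.re
  have h2 := Real.sin_sq_add_cos_sq w.im
  have h3 : Real.sin w.im ^ 2 = 1 - Real.cos w.im ^ 2 := by linarith
  ring_nf
  rw [h3, h1]
  ring

lemma norm_cosh_sub_one (w : ℂ) : ‖cosh w - 1‖ = Real.cosh w.re - Real.cos w.im := by
  have h0 : 0 ≤ Real.cosh w.re - Real.cos w.im := by
    linarith [Real.one_le_cosh w.re, Real.cos_le_one w.im]
  rw [← abs_of_nonneg h0, ← abs_norm, ← sq_eq_sq_iff_abs_eq_abs, ← normSq_eq_norm_sq, normSq_apply]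
  simp only [sub_re, one_re, sub_im, one_im, cosh_re, cosh_im]
  have h1 := Real.cosh_sq w.re
  have h2 := Real.sin_sq_add_cos_sq w.im
  have h3 : Real.sin w.im ^ 2 = 1 - Real.cos w.im ^ 2 := by linarith
  ring_nf
  rw [h3, h1]
  ring

lemma normSq_cosh (w : ℂ) : ‖cosh w‖ ^ 2 = Real.sinh w.re ^ 2 + Real.cos w.im ^ 2 := by
  rw [← normSq_eq_norm_sq, normSq_apply, cosh_re, cosh_im]
  have h1 := Real.cosh_sq w.re
  have h2 := Real.sin_sq_add_cos_sq w.im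
  have h3 : Real.sin w.im ^ 2 = 1 - Real.cos w.im ^ 2 := by linarith
  ring_nf
  rw [h3, h1]
  ring

lemma cosh_ne_zero_of_mem_strip {w : ℂ} (hw : w ∈ strip) : cosh w ≠ 0 := fun h0 => by
  have h := cosh_im_pos hw
  simp [h0] at h

lemma norm_F (w : ℂ) : ‖F w‖ = 1 / ‖cosh w‖ := by simp [F]

lemma norm_F_sub_one {w : ℂ} (hw : cosh w ≠ 0) :
    ‖F w - 1‖ = (Real.cosh w.re + Real.cos w.im) / ‖cosh w‖ := by
  have : F w - 1 = -((cosh w + 1) / cosh w) := by rw [F]; field_simp; ring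
  rw [this, norm_neg, norm_div, norm_cosh_add_one]

lemma norm_F_add_one {w : ℂ} (hw : cosh w ≠ 0) :
    ‖F w + 1‖ = (Real.cosh w.re - Real.cos w.im) / ‖cosh w‖ := by
  have : F w + 1 = (cosh w - 1) / cosh w := by rw [F]; field_simp; ring
  rw [this, norm_div, norm_cosh_sub_one]

lemma ellA_F {w : ℂ} (hw : cosh w ≠ 0) : ellA (F w) = Real.cosh w.re := by
  have := norm_pos_iff.2 hw
  rw [ellA, norm_F, norm_F_sub_one hw, norm_F_add_one hw]
  field_simp
  ring

lemma ellB_F {w : ℂ} (hw : cosh w ≠ 0) : ellB (F w) = Real.cos w.im := by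
  have := norm_pos_iff.2 hw
  rw [ellB, norm_F, norm_F_sub_one hw, norm_F_add_one hw]
  field_simp
  ring

lemma coordX_F {w : ℂ} (hw : w ∈ strip) : coordX (F w) = w.re := by
  rw [coordX, ellA_F (cosh_ne_zero_of_mem_strip hw), Real.arcosh_cosh hw.1.le]

lemma coordY_F {w : ℂ} (hw : w ∈ strip) : coordY (F w) = w.im := by
  rw [coordY, ellB_F (cosh_ne_zero_of_mem_strip hw), Real.arccos_cos hw.2.1.le hw.2.2.le]

lemma Finv_mem {z : ℂ} (hz : z ∈ halfPlane) : Finv z ∈ strip :=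
  Function.invFunOn_mem (bijOn_F.surjOn hz)

lemma F_Finv {z : ℂ} (hz : z ∈ halfPlane) : F (Finv z) = z :=
  Function.invFunOn_eq (bijOn_F.surjOn hz)

lemma Finv_re {z : ℂ} (hz : z ∈ halfPlane) : (Finv z).re = coordX z := by
  conv_rhs => rw [← F_Finv hz]
  rw [coordX_F (Finv_mem hz)]

lemma Finv_im {z : ℂ} (hz : z ∈ halfPlane) : (Finv z).im = coordY z := by
  conv_rhs => rw [← F_Finv hz]
  rw [coordY_F (Finv_mem hz)]

lemma ne_zero_of_mem_halfPlane {z : ℂ} (hz : z ∈ halfPlane) : z ≠ 0 := fun h => by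
  simp [h, halfPlane] at hz

lemma isOpen_halfPlane : IsOpen halfPlane := isOpen_lt continuous_const continuous_im

lemma isOpen_strip : IsOpen strip :=
  (isOpen_lt continuous_const continuous_re).inter
    ((isOpen_lt continuous_const continuous_im).inter (isOpen_lt continuous_im continuous_const))

lemma one_lt_ellA_of_mem {z : ℂ} (hz : z ∈ halfPlane) : 1 < ellA z := by
  have hs := Finv_mem hz
  rw [← F_Finv hz, ellA_F (cosh_ne_zero_of_mem_strip hs)]
  exact Real.one_lt_cosh.2 hs.1.ne'

lemma abs_ellB_lt_one_of_mem {z : ℂ} (hz : z ∈ halfPlane) : |ellB z| < 1 := by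
  have hs := Finv_mem hz
  rw [← F_Finv hz, ellB_F (cosh_ne_zero_of_mem_strip hs)]
  have h1 := Real.sin_pos_of_pos_of_lt_pi hs.2.1 hs.2.2
  have h2 := Real.sin_sq_add_cos_sq (Finv z).im
  rw [← sq_lt_one_iff_abs_lt_one]
  nlinarith

lemma ellB_conj (z : ℂ) : ellB (conj z) = ellB z := by
  have h1 : conj z - 1 = conj (z - 1) := by simp
  have h2 : conj z + 1 = conj (z + 1) := by simp
  rw [ellB, ellB, h1, h2, norm_conj, norm_conj, norm_conj]

lemma ellB_neg (z : ℂ) : ellB (-z) = -ellB z := by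
  have h1 : -z - 1 = -(z + 1) := by ring
  have h2 : -z + 1 = -(z - 1) := by ring
  rw [ellB, ellB, h1, h2, norm_neg, norm_neg, norm_neg]
  ring

lemma ellA_ofReal (t : ℝ) : ellA t = (|t - 1| + |t + 1|) / (2 * |t|) := by
  rw [ellA, ← ofReal_one, ← ofReal_sub, ← ofReal_add, norm_real, norm_real, norm_real]; rfl

lemma ellB_ofReal (t : ℝ) : ellB t = (|t - 1| - |t + 1|) / (2 * |t|) := by
  rw [ellB, ← ofReal_one, ← ofReal_sub, ← ofReal_add, norm_real, norm_real, norm_real]; rfl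

lemma conj_mem_halfPlane {z : ℂ} (hz : z.im < 0) : conj z ∈ halfPlane := by
  simpa [halfPlane] using hz

lemma abs_ellB_lt_one_of_im_ne {z : ℂ} (hz : z.im ≠ 0) : |ellB z| < 1 := by
  rcases hz.lt_or_gt with h | h
  · rw [← ellB_conj]; exact abs_ellB_lt_one_of_mem (conj_mem_halfPlane h)
  · exact abs_ellB_lt_one_of_mem h

lemma ofReal_re_of_im_eq {z : ℂ} (hz : z.im = 0) : ((z.re : ℝ) : ℂ) = z :=
  Complex.ext rfl (by simp [hz])

lemma ellA_ofReal_of_one_le {t : ℝ} (ht : 1 ≤ |t|) : ellA t = 1 := by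
  rw [ellA_ofReal]
  rcases le_abs.1 ht with h | h
  · rw [abs_of_nonneg (by linarith), abs_of_nonneg (by linarith), abs_of_nonneg (by linarith)]
    field_simp; ring
  · have : t ≠ 0 := by intro h0; simp [h0] at h; linarith
    rw [abs_of_nonpos (by linarith), abs_of_nonpos (by linarith : t + 1 ≤ 0),
      abs_of_nonpos (by linarith : t ≤ 0)]
    field_simp; ring

lemma ellB_ofReal_of_neg {t : ℝ} (h1 : -1 ≤ t) (h2 : t < 0) : ellB t = 1 := by
  rw [ellB_ofReal, abs_of_nonpos (by linarith : t - 1 ≤ 0), abs_of_nonneg (by linarith : 0 ≤ t + 1),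
    abs_of_neg h2]
  have := h2.ne
  field_simp; ring

lemma ellB_ofReal_of_pos {t : ℝ} (h1 : t ≤ 1) (h2 : 0 < t) : ellB t = -1 := by
  have := ellB_ofReal_of_neg (t := -t) (by linarith) (by linarith)
  rw [ofReal_neg, ellB_neg] at this
  linarith

lemma norm_pos_half (z : ℂ) (hz : z ≠ 0) : 0 < 2 * ‖z‖ := by
  have := norm_pos_iff.2 hz; positivity

lemma one_le_ellA {z : ℂ} (hz : z ≠ 0) : 1 ≤ ellA z := by
  rw [ellA, le_div_iff₀ (norm_pos_half z hz), one_mul]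
  calc 2 * ‖z‖ = ‖(z - 1) + (z + 1)‖ := by
        rw [show (z - 1) + (z + 1) = 2 * z by ring]; simp
    _ ≤ _ := norm_add_le _ _

/-- The foci 1 and -1 are at distance 2, so the sum of the distances to them is at least 2. This is
what drives `coordX` to infinity at the origin. -/
lemma inv_norm_le_ellA {z : ℂ} (hz : z ≠ 0) : 1 / ‖z‖ ≤ ellA z := by
  rw [ellA, div_le_div_iff₀ (norm_pos_iff.2 hz) (norm_pos_half z hz)]
  have : 2 ≤ ‖z - 1‖ + ‖z + 1‖ := by
    calc (2 : ℝ) = ‖(z + 1) - (z - 1)‖ := by ring_nf; simp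
      _ ≤ ‖z + 1‖ + ‖z - 1‖ := norm_sub_le _ _
      _ = _ := add_comm _ _
  nlinarith [norm_nonneg z]

lemma ellA_le {z : ℂ} (hz : z ≠ 0) : ellA z ≤ 1 + 1 / ‖z‖ := by
  have h0 := norm_pos_iff.2 hz
  rw [ellA, div_le_iff₀ (norm_pos_half z hz)]
  have h1 : ‖z - 1‖ ≤ ‖z‖ + 1 := by simpa using norm_sub_le z 1
  have h2 : ‖z + 1‖ ≤ ‖z‖ + 1 := by simpa using norm_add_le z 1
  have : (1 + 1 / ‖z‖) * (2 * ‖z‖) = 2 * ‖z‖ + 2 := by field_simp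
  linarith

/-- The distances to the two foci differ by at most 2. This is the source of the decay of the
potential at infinity. -/
lemma abs_ellB_le {z : ℂ} (hz : z ≠ 0) : |ellB z| ≤ 1 / ‖z‖ := by
  have h0 := norm_pos_iff.2 hz
  rw [ellB, abs_div, abs_of_pos (norm_pos_half z hz), div_le_div_iff₀ (norm_pos_half z hz) h0]
  have : |‖z - 1‖ - ‖z + 1‖| ≤ 2 := by
    calc _ ≤ ‖(z - 1) - (z + 1)‖ := abs_norm_sub_norm_le _ _
      _ = 2 := by ring_nf; simp
  nlinarith [norm_nonneg z]

lemma abs_ellB_le_one {z : ℂ} (hz : z ≠ 0) : |ellB z| ≤ 1 := by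
  have h0 := norm_pos_iff.2 hz
  rw [ellB, abs_div, abs_of_pos (norm_pos_half z hz), div_le_one (norm_pos_half z hz)]
  have h2 : |‖z - 1‖ - ‖z + 1‖| = |‖1 - z‖ - ‖z + 1‖| := by rw [norm_sub_rev]
  rw [abs_sub_le_iff]
  have e : ∀ a b : ℂ, ‖a‖ ≤ ‖b‖ + ‖a - b‖ := fun a b => by
    calc ‖a‖ = ‖b + (a - b)‖ := by ring_nf
      _ ≤ _ := norm_add_le _ _
  have e1 : ‖(z - 1) + (z + 1)‖ = 2 * ‖z‖ := by
    rw [show (z - 1) + (z + 1) = 2 * z by ring]; simp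
  have e2 := e (z - 1) (-(z + 1))
  have e3 := e (z + 1) (-(z - 1))
  rw [norm_neg] at e2 e3
  rw [show z - 1 - -(z + 1) = (z - 1) + (z + 1) by ring, e1] at e2
  rw [show z + 1 - -(z - 1) = (z - 1) + (z + 1) by ring, e1] at e3
  constructor <;> linarith

lemma continuousAt_ellA {z : ℂ} (hz : z ≠ 0) : ContinuousAt ellA z := by
  have := norm_pos_half z hz
  unfold ellA
  exact ContinuousAt.div (by fun_prop) (by fun_prop) this.ne'

lemma continuousAt_ellB {z : ℂ} (hz : z ≠ 0) : ContinuousAt ellB z := by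
  have := norm_pos_half z hz
  unfold ellB
  exact ContinuousAt.div (by fun_prop) (by fun_prop) this.ne'

lemma contDiffAt_ellA {z : ℂ} (hz : z ≠ 0) (h1 : z ≠ 1) (h2 : z ≠ -1) :
    ContDiffAt ℝ ∞ ellA z := by
  have := norm_pos_half z hz
  unfold ellA
  have e1 : ContDiffAt ℝ ∞ (fun z : ℂ => ‖z - 1‖) z :=
    (contDiffAt_id.sub contDiffAt_const).norm ℝ (sub_ne_zero.2 h1)
  have e2 : ContDiffAt ℝ ∞ (fun z : ℂ => ‖z + 1‖) z :=
    (contDiffAt_id.add contDiffAt_const).norm ℝ (fun h => h2 (eq_neg_of_add_eq_zero_left h))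
  have e3 : ContDiffAt ℝ ∞ (fun z : ℂ => ‖z‖) z := contDiffAt_id.norm ℝ hz
  exact (e1.add e2).div (contDiffAt_const.mul e3) this.ne'

lemma contDiffAt_ellB {z : ℂ} (hz : z ≠ 0) (h1 : z ≠ 1) (h2 : z ≠ -1) :
    ContDiffAt ℝ ∞ ellB z := by
  have := norm_pos_half z hz
  unfold ellB
  have e1 : ContDiffAt ℝ ∞ (fun z : ℂ => ‖z - 1‖) z :=
    (contDiffAt_id.sub contDiffAt_const).norm ℝ (sub_ne_zero.2 h1)
  have e2 : ContDiffAt ℝ ∞ (fun z : ℂ => ‖z + 1‖) z :=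
    (contDiffAt_id.add contDiffAt_const).norm ℝ (fun h => h2 (eq_neg_of_add_eq_zero_left h))
  have e3 : ContDiffAt ℝ ∞ (fun z : ℂ => ‖z‖) z := contDiffAt_id.norm ℝ hz
  exact (e1.sub e2).div (contDiffAt_const.mul e3) this.ne'

/-- Continuity holds across the whole real line apart from 0, including the rays |t| ≥ 1 where
`ellA` attains 1. There `arcosh` is only used from within [1,∞), which suffices because `ellA` never
drops below 1. -/
lemma continuousAt_coordX {z : ℂ} (hz : z ≠ 0) : ContinuousAt coordX z := by
  have h : ContinuousWithinAt Real.arcosh (Set.Ici 1) (ellA z) :=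
    Real.continuousOn_arcosh _ (one_le_ellA hz)
  have : Tendsto ellA (𝓝 z) (𝓝[Set.Ici 1] (ellA z)) := by
    refine tendsto_nhdsWithin_iff.2 ⟨continuousAt_ellA hz, ?_⟩
    filter_upwards [isOpen_ne.mem_nhds hz] with w hw using one_le_ellA hw
  exact h.tendsto.comp this

lemma continuousAt_coordY {z : ℂ} (hz : z ≠ 0) : ContinuousAt coordY z :=
  Real.continuous_arccos.continuousAt.comp (continuousAt_ellB hz)

lemma coordX_nonneg {z : ℂ} (hz : z ≠ 0) : 0 ≤ coordX z := Real.arcosh_nonneg (one_le_ellA hz)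

lemma cosh_coordX {z : ℂ} (hz : z ≠ 0) : Real.cosh (coordX z) = ellA z :=
  Real.cosh_arcosh (one_le_ellA hz)

lemma ellA_ne_one_ne {z : ℂ} (h : 1 < ellA z) : z ≠ 0 ∧ z ≠ 1 ∧ z ≠ -1 := by
  refine ⟨?_, ?_, ?_⟩ <;> rintro rfl <;> revert h
  · simp [ellA]
  · have := ellA_ofReal_of_one_le (t := 1) (by simp); simp at this; simp [this]
  · have := ellA_ofReal_of_one_le (t := -1) (by simp); simp at this; simp [this]

/-- Smoothness is lost only where `ellA` = 1, so `coordX` is smooth across the open Dirichlet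
intervals. For `coordY` the roles are reversed: the bad set is where |`ellB`| = 1. -/
lemma contDiffAt_coordX {z : ℂ} (h : 1 < ellA z) : ContDiffAt ℝ ∞ coordX z := by
  obtain ⟨h0, h1, h2⟩ := ellA_ne_one_ne h
  exact (Real.contDiffAt_arcosh h).comp z (contDiffAt_ellA h0 h1 h2)

lemma abs_ellB_lt_one_ne {z : ℂ} (h0 : z ≠ 0) (h : |ellB z| < 1) : z ≠ 1 ∧ z ≠ -1 := by
  refine ⟨?_, ?_⟩ <;> rintro rfl <;> revert h
  · have := ellB_ofReal_of_pos (t := 1) (by simp) (by simp); simp at this; simp [this]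
  · have := ellB_ofReal_of_neg (t := -1) (by simp) (by simp); simp at this; simp [this]

lemma contDiffAt_coordY {z : ℂ} (h0 : z ≠ 0) (h : |ellB z| < 1) : ContDiffAt ℝ ∞ coordY z := by
  obtain ⟨h1, h2⟩ := abs_ellB_lt_one_ne h0 h
  obtain ⟨h3, h4⟩ := abs_lt.1 h
  exact (Real.contDiffAt_arccos h3.ne' h4.ne).comp z (contDiffAt_ellB h0 h1 h2)

/-! ### The conformal map and its inverse -/

lemma hasDerivAt_F {w : ℂ} (hw : cosh w ≠ 0) : HasDerivAt F (sinh w / cosh w ^ 2) w := by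
  unfold F
  have := (hasDerivAt_const w (-1 : ℂ)).div (hasDerivAt_cosh w) hw
  convert! this using 1
  simp

lemma norm_sinh_sq_le {w : ℂ} : ‖cosh w‖ ^ 2 - 1 ≤ ‖sinh w‖ ^ 2 := by
  have h : cosh w ^ 2 = sinh w ^ 2 + 1 := Complex.cosh_sq w
  have := norm_add_le (sinh w ^ 2) 1
  rw [← h] at this
  simp at this
  linarith

lemma sinh_ne_zero_of_mem_strip {w : ℂ} (hw : w ∈ strip) : sinh w ≠ 0 := by
  intro h0
  have h : cosh w ^ 2 = 1 := by rw [Complex.cosh_sq, h0]; ring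
  have him := cosh_im_pos hw
  rcases sq_eq_one_iff.1 h with h1 | h1 <;> simp [h1] at him

lemma deriv_F_ne_zero {w : ℂ} (hw : w ∈ strip) : sinh w / cosh w ^ 2 ≠ 0 :=
  div_ne_zero (sinh_ne_zero_of_mem_strip hw) (pow_ne_zero 2 (cosh_ne_zero_of_mem_strip hw))

lemma continuousAt_Finv {z : ℂ} (hz : z ∈ halfPlane) : ContinuousAt Finv z := by
  have h0 := ne_zero_of_mem_halfPlane hz
  have : ContinuousAt (fun z => (coordX z : ℂ) + coordY z * I) z :=
    (continuous_ofReal.continuousAt.comp (continuousAt_coordX h0)).add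
      ((continuous_ofReal.continuousAt.comp (continuousAt_coordY h0)).mul continuousAt_const)
  refine this.congr ?_
  filter_upwards [isOpen_halfPlane.mem_nhds hz] with y hy
  rw [← Finv_re hy, ← Finv_im hy, re_add_im]

lemma hasDerivAt_Finv {z : ℂ} (hz : z ∈ halfPlane) :
    HasDerivAt Finv (cosh (Finv z) ^ 2 / sinh (Finv z)) z := by
  have hs := Finv_mem hz
  -- Continuity of the inverse is already known from the explicit coordinates, so the nonvanishing
  -- derivative of `F` is enough.
  have := HasDerivAt.of_local_left_inverse (continuousAt_Finv hz)
    (hasDerivAt_F (cosh_ne_zero_of_mem_strip hs)) (deriv_F_ne_zero hs)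
    (by filter_upwards [isOpen_halfPlane.mem_nhds hz] with _ hy using F_Finv hy)
  rwa [inv_div] at this

lemma hasDerivAt_deriv_Finv {z : ℂ} (hz : z ∈ halfPlane) : HasDerivAt Finv (deriv Finv z) z := by
  rw [(hasDerivAt_Finv hz).deriv]; exact hasDerivAt_Finv hz

lemma analyticAt_Finv {z : ℂ} (hz : z ∈ halfPlane) : AnalyticAt ℂ Finv z :=
  DifferentiableOn.analyticAt (s := halfPlane)
    (fun _ hy => (hasDerivAt_Finv hy).differentiableAt.differentiableWithinAt)
    (isOpen_halfPlane.mem_nhds hz)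

/-! ### The potential: closed form, bound, decay, symmetry and behaviour at the origin. -/

lemma potential_eq (z : ℂ) : potential z = Real.pi / 2 - (Finv z).im := by
  have : Real.pi * I / 2 = ((Real.pi / 2 : ℝ) : ℂ) * I := by push_cast; ring
  rw [potential, sub_im, this]
  simp

lemma potential_eq_arcsin {z : ℂ} (hz : z ∈ halfPlane) : potential z = Real.arcsin (ellB z) := by
  rw [potential_eq, Finv_im hz, coordY, Real.arccos]; ring

lemma harmonicOnNhd_potential : InnerProductSpace.HarmonicOnNhd potential halfPlane := by
  intro z hz
  exact (analyticAt_const.sub (analyticAt_Finv hz)).harmonicAt_im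

lemma abs_potential_le {z : ℂ} (hz : z ∈ halfPlane) : |potential z| ≤ Real.pi / 2 := by
  rw [potential_eq_arcsin hz]
  exact abs_le.2 ⟨Real.neg_pi_div_two_le_arcsin _, Real.arcsin_le_pi_div_two _⟩

lemma tendsto_ellB_cobounded : Tendsto ellB (Bornology.cobounded ℂ) (𝓝 0) := by
  have h1 : Tendsto (fun z : ℂ => 1 / ‖z‖) (Bornology.cobounded ℂ) (𝓝 0) := by
    simpa [Function.comp_def] using tendsto_inv_atTop_zero.comp (tendsto_norm_cobounded_atTop (E := ℂ))
  refine squeeze_zero_norm' ?_ h1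
  have : ∀ᶠ z : ℂ in Bornology.cobounded ℂ, z ≠ 0 := by
    filter_upwards [(tendsto_norm_cobounded_atTop (E := ℂ)).eventually_gt_atTop 0] with z hz
    exact norm_pos_iff.1 hz
  filter_upwards [this] with z hz using abs_ellB_le hz

lemma tendsto_potential :
    Tendsto potential (Bornology.cobounded ℂ ⊓ 𝓟 halfPlane) (𝓝 0) := by
  have h : Tendsto (fun z => Real.arcsin (ellB z)) (Bornology.cobounded ℂ) (𝓝 0) := by
    have := (Real.continuous_arcsin.tendsto 0).comp tendsto_ellB_cobounded
    simpa [Function.comp_def] using this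
  refine (h.mono_left inf_le_left).congr' ?_
  filter_upwards [mem_inf_of_right (mem_principal_self halfPlane)] with z hz
  exact (potential_eq_arcsin hz).symm

lemma potential_odd (x₁ x₂ : ℝ) (h : 0 < x₂) :
    potential ⟨x₁, x₂⟩ = -potential ⟨-x₁, x₂⟩ := by
  have h1 : (⟨x₁, x₂⟩ : ℂ) = -conj (⟨-x₁, x₂⟩ : ℂ) := by apply Complex.ext <;> simp
  rw [potential_eq_arcsin (by exact h), potential_eq_arcsin (by exact h), h1, ellB_neg, ellB_conj,
    Real.arcsin_neg]

lemma gradient_potential {z : ℂ} (hz : z ∈ halfPlane) :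
    gradient potential z = -(conj (deriv Finv z) * I) := by
  have h := gradient_im_comp ((hasDerivAt_const z (Real.pi * I / 2)).sub (hasDerivAt_deriv_Finv hz))
  rw [zero_sub, map_neg, neg_mul] at h
  exact h

lemma gradient_coordX {z : ℂ} (hz : z ∈ halfPlane) :
    gradient coordX z = conj (deriv Finv z) := by
  rw [← gradient_re_comp (hasDerivAt_deriv_Finv hz)]
  apply Filter.EventuallyEq.gradient_eq
  filter_upwards [isOpen_halfPlane.mem_nhds hz] with y hy using (Finv_re hy).symm

lemma gradient_potential_eq {z : ℂ} (hz : z ∈ halfPlane) :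
    gradient potential z = -(gradient coordX z * I) := by
  rw [gradient_potential hz, gradient_coordX hz]

/-- Since 1/z = -cosh w, the sum collapses to cosh w · exp(-w) / sinh w. The numerator has modulus
at most 1. For |z| < 1/2 one has |cosh w| ≥ 2, so |sinh w| ≥ |cosh w| / 2 = 1 / (2|z|). -/
lemma norm_deriv_Finv_add_inv_le {z : ℂ} (hz : z ∈ halfPlane) (hz2 : ‖z‖ < 1 / 2) :
    ‖deriv Finv z + 1 / z‖ ≤ 2 * ‖z‖ := by
  have hs := Finv_mem hz
  rw [(hasDerivAt_Finv hz).deriv]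
  set w := Finv z with hw
  have hc := cosh_ne_zero_of_mem_strip hs
  have hsn := sinh_ne_zero_of_mem_strip hs
  have hzF : z = -1 / cosh w := (F_Finv hz).symm
  have hnz : ‖z‖ = 1 / ‖cosh w‖ := by rw [hzF]; simp
  have hcpos := norm_pos_iff.2 hc
  have hc2 : 2 ≤ ‖cosh w‖ := by
    rw [hnz, div_lt_div_iff₀ hcpos two_pos] at hz2
    linarith
  have hkey : cosh w ^ 2 / sinh w + 1 / z = cosh w * exp (-w) / sinh w := by
    rw [← Complex.cosh_sub_sinh, hzF]; field_simp; ring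
  have hexp : ‖exp (-w)‖ = Real.exp (-w.re) := by rw [Complex.norm_exp]; simp
  have hcosh : ‖cosh w‖ ≤ Real.cosh w.re := by
    rw [← abs_of_pos (Real.cosh_pos w.re), ← abs_norm, ← sq_le_sq, normSq_cosh, Real.cosh_sq]
    linarith [Real.cos_sq_le_one w.im]
  have hle : ‖cosh w‖ * Real.exp (-w.re) ≤ 1 := by
    have h1 : Real.cosh w.re ≤ Real.exp w.re := by
      rw [Real.cosh_eq]
      linarith [Real.exp_le_exp.2 (by linarith [hs.1] : -w.re ≤ w.re)]
    calc _ ≤ Real.exp w.re * Real.exp (-w.re) := by gcongr; exact hcosh.trans h1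
      _ = 1 := by rw [← Real.exp_add]; simp
  have hsinh : ‖cosh w‖ / 2 ≤ ‖sinh w‖ := by
    have := norm_sinh_sq_le (w := w)
    refine le_of_sq_le_sq ?_ (norm_nonneg _)
    nlinarith
  have hspos := norm_pos_iff.2 hsn
  rw [hkey, norm_div, norm_mul, hexp, hnz, div_le_iff₀ hspos]
  refine hle.trans ?_
  rw [mul_one_div, div_mul_eq_mul_div, le_div_iff₀ hcpos]
  linarith

lemma norm_gradient_potential_sub_le {z : ℂ} (hz : z ∈ halfPlane) (hz2 : ‖z‖ < 1 / 2) :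
    ‖gradient potential z - (1 / ‖z‖ ^ 2) • perp z‖ ≤ 2 * ‖z‖ := by
  have h0 := ne_zero_of_mem_halfPlane hz
  have hp : perp z = z * I := by apply Complex.ext <;> simp [perp]
  have : gradient potential z - (1 / ‖z‖ ^ 2) • perp z = -(conj (deriv Finv z + 1 / z) * I) := by
    rw [gradient_potential hz, hp, map_add, map_div₀, map_one, ← normSq_eq_norm_sq, real_smul]
    have : 1 / conj z = ((1 / normSq z : ℝ) : ℂ) * z := by
      push_cast
      rw [← mul_conj]
      have : conj z ≠ 0 := by simpa using h0
      field_simp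
    rw [this]
    ring
  rw [this, norm_neg, norm_mul, norm_I, mul_one, norm_conj]
  exact norm_deriv_Finv_add_inv_le hz hz2

/-! ### Area formulas -/

lemma det_smul_one (c : ℂ) : (c • (1 : ℂ →L[ℝ] ℂ)).det = ‖c‖ ^ 2 := by
  have h : ((c • (1 : ℂ →L[ℝ] ℂ) : ℂ →L[ℝ] ℂ) : ℂ →ₗ[ℝ] ℂ) = Algebra.lmul ℝ ℂ c := by
    ext; simp
  rw [ContinuousLinearMap.det, h, ← Algebra.norm_apply, Algebra.norm_complex_apply,
    normSq_eq_norm_sq]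

lemma injOn_Finv : Set.InjOn Finv halfPlane := fun a ha b hb h => by
  rw [← F_Finv ha, h, F_Finv hb]

lemma measurableSet_outer (r : ℝ) : MeasurableSet (outer r) :=
  isOpen_halfPlane.measurableSet.diff Metric.isOpen_ball.measurableSet

lemma outer_subset_halfPlane (r : ℝ) : outer r ⊆ halfPlane := Set.sdiff_subset

lemma norm_ge_of_mem_outer {r : ℝ} {z : ℂ} (hz : z ∈ outer r) : r ≤ ‖z‖ := by
  simpa using hz.2

lemma outer_anti {r s : ℝ} (h : r ≤ s) : outer s ⊆ outer r :=
  Set.sdiff_subset_sdiff_right (Metric.ball_subset_ball h)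

lemma volume_reProdIm (s t : Set ℝ) :
    volume (s ×ℂ t) = volume s * volume t := by
  have h := Complex.volume_preserving_equiv_real_prod.measure_preimage_equiv (s ×ˢ t)
  rw [← Measure.prod_prod, ← Measure.volume_eq_prod, ← h]
  rfl

/-- The integrand is the Jacobian of the injective conformal map, so the integral is the area of the
image. On `outer r` one has sinh w₁ ≤ |cosh w| ≤ 1/r, hence exp(w₁) ≤ 2/r + 1 ≤ (1/r + 2)², which
confines the image to a rectangle of height π. -/
lemma lintegral_deriv_Finv_le {r : ℝ} (hr : 0 < r) :
    ∫⁻ z in outer r, ‖deriv Finv z‖ₑ ^ 2 ≤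
      ENNReal.ofReal (2 * Real.pi * Real.log (1 / r + 2)) := by
  have h1 := lintegral_abs_det_fderiv_eq_addHaar_image volume (measurableSet_outer r)
    (fun z hz => (hasFDerivAt_real_of_hasDerivAt
      (hasDerivAt_deriv_Finv (outer_subset_halfPlane r hz))).hasFDerivWithinAt)
    (injOn_Finv.mono (outer_subset_halfPlane r))
  have h2 : ∫⁻ z in outer r, ‖deriv Finv z‖ₑ ^ 2 = volume (Finv '' outer r) := by
    rw [← h1]
    refine lintegral_congr fun z => ?_
    rw [det_smul_one, abs_of_nonneg (sq_nonneg _), ENNReal.ofReal_pow (norm_nonneg _),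
      ofReal_norm]
  have h3 : Finv '' outer r ⊆ Set.Icc 0 (2 * Real.log (1 / r + 2)) ×ℂ Set.Icc 0 Real.pi := by
    rintro _ ⟨z, hz, rfl⟩
    have hzh := outer_subset_halfPlane r hz
    have hs := Finv_mem hzh
    refine ⟨⟨hs.1.le, ?_⟩, hs.2.1.le, hs.2.2.le⟩
    set w := Finv z with hw
    have hn : r ≤ 1 / ‖cosh w‖ := by
      rw [← norm_F, hw, F_Finv hzh]; exact norm_ge_of_mem_outer hz
    have hc := norm_pos_iff.2 (cosh_ne_zero_of_mem_strip hs)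
    have h4 : ‖cosh w‖ ≤ 1 / r := by
      rw [le_div_iff₀ hc] at hn
      rw [le_div_iff₀ hr]; linarith
    have h5 : Real.sinh w.re ≤ 1 / r := by
      refine le_trans (le_of_sq_le_sq ?_ hc.le) h4
      rw [normSq_cosh]; nlinarith [sq_nonneg (Real.cos w.im)]
    have h6 : Real.exp w.re ≤ 2 * (1 / r) + 1 := by
      rw [Real.sinh_eq] at h5
      have : Real.exp (-w.re) ≤ 1 := Real.exp_le_one_iff.2 (by linarith [hs.1])
      linarith
    have hr' : 0 < 1 / r := by positivity
    rw [← Real.exp_le_exp, two_mul, Real.exp_add, Real.exp_log (by linarith)]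
    nlinarith
  rw [h2]
  refine (measure_mono h3).trans ?_
  rw [volume_reProdIm, Real.volume_Icc, Real.volume_Icc, ← ENNReal.ofReal_mul]
  · apply ENNReal.ofReal_le_ofReal; ring_nf; rfl
  · have : 0 < 1 / r := by positivity
    have := Real.log_nonneg (by linarith : 1 ≤ 1 / r + 2)
    linarith

lemma eLpNorm_two_sq {α E : Type*} [MeasurableSpace α] [NormedAddCommGroup E] (f : α → E)
    (μ : Measure α) : eLpNorm f 2 μ ^ 2 = ∫⁻ x, ‖f x‖ₑ ^ 2 ∂μ := by
  rw [eLpNorm_eq_lintegral_rpow_enorm_toReal (by norm_num) (by norm_num), ← ENNReal.rpow_natCast,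
    ← ENNReal.rpow_mul]
  simp

lemma memLp_two_of_lintegral {α E : Type*} [MeasurableSpace α] [NormedAddCommGroup E] {f : α → E}
    {μ : Measure α} (hf : AEStronglyMeasurable f μ) (h : ∫⁻ x, ‖f x‖ₑ ^ 2 ∂μ < ⊤) :
    MemLp f 2 μ := by
  refine ⟨hf, ?_⟩
  rw [← eLpNorm_two_sq] at h
  exact (ENNReal.pow_lt_top_iff (n := 2)).1 h |>.resolve_right two_ne_zero

lemma measurable_gradient (f : ℂ → ℝ) : Measurable (gradient f) :=
  (InnerProductSpace.toDual ℝ ℂ).symm.continuous.measurable.comp (measurable_fderiv ℝ f)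

lemma memLp_deriv_Finv {r : ℝ} (hr : 0 < r) :
    MemLp (fun z => ‖deriv Finv z‖) 2 (volume.restrict (outer r)) := by
  refine memLp_two_of_lintegral (measurable_deriv Finv).norm.aestronglyMeasurable ?_
  simp only [enorm_norm]
  exact (lintegral_deriv_Finv_le hr).trans_lt ENNReal.ofReal_lt_top

/-! ### Smooth truncations -/

/-- A smooth function vanishing for `s ≤ 1/(n+4)` and equal to `s` for `s ≥ 2/(n+4)`. -/
noncomputable def trunc (n : ℕ) (s : ℝ) : ℝ := s * Real.smoothTransition ((n + 4) * s - 1)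

lemma contDiff_trunc (n : ℕ) : ContDiff ℝ ∞ (trunc n) :=
  contDiff_id.mul (Real.smoothTransition.contDiff.comp (by fun_prop))

lemma differentiable_trunc (n : ℕ) : Differentiable ℝ (trunc n) :=
  (contDiff_trunc n).differentiable (by norm_cast)

lemma trunc_of_le {n : ℕ} {s : ℝ} (h : (n + 4) * s ≤ 1) : trunc n s = 0 := by
  rw [trunc, Real.smoothTransition.zero_of_nonpos (by linarith), mul_zero]

lemma trunc_of_nonpos {n : ℕ} {s : ℝ} (h : s ≤ 0) : trunc n s = 0 :=
  trunc_of_le (by nlinarith [Nat.cast_nonneg (α := ℝ) n])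

lemma trunc_of_ge {n : ℕ} {s : ℝ} (h : 2 ≤ (n + 4) * s) : trunc n s = s := by
  rw [trunc, Real.smoothTransition.one_of_one_le (by linarith), mul_one]

lemma abs_trunc_le (n : ℕ) (s : ℝ) : |trunc n s| ≤ |s| := by
  rw [trunc, abs_mul, abs_of_nonneg (Real.smoothTransition.nonneg _)]
  exact mul_le_of_le_one_right (abs_nonneg s) (Real.smoothTransition.le_one _)

lemma trunc_eventuallyEq_zero {n : ℕ} {s : ℝ} (h : (n + 4) * s < 1) : trunc n =ᶠ[𝓝 s] 0 := by
  have : ContinuousAt (fun s : ℝ => (n + 4) * s) s := by fun_prop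
  filter_upwards [this.eventually_lt_const h] with y hy using trunc_of_le hy.le

lemma eventually_mul_gt {s : ℝ} (hs : 0 < s) (c : ℝ) : ∀ᶠ n : ℕ in atTop, c < (n + 4) * s := by
  have : Tendsto (fun n : ℕ => ((n : ℝ) + 4) * s) atTop atTop :=
    (tendsto_atTop_add_const_right _ _ tendsto_natCast_atTop_atTop).atTop_mul_const hs
  exact this.eventually_gt_atTop c

lemma eventually_trunc_eventuallyEq {s : ℝ} (hs : 0 < s) :
    ∀ᶠ n : ℕ in atTop, trunc n =ᶠ[𝓝 s] id := by
  filter_upwards [eventually_mul_gt hs 2] with n hn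
  have : ContinuousAt (fun s : ℝ => (n + 4) * s) s := by fun_prop
  filter_upwards [this.eventually_const_lt hn] with y hy using trunc_of_ge hy.le

lemma exists_abs_deriv_smoothTransition_le :
    ∃ M : ℝ, ∀ s, |deriv Real.smoothTransition s| ≤ M := by
  have hc : Continuous (deriv Real.smoothTransition) :=
    (Real.smoothTransition.contDiff (n := 1)).continuous_deriv le_rfl
  have hs : HasCompactSupport (deriv Real.smoothTransition) := by
    refine HasCompactSupport.intro (isCompact_Icc (a := (0 : ℝ)) (b := 1)) fun s hs => ?_
    rw [Set.mem_Icc, not_and_or, not_le, not_le] at hs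
    rcases hs with h | h
    · have : Real.smoothTransition =ᶠ[𝓝 s] fun _ => 0 := by
        filter_upwards [eventually_lt_nhds h] with y hy
          using Real.smoothTransition.zero_of_nonpos hy.le
      rw [this.deriv_eq, deriv_const]
    · have : Real.smoothTransition =ᶠ[𝓝 s] fun _ => 1 := by
        filter_upwards [eventually_gt_nhds h] with y hy
          using Real.smoothTransition.one_of_one_le hy.le
      rw [this.deriv_eq, deriv_const]
  obtain ⟨M, hM⟩ := hs.exists_bound_of_continuous hc
  exact ⟨M, fun s => by simpa using hM s⟩

/-- Differentiating the transition costs a factor n + 4, but it is only active for (n + 4) s ≤ 2,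
where the prefactor s compensates. Uniformity in n is what dominated convergence needs later. -/
lemma exists_abs_deriv_trunc_le : ∃ K : ℝ, 1 ≤ K ∧ ∀ n s, |deriv (trunc n) s| ≤ K := by
  obtain ⟨M, hM⟩ := exists_abs_deriv_smoothTransition_le
  have hM0 : 0 ≤ M := (abs_nonneg _).trans (hM 0)
  refine ⟨1 + 2 * M, by linarith, fun n s => ?_⟩
  have hn : (0 : ℝ) < n + 4 := by positivity
  rcases lt_or_ge ((n + 4) * s) 1 with h | h
  · rw [(trunc_eventuallyEq_zero h).deriv_eq]
    simp only [Pi.zero_def, deriv_const, abs_zero]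
    linarith
  rcases lt_or_ge 2 ((n + 4) * s) with h2 | h2
  · have : ContinuousAt (fun s : ℝ => (n + 4) * s) s := by fun_prop
    have : trunc n =ᶠ[𝓝 s] id := by
      filter_upwards [this.eventually_const_lt h2] with y hy using trunc_of_ge hy.le
    rw [this.deriv_eq, deriv_id, abs_one]
    linarith
  · have h1 : HasDerivAt (fun s : ℝ => (n + 4) * s - 1) (n + 4) s := by
      simpa using ((hasDerivAt_id s).const_mul ((n : ℝ) + 4)).sub_const 1
    have h3 : HasDerivAt Real.smoothTransition (deriv Real.smoothTransition ((n + 4) * s - 1))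
        ((n + 4) * s - 1) :=
      ((Real.smoothTransition.contDiff (n := 1)).differentiable one_ne_zero _).hasDerivAt
    have h4 := (hasDerivAt_id s).mul (h3.comp s h1)
    have h5 : deriv (trunc n) s = Real.smoothTransition ((n + 4) * s - 1) +
        ((n + 4) * s) * deriv Real.smoothTransition ((n + 4) * s - 1) := by
      have := h4.deriv
      simp only [id, one_mul, Function.comp_apply] at this
      rw [show (trunc n) = (id * (Real.smoothTransition ∘ fun s : ℝ => (n + 4) * s - 1)) from rfl]
      rw [this]; ring
    rw [h5]
    refine (abs_add_le _ _).trans (add_le_add ?_ ?_)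
    · rw [abs_of_nonneg (Real.smoothTransition.nonneg _)]
      exact Real.smoothTransition.le_one _
    · rw [abs_mul]
      refine mul_le_mul ?_ (hM _) (abs_nonneg _) (by norm_num)
      rw [abs_le]; constructor <;> linarith

/-! ### Integration over the half-plane -/

lemma ae_im_ne_zero : ∀ᵐ z : ℂ, z.im ≠ 0 := by
  have h : volume ((Set.univ : Set ℝ) ×ℂ ({0} : Set ℝ)) = 0 := by simp [volume_reProdIm]
  rw [ae_iff]
  convert h using 2
  ext z; simp [mem_reProdIm]

lemma ae_re_ne_zero : ∀ᵐ z : ℂ, z.re ≠ 0 := by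
  have h : volume (({0} : Set ℝ) ×ℂ (Set.univ : Set ℝ)) = 0 := by simp [volume_reProdIm]
  rw [ae_iff]
  convert h using 2
  ext z; simp [mem_reProdIm]

lemma setIntegral_reProdIm {E : Type*} [NormedAddCommGroup E] [NormedSpace ℝ E] (s t : Set ℝ)
    (f : ℂ → E) : ∫ z in s ×ℂ t, f z = ∫ p in s ×ˢ t, f ⟨p.1, p.2⟩ :=
  Complex.volume_preserving_equiv_real_prod.setIntegral_preimage_emb
    measurableEquivRealProd.measurableEmbedding (fun p => f ⟨p.1, p.2⟩) (s ×ˢ t)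

lemma integrableOn_reProdIm {E : Type*} [NormedAddCommGroup E] (s t : Set ℝ)
    (f : ℂ → E) : IntegrableOn f (s ×ℂ t) ↔
      IntegrableOn (fun p : ℝ × ℝ => f ⟨p.1, p.2⟩) (s ×ˢ t) :=
  Complex.volume_preserving_equiv_real_prod.integrableOn_comp_preimage
    measurableEquivRealProd.measurableEmbedding (f := fun p : ℝ × ℝ => f ⟨p.1, p.2⟩) (s := s ×ˢ t)

lemma halfPlane_eq : halfPlane = Set.univ ×ℂ Set.Ioi 0 := by
  ext z; simp [halfPlane, mem_reProdIm]

lemma setIntegral_halfPlane_fderiv_one {ζ : ℂ → ℝ} (hζ : IsTest ζ) :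
    ∫ z in halfPlane, fderiv ℝ ζ z 1 = 0 := by
  have hi : IntegrableOn (fun z => fderiv ℝ ζ z 1) halfPlane :=
    ((hζ.fderiv_apply 1).1.continuous.integrable_of_hasCompactSupport
      (hζ.fderiv_apply 1).2).integrableOn
  rw [halfPlane_eq, integrableOn_reProdIm] at hi
  have hi' : IntegrableOn (fun p : ℝ × ℝ => fderiv ℝ ζ ⟨p.2, p.1⟩ 1) (Set.Ioi 0 ×ˢ Set.univ)
    (volume.prod volume) := hi.swap
  rw [halfPlane_eq, setIntegral_reProdIm, Measure.volume_eq_prod, ← setIntegral_prod_swap]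
  refine (setIntegral_prod _ hi').trans ?_
  refine (setIntegral_congr_fun measurableSet_Ioi fun y _ => ?_).trans (integral_zero _ _)
  have hcl : IsClosedEmbedding (fun x : ℝ => (⟨x, y⟩ : ℂ)) := by
    refine Isometry.isClosedEmbedding (Isometry.of_dist_eq fun a b => ?_)
    exact Complex.dist_of_im_eq rfl
  have hd : ∀ x : ℝ, HasDerivAt (fun x : ℝ => (⟨x, y⟩ : ℂ)) 1 x := fun x => by
    have : HasDerivAt (fun x : ℝ => (x : ℂ) + y * I) 1 x :=
      (ofRealCLM.hasDerivAt (x := x)).add_const _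
    simpa [← mk_eq_add_mul_I] using this
  have h1 : HasCompactSupport (fun x : ℝ => ζ ⟨x, y⟩) := hζ.2.comp_isClosedEmbedding hcl
  have h2 : HasCompactSupport (fun x : ℝ => fderiv ℝ ζ ⟨x, y⟩ 1) :=
    (hζ.fderiv_apply 1).2.comp_isClosedEmbedding hcl
  simp only [Measure.restrict_univ]
  exact integral_eq_zero_of_hasDerivAt_of_integrable
    (fun x => (hζ.differentiable _).hasFDerivAt.comp_hasDerivAt x (hd x))
    (((hζ.fderiv_apply 1).1.continuous.comp hcl.continuous).integrable_of_hasCompactSupport h2)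
    ((hζ.1.continuous.comp hcl.continuous).integrable_of_hasCompactSupport h1)

lemma setIntegral_halfPlane_fderiv_I {ζ : ℂ → ℝ} (hζ : IsTest ζ) :
    ∫ z in halfPlane, fderiv ℝ ζ z I = -∫ t : ℝ, ζ t := by
  have hi : IntegrableOn (fun z => fderiv ℝ ζ z I) halfPlane :=
    ((hζ.fderiv_apply I).1.continuous.integrable_of_hasCompactSupport
      (hζ.fderiv_apply I).2).integrableOn
  rw [halfPlane_eq, integrableOn_reProdIm] at hi
  rw [halfPlane_eq, setIntegral_reProdIm, Measure.volume_eq_prod, setIntegral_prod _ hi,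
    Measure.restrict_univ, ← integral_neg]
  refine integral_congr_ae (Eventually.of_forall fun x => ?_)
  have hcl : IsClosedEmbedding (fun y : ℝ => (⟨x, y⟩ : ℂ)) := by
    refine Isometry.isClosedEmbedding (Isometry.of_dist_eq fun a b => ?_)
    exact Complex.dist_of_re_eq rfl
  have hd : ∀ y : ℝ, HasDerivAt (fun y : ℝ => (⟨x, y⟩ : ℂ)) I y := fun y => by
    have : HasDerivAt (fun y : ℝ => (x : ℂ) + y * I) (1 * I) y :=
      ((ofRealCLM.hasDerivAt (x := y)).mul_const I).const_add _
    simpa [← mk_eq_add_mul_I] using this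
  have hc : ContDiff ℝ 1 (fun y : ℝ => (⟨x, y⟩ : ℂ)) := by
    have : ContDiff ℝ 1 (fun y : ℝ => (x : ℂ) + y * I) :=
      contDiff_const.add (ofRealCLM.contDiff.mul contDiff_const)
    simpa [← mk_eq_add_mul_I] using this
  have h1 : HasCompactSupport (ζ ∘ fun y : ℝ => (⟨x, y⟩ : ℂ)) := hζ.2.comp_isClosedEmbedding hcl
  have := h1.integral_Ioi_deriv_eq (hζ.contDiff_one.comp hc) 0
  have e : ∀ y : ℝ, deriv (ζ ∘ fun y : ℝ => (⟨x, y⟩ : ℂ)) y = fderiv ℝ ζ ⟨x, y⟩ I := fun y =>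
    ((hζ.differentiable _).hasFDerivAt.comp_hasDerivAt y (hd y)).deriv
  simp only [e, Function.comp_apply] at this
  exact this

lemma setIntegral_re {f : ℂ → ℂ} {s : Set ℂ} (hf : IntegrableOn f s) :
    (∫ z in s, f z).re = ∫ z in s, (f z).re :=
  (reCLM.integral_comp_comm hf).symm

lemma setIntegral_im {f : ℂ → ℂ} {s : Set ℂ} (hf : IntegrableOn f s) :
    (∫ z in s, f z).im = ∫ z in s, (f z).im :=
  (imCLM.integral_comp_comm hf).symm

lemma IsTest.integrable_gradient {ζ : ℂ → ℝ} (hζ : IsTest ζ) : Integrable (gradient ζ) :=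
  hζ.continuous_gradient.integrable_of_hasCompactSupport hζ.hasCompactSupport_gradient

lemma setIntegral_halfPlane_gradient {ζ : ℂ → ℝ} (hζ : IsTest ζ) :
    ∫ z in halfPlane, gradient ζ z = -(((∫ t : ℝ, ζ t : ℝ) : ℂ) * I) := by
  have hi := hζ.integrable_gradient.integrableOn (s := halfPlane)
  apply Complex.ext
  · rw [setIntegral_re hi]
    simp [gradient_re, setIntegral_halfPlane_fderiv_one hζ]
  · rw [setIntegral_im hi]
    simp [gradient_im, setIntegral_halfPlane_fderiv_I hζ]

/-- If `∇ξ` integrates against `V` like `-ξ K` for the two partial derivatives `ξ` of `ζ`, then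
`K` is orthogonal to the rotated gradient of `ζ`. -/
lemma integral_inner_rotated_gradient_eq_zero {V : ℂ → ℝ} {K : ℂ → ℂ} {ζ : ℂ → ℝ} {s : Set ℂ}
    (hζ : IsTest ζ)
    (hi : ∀ v : ℂ, IntegrableOn (fun z => V z • gradient (fun z => fderiv ℝ ζ z v) z +
      (fderiv ℝ ζ z v) • K z) s)
    (h : ∀ v : ℂ, ∫ z in s, (V z • gradient (fun z => fderiv ℝ ζ z v) z +
      (fderiv ℝ ζ z v) • K z) = 0) :
    ∫ z in s, inner ℝ (K z) (I * gradient ζ z) = 0 := by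
  -- Combine the imaginary part for v = 1 with the real part for v = I: the terms containing V are
  -- mixed second derivatives of ζ and cancel by symmetry, leaving only K against the rotated
  -- gradient.
  have h1 := congrArg re (h I)
  have h2 := congrArg im (h 1)
  rw [setIntegral_re (hi _), zero_re] at h1
  rw [setIntegral_im (hi _), zero_im] at h2
  have h3 := integral_sub (hi 1).im (hi I).re
  have h3' : ∫ z in s, ((V z • gradient (fun z => fderiv ℝ ζ z 1) z +
      (fderiv ℝ ζ z 1) • K z).im - (V z • gradient (fun z => fderiv ℝ ζ z I) z +
      (fderiv ℝ ζ z I) • K z).re) = 0 := by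
    refine h3.trans ?_
    simp only [RCLike.re_to_complex, RCLike.im_to_complex]
    rw [h1, h2, sub_zero]
  rw [← h3']
  refine integral_congr_ae (Eventually.of_forall fun z => ?_)
  have hsym : IsSymmSndFDerivAt ℝ ζ z := hζ.1.contDiffAt.isSymmSndFDerivAt (by
    rw [minSmoothness_of_isRCLikeNormedField]; norm_cast)
  have hd : DifferentiableAt ℝ (fderiv ℝ ζ) z :=
    ((hζ.1.fderiv_right (m := ∞) (by norm_cast)).differentiable (by norm_cast)) z
  have e : ∀ v u : ℂ, fderiv ℝ (fun z => fderiv ℝ ζ z v) z u = fderiv ℝ (fderiv ℝ ζ) z u v := by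
    intro v u
    have := (hd.hasFDerivAt.clm_apply (hasFDerivAt_const v z)).fderiv
    rw [this]; simp
  simp only [inner_eq, add_re, add_im, smul_re, smul_im, gradient_re, gradient_im, mul_re, mul_im,
    I_re, I_im, e, smul_eq_mul]
  rw [hsym I 1]
  ring

/-! ### Products with functions of finite Dirichlet energy away from the origin -/

lemma exists_ball_disjoint_tsupport {E : Type*} [Zero E] {g : ℂ → E} (h0 : (0 : ℂ) ∉ tsupport g) :
    ∃ r : ℝ, 0 < r ∧ ∀ z, z ∈ Metric.ball (0 : ℂ) r → g z = 0 := by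
  obtain ⟨r, hr, h⟩ := Metric.isOpen_iff.1 (isClosed_tsupport g).isOpen_compl 0 h0
  exact ⟨r, hr, fun z hz => image_eq_zero_of_notMem_tsupport (h hz)⟩

lemma integrableOn_halfPlane_of_outer {E F : Type*} [NormedAddCommGroup E] [Zero F] {f : ℂ → E}
    {g : ℂ → F} (hf : ∀ r : ℝ, 0 < r → IntegrableOn f (outer r))
    (h0 : (0 : ℂ) ∉ tsupport g) (hg : ∀ z, g z = 0 → f z = 0) : IntegrableOn f halfPlane := by
  obtain ⟨r, hr, h⟩ := exists_ball_disjoint_tsupport h0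
  refine (hf r hr).of_forall_sdiff_eq_zero isOpen_halfPlane.measurableSet fun z hz => hg z (h z ?_)
  by_contra hb
  exact hz.2 ⟨hz.1, hb⟩

lemma integrableOn_halfPlane_smul {g : ℂ → ℝ} {G : ℂ → ℂ} (hg : Continuous g)
    (hgc : HasCompactSupport g) (h0 : (0 : ℂ) ∉ tsupport g)
    (hG : ∀ r : ℝ, 0 < r → MemLp G 2 (volume.restrict (outer r))) :
    IntegrableOn (fun z => g z • G z) halfPlane := by
  refine integrableOn_halfPlane_of_outer (fun r hr => ?_) h0 (fun z hz => by simp [hz])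
  have h1 : MemLp g 2 (volume.restrict (outer r)) :=
    (hg.memLp_of_hasCompactSupport hgc).restrict _
  exact memLp_one_iff_integrable.1 ((hG r hr).smul h1 (r := 1))

lemma integrableOn_halfPlane_inner {g : ℂ → ℂ} {G : ℂ → ℂ} (hg : Continuous g)
    (hgc : HasCompactSupport g) (h0 : (0 : ℂ) ∉ tsupport g)
    (hG : ∀ r : ℝ, 0 < r → MemLp G 2 (volume.restrict (outer r))) :
    IntegrableOn (fun z => inner ℝ (G z) (g z)) halfPlane := by
  refine integrableOn_halfPlane_of_outer (fun r hr => ?_) h0 (fun z hz => by simp [hz])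
  have h1 : MemLp g 2 (volume.restrict (outer r)) :=
    (hg.memLp_of_hasCompactSupport hgc).restrict _
  have h2 := (hG r hr).norm.integrable_mul h1.norm
  refine Integrable.mono' h2 ((hG r hr).1.inner h1.1) (Eventually.of_forall fun z => ?_)
  exact norm_inner_le_norm _ _

/-- A function `V` on the half-plane which is continuous up to the boundary (except at the origin)
and has finite Dirichlet energy away from the origin satisfies the Gauss–Green formula without
boundary term against test functions `ζ` whose support meets the boundary only where `V = 0`. -/
lemma setIntegral_halfPlane_product_eq_zero {V ζ : ℂ → ℝ} (hVc : ∀ z, z ≠ 0 → ContinuousAt V z)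
    (hVpos : ∀ z ∈ halfPlane, 0 < V z) (hVs : ∀ z ∈ halfPlane, ContDiffAt ℝ ∞ V z)
    (hVg : ∀ r : ℝ, 0 < r → MemLp (gradient V) 2 (volume.restrict (outer r)))
    (hζ : IsTest ζ) (h0 : (0 : ℂ) ∉ tsupport ζ)
    (hV0 : ∀ t : ℝ, (t : ℂ) ∈ tsupport ζ → V t = 0) :
    IntegrableOn (fun z => V z • gradient ζ z + ζ z • gradient V z) halfPlane ∧
    ∫ z in halfPlane, (V z • gradient ζ z + ζ z • gradient V z) = 0 := by
  obtain ⟨K, hK1, hK⟩ := exists_abs_deriv_trunc_le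
  have hne : ∀ z ∈ tsupport ζ, z ≠ 0 := fun z hz h => h0 (h ▸ hz)
  have hVon : ContinuousOn V (tsupport ζ) := fun z hz => (hVc z (hne z hz)).continuousWithinAt
  obtain ⟨M, hM⟩ := hζ.2.isCompact.exists_bound_of_continuousOn hVon
  have hVcont : ContinuousOn V halfPlane := fun z hz =>
    (hVc z (ne_zero_of_mem_halfPlane hz)).continuousWithinAt
  have hI2 := integrableOn_halfPlane_smul hζ.1.continuous hζ.2 h0 hVg
  have hbI : IntegrableOn (fun z => M * ‖gradient ζ z‖ + K * ‖ζ z • gradient V z‖) halfPlane :=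
    (hζ.integrable_gradient.integrableOn.norm.const_mul M).add (hI2.norm.const_mul K)
  have hmeas : AEStronglyMeasurable (fun z => V z • gradient ζ z + ζ z • gradient V z)
      (volume.restrict halfPlane) :=
    ((hVcont.aestronglyMeasurable isOpen_halfPlane.measurableSet).smul
      hζ.continuous_gradient.aestronglyMeasurable).add hI2.1
  have hgM : ∀ z, |V z| * ‖gradient ζ z‖ ≤ M * ‖gradient ζ z‖ := fun z => by
    by_cases hz : z ∈ tsupport ζ
    · exact mul_le_mul_of_nonneg_right (hM z hz) (norm_nonneg _)
    · simp [gradient_eq_zero_of_notMem hz]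
  refine ⟨Integrable.mono' hbI hmeas (Eventually.of_forall fun z => ?_), ?_⟩
  · refine (norm_add_le _ _).trans (add_le_add ?_ ?_)
    · rw [norm_smul, Real.norm_eq_abs]; exact hgM z
    · exact le_mul_of_one_le_left (norm_nonneg _) hK1
  -- Near boundary points in the support of ζ, V is so small that `trunc n` kills it. The extension
  -- by zero is therefore a genuine test function on the plane, and its gradient integrates to 0.
  set ψ : ℕ → ℂ → ℝ := fun n => halfPlane.indicator fun z => trunc n (V z) * ζ z with hψ
  have hin : ∀ n, ∀ z ∈ halfPlane, ψ n =ᶠ[𝓝 z] fun z => trunc n (V z) * ζ z := fun n z hz => by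
    filter_upwards [isOpen_halfPlane.mem_nhds hz] with y hy
    exact Set.indicator_of_mem hy _
  have hout : ∀ n z, z.im < 0 → ψ n =ᶠ[𝓝 z] 0 := fun n z hz => by
    filter_upwards [(isOpen_lt continuous_im continuous_const).mem_nhds hz] with y hy
    have hyh : y ∉ halfPlane := fun h => lt_asymm (show 0 < y.im from h) hy
    simp only [hψ, Set.indicator_of_notMem hyh, Pi.zero_apply]
  have htest : ∀ n, IsTest (ψ n) := fun n => by
    refine ⟨contDiff_iff_contDiffAt.2 fun z => ?_, hζ.2.mono fun z hz => ?_⟩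
    · by_cases hzs : z ∈ tsupport ζ
      · rcases lt_trichotomy z.im 0 with h | h | h
        · exact contDiffAt_const.congr_of_eventuallyEq (hout n z h)
        · have hV : V z = 0 := by
            rw [← ofReal_re_of_im_eq h] at hzs ⊢
            exact hV0 _ hzs
          have h2 : trunc n =ᶠ[𝓝 (V z)] (0 : ℝ → ℝ) := trunc_eventuallyEq_zero (by simp [hV])
          refine contDiffAt_const.congr_of_eventuallyEq (f := fun _ => (0 : ℝ)) ?_
          filter_upwards [(hVc z (hne z hzs)).tendsto.eventually h2] with y hy
          by_cases hyh : y ∈ halfPlane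
          · simp only [hψ, Set.indicator_of_mem hyh, hy, Pi.zero_apply, zero_mul]
          · simp only [hψ, Set.indicator_of_notMem hyh]
        · exact (((contDiff_trunc n).contDiffAt.comp z (hVs z h)).mul
            hζ.1.contDiffAt).congr_of_eventuallyEq (hin n z h)
      · refine contDiffAt_const.congr_of_eventuallyEq (f := fun _ => (0 : ℝ)) ?_
        filter_upwards [(isClosed_tsupport ζ).isOpen_compl.mem_nhds hzs] with y hy
        have : ζ y = 0 := image_eq_zero_of_notMem_tsupport hy
        simp only [hψ, Set.indicator]; split_ifs <;> simp [this]
    · intro h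
      apply hz
      simp only [hψ, Set.indicator]; split_ifs <;> simp [h]
  have hgrad : ∀ n, ∀ z ∈ halfPlane, gradient (ψ n) z =
      trunc n (V z) • gradient ζ z + (ζ z * deriv (trunc n) (V z)) • gradient V z := by
    intro n z hz
    have hVd : DifferentiableAt ℝ V z := (hVs z hz).differentiableAt (by norm_cast)
    have hcd : DifferentiableAt ℝ (fun z => trunc n (V z)) z :=
      (differentiable_trunc n _).comp z hVd
    rw [(hin n z hz).gradient_eq, gradient_mul hcd (hζ.differentiable z),
      gradient_comp_real (differentiable_trunc n _) hVd, smul_smul]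
  have hzero : ∀ n, ∫ z in halfPlane, (trunc n (V z) • gradient ζ z +
      (ζ z * deriv (trunc n) (V z)) • gradient V z) = 0 := fun n => by
    rw [← setIntegral_congr_fun isOpen_halfPlane.measurableSet (hgrad n),
      ← (htest n).integral_gradient]
    refine setIntegral_eq_integral_of_ae_compl_eq_zero ?_
    filter_upwards [ae_im_ne_zero] with z hz hzh
    have : z.im < 0 := lt_of_le_of_ne (not_lt.1 hzh) hz
    rw [(hout n z this).gradient_eq]
    exact gradient_const z (0 : ℝ)
  -- Let n → ∞: V is positive inside the half-plane, so at each point `trunc n` is eventually the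
  -- identity near V z, and the derivatives of the truncations are bounded by K throughout.
  have hlim := tendsto_integral_of_dominated_convergence (μ := volume.restrict halfPlane)
    (F := fun n z => trunc n (V z) • gradient ζ z +
      (ζ z * deriv (trunc n) (V z)) • gradient V z)
    (f := fun z => V z • gradient ζ z + ζ z • gradient V z)
    (fun z => M * ‖gradient ζ z‖ + K * ‖ζ z • gradient V z‖) ?_ hbI ?_ ?_
  · simp only [hzero] at hlim
    exact tendsto_nhds_unique hlim tendsto_const_nhds
  · intro n
    refine ((htest n).continuous_gradient.aestronglyMeasurable).congr ?_
    filter_upwards [ae_restrict_mem isOpen_halfPlane.measurableSet] with z hz using hgrad n z hz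
  · intro n
    refine Eventually.of_forall fun z => (norm_add_le _ _).trans (add_le_add ?_ ?_)
    · rw [norm_smul, Real.norm_eq_abs]
      exact (mul_le_mul_of_nonneg_right (abs_trunc_le n _) (norm_nonneg _)).trans (hgM z)
    · rw [mul_comm, mul_smul, norm_smul, Real.norm_eq_abs]
      exact mul_le_mul_of_nonneg_right (hK n _) (norm_nonneg _)
  · filter_upwards [ae_restrict_mem isOpen_halfPlane.measurableSet] with z hz
    refine tendsto_const_nhds.congr' ?_
    filter_upwards [eventually_trunc_eventuallyEq (hVpos z hz)] with n hn
    rw [hn.eq_of_nhds, hn.deriv_eq]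
    simp

/-! ### The potential satisfies the boundary conditions -/

lemma memLp_outer_of_norm_le {G : ℂ → ℂ} {c : ℝ} (hG : Measurable G)
    (h : ∀ z ∈ halfPlane, ‖G z‖ ≤ c * ‖deriv Finv z‖) {r : ℝ} (hr : 0 < r) :
    MemLp G 2 (volume.restrict (outer r)) := by
  refine ((memLp_deriv_Finv hr).const_mul c).mono hG.aestronglyMeasurable ?_
  filter_upwards [ae_restrict_mem (measurableSet_outer r)] with z hz
  exact (h z (outer_subset_halfPlane r hz)).trans (le_abs_self _)

lemma gradient_coordY {z : ℂ} (hz : z ∈ halfPlane) :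
    gradient coordY z = conj (deriv Finv z) * I := by
  rw [← gradient_im_comp (hasDerivAt_deriv_Finv hz)]
  apply Filter.EventuallyEq.gradient_eq
  filter_upwards [isOpen_halfPlane.mem_nhds hz] with y hy using (Finv_im hy).symm

lemma gradient_const_sub (f : ℂ → ℝ) (c : ℝ) (z : ℂ) :
    gradient (fun z => c - f z) z = -gradient f z := by
  apply Complex.ext <;> simp [gradient_re, gradient_im, fderiv_const_sub]

lemma coordY_mem {z : ℂ} (hz : z ∈ halfPlane) : 0 < coordY z ∧ coordY z < Real.pi := by
  rw [← Finv_im hz]; exact (Finv_mem hz).2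

lemma coordX_pos {z : ℂ} (hz : z ∈ halfPlane) : 0 < coordX z := by
  rw [← Finv_re hz]; exact (Finv_mem hz).1

lemma contDiffAt_coordX_of_mem {z : ℂ} (hz : z ∈ halfPlane) : ContDiffAt ℝ ∞ coordX z :=
  contDiffAt_coordX (one_lt_ellA_of_mem hz)

lemma contDiffAt_coordY_of_mem {z : ℂ} (hz : z ∈ halfPlane) : ContDiffAt ℝ ∞ coordY z :=
  contDiffAt_coordY (ne_zero_of_mem_halfPlane hz) (abs_ellB_lt_one_of_mem hz)

/-- V measures the deviation from the boundary value and vanishes on J, so it contributes no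
boundary term; the constant c contributes exactly the required one. -/
lemma hasTraceOn_potential_of_eq {J : Set ℝ} (hJ : (0 : ℝ) ∉ J) {c σ : ℝ} {V : ℂ → ℝ}
    (hVc : ∀ z, z ≠ 0 → ContinuousAt V z) (hVpos : ∀ z ∈ halfPlane, 0 < V z)
    (hVs : ∀ z ∈ halfPlane, ContDiffAt ℝ ∞ V z)
    (hVg : ∀ z ∈ halfPlane, ‖gradient V z‖ ≤ 1 * ‖deriv Finv z‖)
    (hV0 : ∀ t ∈ J, V (t : ℂ) = 0)
    (hp : ∀ z ∈ halfPlane, potential z = c + σ * V z) :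
    HasTraceOn potential (gradient potential) J c := by
  intro ζ hζ hsupp
  have h0 : (0 : ℂ) ∉ tsupport ζ := fun h => hJ (hsupp 0 (by simpa using h))
  obtain ⟨hi, hz⟩ := setIntegral_halfPlane_product_eq_zero hVc hVpos hVs
    (fun r hr => memLp_outer_of_norm_le (measurable_gradient _) hVg hr) hζ h0
    (fun t ht => hV0 t (hsupp t ht))
  have hgp : ∀ z ∈ halfPlane, gradient potential z = σ • gradient V z := fun z hz => by
    have : potential =ᶠ[𝓝 z] fun z => c + σ * V z := by
      filter_upwards [isOpen_halfPlane.mem_nhds hz] with y hy using hp y hy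
    have hd := (hVs z hz).differentiableAt (by norm_cast)
    rw [this.gradient_eq]
    apply Complex.ext <;>
      simp [gradient_re, gradient_im, fderiv_const_add, fderiv_const_mul hd]
  have heq : ∀ z ∈ halfPlane, potential z • gradient ζ z + ζ z • gradient potential z =
      c • gradient ζ z + σ • (V z • gradient ζ z + ζ z • gradient V z) := fun z hz => by
    rw [hgp z hz, hp z hz, add_smul, smul_add, smul_smul, smul_smul, smul_smul, add_assoc,
      mul_comm σ (ζ z)]
  have hA : IntegrableOn (fun z => c • gradient ζ z) halfPlane :=
    hζ.integrable_gradient.integrableOn.smul c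
  have hB : IntegrableOn (fun z => σ • (V z • gradient ζ z + ζ z • gradient V z)) halfPlane :=
    hi.smul σ
  rw [setIntegral_congr_fun isOpen_halfPlane.measurableSet heq, integral_add hA hB, integral_smul,
    integral_smul, hz, smul_zero, add_zero, setIntegral_halfPlane_gradient hζ,
    setIntegral_eq_integral_of_forall_compl_eq_zero (fun t ht => ?_), integral_const_mul]
  · simp [mul_assoc]
  · rw [image_eq_zero_of_notMem_tsupport (fun h => ht (hsupp t h)), mul_zero]

lemma hasTraceOn_potential_left :
    HasTraceOn potential (gradient potential) (Set.Ioo (-1) 0) (Real.pi / 2) := by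
  refine hasTraceOn_potential_of_eq (V := coordY) (σ := -1) (by simp)
    (fun z => continuousAt_coordY) (fun z hz => (coordY_mem hz).1)
    (fun z => contDiffAt_coordY_of_mem) (fun z hz => by rw [gradient_coordY hz]; simp)
    (fun t ht => ?_) (fun z hz => ?_)
  · rw [coordY, ellB_ofReal_of_neg ht.1.le ht.2, Real.arccos_one]
  · rw [potential_eq, Finv_im hz]; ring

lemma hasTraceOn_potential_right :
    HasTraceOn potential (gradient potential) (Set.Ioo 0 1) (-(Real.pi / 2)) := by
  refine hasTraceOn_potential_of_eq (V := fun z => Real.pi - coordY z) (σ := 1) (by simp)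
    (fun z hz => continuousAt_const.sub (continuousAt_coordY hz))
    (fun z hz => sub_pos.2 (coordY_mem hz).2)
    (fun z hz => contDiffAt_const.sub (contDiffAt_coordY_of_mem hz))
    (fun z hz => by rw [gradient_const_sub, gradient_coordY hz]; simp)
    (fun t ht => ?_) (fun z hz => ?_)
  · rw [coordY, ellB_ofReal_of_pos ht.2.le ht.1, Real.arccos_neg_one, sub_self]
  · rw [potential_eq, Finv_im hz]; ring

/-- By Cauchy–Riemann the gradient of the potential is the rotated gradient of `coordX`. As `coordX`
vanishes on |t| ≥ 1, the Gauss–Green formula applies to it with the partial derivatives of ζ as test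
functions. -/
lemma isWeaklyHarmonicNeumann_potential : IsWeaklyHarmonicNeumann (gradient potential) := by
  intro ζ hζ hsupp
  have key : ∀ v : ℂ, IntegrableOn (fun z => coordX z • gradient (fun z => fderiv ℝ ζ z v) z +
      (fderiv ℝ ζ z v) • gradient coordX z) halfPlane ∧
      ∫ z in halfPlane, (coordX z • gradient (fun z => fderiv ℝ ζ z v) z +
      (fderiv ℝ ζ z v) • gradient coordX z) = 0 := by
    intro v
    have hs := tsupport_fderiv_apply_subset' ζ v
    refine setIntegral_halfPlane_product_eq_zero (fun z => continuousAt_coordX)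
      (fun z => coordX_pos) (fun z => contDiffAt_coordX_of_mem)
      (fun r hr => memLp_outer_of_norm_le (c := 1) (measurable_gradient _)
        (fun z hz => by rw [gradient_coordX hz]; simp) hr)
      (hζ.fderiv_apply v) (fun h => ?_) (fun t ht => ?_)
    · have := hsupp 0 (by simpa using hs h)
      rcases this with h | h <;> norm_num at h
    · rw [coordX, ellA_ofReal_of_one_le, Real.arcosh_zero]
      rcases hsupp t (hs ht) with h | h
      · exact le_abs.2 (Or.inr (by linarith))
      · exact le_abs.2 (Or.inl h.le)
  have := integral_inner_rotated_gradient_eq_zero hζ (fun v => (key v).1) (fun v => (key v).2)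
  rw [← this]
  refine setIntegral_congr_fun isOpen_halfPlane.measurableSet fun z hz => ?_
  simp only [gradient_potential_eq hz, inner_eq]
  simp
  ring

/-! ### The potential belongs to the energy space -/

/-- A smooth approximation of the identity on `[-π/2, π/2]` which is constant near `±π/2` and `0`. -/
noncomputable def plateau (n : ℕ) (s : ℝ) : ℝ :=
  trunc n (Real.pi / 2 - trunc n (Real.pi / 2 - s)) -
    trunc n (Real.pi / 2 - trunc n (Real.pi / 2 + s))

lemma contDiff_plateau (n : ℕ) : ContDiff ℝ ∞ (plateau n) :=
  ((contDiff_trunc n).comp (contDiff_const.sub ((contDiff_trunc n).comp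
    (contDiff_const.sub contDiff_id)))).sub
    ((contDiff_trunc n).comp (contDiff_const.sub ((contDiff_trunc n).comp
    (contDiff_const.add contDiff_id))))

lemma differentiable_plateau (n : ℕ) : Differentiable ℝ (plateau n) :=
  (contDiff_plateau n).differentiable (by norm_cast)

lemma exists_abs_deriv_plateau_le : ∃ K : ℝ, 1 ≤ K ∧ ∀ n s, |deriv (plateau n) s| ≤ K := by
  obtain ⟨K, hK1, hK⟩ := exists_abs_deriv_trunc_le
  refine ⟨K * K + K * K, by nlinarith, fun n s => ?_⟩
  have hd : ∀ x, HasDerivAt (trunc n) (deriv (trunc n) x) x :=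
    fun x => (differentiable_trunc n x).hasDerivAt
  have e1 := (hd _).comp s (((hd _).comp s ((hasDerivAt_id s).const_sub (Real.pi / 2))).const_sub
    (Real.pi / 2))
  have e2 := (hd _).comp s (((hd _).comp s ((hasDerivAt_id s).const_add (Real.pi / 2))).const_sub
    (Real.pi / 2))
  have e3 := (e1.sub e2).deriv
  have e4 : deriv (plateau n) s = _ := e3
  rw [e4]
  refine (abs_sub _ _).trans (add_le_add ?_ ?_) <;>
  · simp only [abs_mul, abs_neg, abs_one, mul_one]
    exact mul_le_mul (hK _ _) (hK _ _) (abs_nonneg _) (by linarith)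

lemma pi_div_two_bounds : (3 / 2 : ℝ) < Real.pi / 2 := by linarith [Real.pi_gt_three]

/-- This is the reason for the shift by 4: every `trunc n` is the identity on [1/2, ∞), so the
different truncations inside `plateau` do not interfere. -/
lemma le_mul_four (n : ℕ) {s : ℝ} (hs : 1 / 2 ≤ s) : 2 ≤ ((n : ℝ) + 4) * s := by
  nlinarith [Nat.cast_nonneg (α := ℝ) n]

lemma plateau_eventuallyEq_zero (n : ℕ) : plateau n =ᶠ[𝓝 0] 0 := by
  have h1 : ContinuousAt (fun s : ℝ => ((n : ℝ) + 4) * |s|) 0 := by fun_prop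
  have h2 : ContinuousAt (fun s : ℝ => |s|) 0 := by fun_prop
  filter_upwards [h1.eventually_lt_const (u := 1) (by simp),
    h2.eventually_lt_const (u := 1) (by simp)] with s hs1 hs2
  have hp := pi_div_two_bounds
  obtain ⟨a, b⟩ := abs_lt.1 hs2
  have hn : (0 : ℝ) < n + 4 := by positivity
  rw [plateau, trunc_of_ge (s := Real.pi / 2 - s) (le_mul_four n (by linarith)),
    trunc_of_ge (s := Real.pi / 2 + s) (le_mul_four n (by linarith)),
    trunc_of_le, trunc_of_le]
  · simp
  · nlinarith [neg_abs_le s]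
  · nlinarith [le_abs_self s]

lemma plateau_neg (n : ℕ) (s : ℝ) : plateau n (-s) = -plateau n s := by
  simp only [plateau, sub_neg_eq_add, neg_sub, ← sub_eq_add_neg]

lemma plateau_of_near {n : ℕ} {s : ℝ} (h : ((n : ℝ) + 4) * |Real.pi / 2 - s| ≤ 1) :
    plateau n s = Real.pi / 2 := by
  have hp := pi_div_two_bounds
  have hn : (0 : ℝ) ≤ n := n.cast_nonneg
  have h1 : |Real.pi / 2 - s| ≤ 1 / 4 := by nlinarith [abs_nonneg (Real.pi / 2 - s)]
  obtain ⟨a, b⟩ := abs_le.1 h1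
  rw [plateau, trunc_of_le (s := Real.pi / 2 - s), trunc_of_ge (s := Real.pi / 2 + s), sub_zero,
    trunc_of_ge, trunc_of_nonpos (by linarith), sub_zero]
  · exact le_mul_four n (by linarith)
  · exact le_mul_four n (by linarith)
  · nlinarith [le_abs_self (Real.pi / 2 - s)]

lemma plateau_eventuallyEq_pi_div_two (n : ℕ) :
    plateau n =ᶠ[𝓝 (Real.pi / 2)] fun _ => Real.pi / 2 := by
  have h1 : ContinuousAt (fun s : ℝ => ((n : ℝ) + 4) * |Real.pi / 2 - s|) (Real.pi / 2) := by
    fun_prop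
  filter_upwards [h1.eventually_lt_const (u := 1) (by simp)] with s hs using plateau_of_near hs.le

lemma plateau_eventuallyEq_neg_pi_div_two (n : ℕ) :
    plateau n =ᶠ[𝓝 (-(Real.pi / 2))] fun _ => -(Real.pi / 2) := by
  have h1 : ContinuousAt (fun s : ℝ => ((n : ℝ) + 4) * |Real.pi / 2 - -s|) (-(Real.pi / 2)) := by
    fun_prop
  filter_upwards [h1.eventually_lt_const (u := 1) (by simp)] with s hs
  rw [← neg_neg s, plateau_neg, plateau_of_near hs.le]

lemma eventually_plateau_eventuallyEq_of_pos {s : ℝ} (hs : 0 < s) (hs2 : s < Real.pi / 2) :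
    ∀ᶠ n : ℕ in atTop, plateau n =ᶠ[𝓝 s] id := by
  filter_upwards [eventually_mul_gt hs 2, eventually_mul_gt (sub_pos.2 hs2) 2] with n h1 h2
  have c1 : ContinuousAt (fun s : ℝ => ((n : ℝ) + 4) * s) s := by fun_prop
  have c2 : ContinuousAt (fun s : ℝ => ((n : ℝ) + 4) * (Real.pi / 2 - s)) s := by fun_prop
  filter_upwards [c1.eventually_const_lt h1, c2.eventually_const_lt h2, lt_mem_nhds hs]
    with y hy1 hy2 hy3
  have hp := pi_div_two_bounds
  rw [plateau, trunc_of_ge hy2.le, trunc_of_ge (s := Real.pi / 2 + y)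
    (le_mul_four n (by linarith)), trunc_of_ge, trunc_of_nonpos (by linarith)]
  · simp
  · rw [sub_sub_cancel]; exact hy1.le

lemma eventually_plateau_eventuallyEq {s : ℝ} (hs : s ≠ 0) (hs2 : |s| < Real.pi / 2) :
    ∀ᶠ n : ℕ in atTop, plateau n =ᶠ[𝓝 s] id := by
  obtain ⟨a, b⟩ := abs_lt.1 hs2
  rcases hs.lt_or_gt with h | h
  · filter_upwards [eventually_plateau_eventuallyEq_of_pos (s := -s) (by linarith) (by linarith)]
      with n hn
    filter_upwards [continuous_neg.continuousAt.tendsto.eventually hn] with y hy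
    rw [← neg_neg y, plateau_neg, hy]; rfl
  · exact eventually_plateau_eventuallyEq_of_pos h b

lemma abs_plateau_le (n : ℕ) {s : ℝ} (hs : |s| ≤ Real.pi / 2) : |plateau n s| ≤ 2 * Real.pi := by
  have hpi := Real.pi_pos
  obtain ⟨a, b⟩ := abs_le.1 hs
  have key : ∀ t : ℝ, 0 ≤ t → t ≤ Real.pi → |trunc n (Real.pi / 2 - trunc n t)| ≤ Real.pi := by
    intro t h0 h1
    have h2 : 0 ≤ trunc n t := mul_nonneg h0 (Real.smoothTransition.nonneg _)
    have h3 := (le_abs_self _).trans (abs_trunc_le n t)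
    rw [abs_of_nonneg h0] at h3
    refine (abs_trunc_le n _).trans (abs_le.2 ⟨by linarith, by linarith⟩)
  have h1 := key (Real.pi / 2 - s) (by linarith) (by linarith)
  have h2 := key (Real.pi / 2 + s) (by linarith) (by linarith)
  exact (abs_sub _ _).trans (by linarith)

/-- The extension of the potential to the whole plane by even reflection. -/
noncomputable def reflPotential (z : ℂ) : ℝ := Real.arcsin (ellB z)

lemma continuousAt_reflPotential {z : ℂ} (hz : z ≠ 0) : ContinuousAt reflPotential z :=
  Real.continuous_arcsin.continuousAt.comp (continuousAt_ellB hz)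

lemma abs_reflPotential_le (z : ℂ) : |reflPotential z| ≤ Real.pi / 2 :=
  abs_le.2 ⟨Real.neg_pi_div_two_le_arcsin _, Real.arcsin_le_pi_div_two _⟩

lemma contDiffAt_reflPotential {z : ℂ} (h0 : z ≠ 0) (h : |ellB z| < 1) :
    ContDiffAt ℝ ∞ reflPotential z := by
  obtain ⟨h1, h2⟩ := abs_ellB_lt_one_ne h0 h
  obtain ⟨h3, h4⟩ := abs_lt.1 h
  exact (Real.contDiffAt_arcsin h3.ne' h4.ne).comp z (contDiffAt_ellB h0 h1 h2)

lemma abs_reflPotential_lt {z : ℂ} (h : |ellB z| < 1) : |reflPotential z| < Real.pi / 2 := by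
  obtain ⟨h3, h4⟩ := abs_lt.1 h
  exact abs_lt.2 ⟨Real.neg_pi_div_two_lt_arcsin.2 h3, Real.arcsin_lt_pi_div_two.2 h4⟩

/-- A zero forces equal distances to 1 and -1. The zeros thus lie in a null set, and flattening the
values near 0 does no harm almost everywhere. -/
lemma reflPotential_ne_zero {z : ℂ} (h : z.re ≠ 0) : reflPotential z ≠ 0 := by
  rw [reflPotential, Ne, Real.arcsin_eq_zero_iff, ellB, div_eq_zero_iff, not_or]
  have hz : z ≠ 0 := fun h0 => h (by simp [h0])
  refine ⟨fun h1 => h ?_, (norm_pos_half z hz).ne'⟩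
  have h2 : ‖z - 1‖ ^ 2 = ‖z + 1‖ ^ 2 := by rw [sub_eq_zero.1 h1]
  rw [← normSq_eq_norm_sq, ← normSq_eq_norm_sq, normSq_apply, normSq_apply] at h2
  simp at h2
  linarith

lemma norm_gradient_reflPotential {z : ℂ} (hz : z ∈ halfPlane) :
    ‖gradient reflPotential z‖ = ‖deriv Finv z‖ := by
  have : reflPotential =ᶠ[𝓝 z] potential := by
    filter_upwards [isOpen_halfPlane.mem_nhds hz] with y hy using (potential_eq_arcsin hy).symm
  rw [this.gradient_eq, gradient_potential hz]
  simp

lemma norm_gradient_reflPotential_conj (z : ℂ) :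
    ‖gradient reflPotential (conj z)‖ = ‖gradient reflPotential z‖ := by
  have h : reflPotential ∘ conjLIE = reflPotential := by
    ext z; simp [reflPotential, ellB_conj]
  rw [norm_gradient_eq, norm_gradient_eq]
  conv_rhs => rw [← h]
  have h2 := conjLIE.toContinuousLinearEquiv.comp_right_fderiv (f := reflPotential) (x := z)
  have h3 : fderiv ℝ (reflPotential ∘ conjLIE) z =
    (fderiv ℝ reflPotential (conj z)).comp
      (conjLIE.toContinuousLinearEquiv : ℂ →L[ℝ] ℂ) := h2
  rw [h3]
  exact (ContinuousLinearMap.opNorm_comp_linearIsometryEquiv _ conjLIE).symm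

/-- A smooth cutoff vanishing near the origin and equal to one outside the ball of radius `r`. -/
noncomputable def cutoff (r : ℝ) (z : ℂ) : ℝ := Real.smoothTransition (2 * (‖z‖ ^ 2 / r ^ 2) - 1)

lemma contDiff_cutoff (r : ℝ) : ContDiff ℝ ∞ (cutoff r) := by
  have : ContDiff ℝ ∞ (fun z : ℂ => ‖z‖ ^ 2) := contDiff_norm_sq ℝ
  exact Real.smoothTransition.contDiff.comp
    ((contDiff_const.mul (this.div_const _)).sub contDiff_const)

lemma cutoff_nonneg (r : ℝ) (z : ℂ) : 0 ≤ cutoff r z := Real.smoothTransition.nonneg _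

lemma cutoff_le_one (r : ℝ) (z : ℂ) : cutoff r z ≤ 1 := Real.smoothTransition.le_one _

lemma cutoff_of_le {r : ℝ} (hr : 0 < r) {z : ℂ} (hz : ‖z‖ ≤ r / 2) : cutoff r z = 0 := by
  refine Real.smoothTransition.zero_of_nonpos ?_
  have : ‖z‖ ^ 2 / r ^ 2 ≤ 1 / 4 := by
    rw [div_le_iff₀ (by positivity)]
    nlinarith [norm_nonneg z]
  linarith

lemma cutoff_of_ge {r : ℝ} (hr : 0 < r) {z : ℂ} (hz : r ≤ ‖z‖) : cutoff r z = 1 := by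
  refine Real.smoothTransition.one_of_one_le ?_
  have : 1 ≤ ‖z‖ ^ 2 / r ^ 2 := by
    rw [le_div_iff₀ (by positivity)]
    nlinarith [norm_nonneg z]
  linarith

lemma cutoff_eventuallyEq_zero {r : ℝ} (hr : 0 < r) : cutoff r =ᶠ[𝓝 0] fun _ => 0 := by
  filter_upwards [Metric.ball_mem_nhds (0 : ℂ) (half_pos hr)] with y hy
  exact cutoff_of_le hr (by simpa using (Metric.mem_ball.1 hy).le)

lemma hasCompactSupport_gradient_cutoff {r : ℝ} (hr : 0 < r) :
    HasCompactSupport (gradient (cutoff r)) := by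
  refine HasCompactSupport.intro (isCompact_closedBall (0 : ℂ) r) fun z hz => ?_
  have : cutoff r =ᶠ[𝓝 z] fun _ => 1 := by
    filter_upwards [Metric.isClosed_closedBall.isOpen_compl.mem_nhds hz] with y hy
    refine cutoff_of_ge hr ?_
    simp at hy
    exact hy.le
  rw [this.gradient_eq, gradient_fun_const]

lemma continuous_gradient_cutoff (r : ℝ) : Continuous (gradient (cutoff r)) :=
  ContDiff.continuous_gradient ((contDiff_cutoff r).of_le (by norm_cast))

/-- The cutoff lives in |z| ≥ r/2, where the energy in the upper half-plane is already controlled;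
the lower half-plane is its mirror image, and the real line is null. -/
lemma memLp_cutoff_mul_norm_gradient {r : ℝ} (hr : 0 < r) :
    MemLp (fun z => cutoff r z * ‖gradient reflPotential z‖) 2 volume := by
  set h : ℂ → ℝ := (outer (r / 2)).indicator fun z => ‖gradient reflPotential z‖ with hh
  have h1 : MemLp h 2 volume := by
    rw [hh, memLp_indicator_iff_restrict (measurableSet_outer _)]
    exact (memLp_outer_of_norm_le (c := 1) (measurable_gradient _)
      (fun z hz => by rw [norm_gradient_reflPotential hz, one_mul]) (half_pos hr)).norm
  have h2 : MemLp (h ∘ conjLIE) 2 volume :=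
    h1.comp_measurePreserving conjLIE.measurePreserving
  refine (h1.add h2).mono ?_ ?_
  · exact ((contDiff_cutoff r).continuous.measurable.mul
      (measurable_gradient _).norm).aestronglyMeasurable
  · filter_upwards [ae_im_ne_zero] with z hz
    have hn : ∀ z, 0 ≤ h z := fun z => Set.indicator_nonneg (fun _ _ => norm_nonneg _) z
    have hc := cutoff_nonneg r z
    have hc1 := cutoff_le_one r z
    have hg := norm_nonneg (gradient reflPotential z)
    rw [Real.norm_eq_abs, Real.norm_eq_abs, abs_of_nonneg (by positivity)]
    simp only [Pi.add_apply, Function.comp_apply, conjLIE_apply]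
    rw [abs_of_nonneg (add_nonneg (hn _) (hn _))]
    rcases le_or_gt ‖z‖ (r / 2) with h0 | h0
    · rw [cutoff_of_le hr h0, zero_mul]; exact add_nonneg (hn _) (hn _)
    refine (mul_le_of_le_one_left hg hc1).trans ?_
    rcases hz.lt_or_gt with him | him
    · have hm : conj z ∈ outer (r / 2) := ⟨conj_mem_halfPlane him, by simpa using h0.le⟩
      have : h (conj z) = ‖gradient reflPotential z‖ := by
        rw [hh, Set.indicator_of_mem hm, norm_gradient_reflPotential_conj]
      rw [this]; linarith [hn z]
    · have hm : z ∈ outer (r / 2) := ⟨him, by simpa using h0.le⟩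
      have : h z = ‖gradient reflPotential z‖ := by rw [hh, Set.indicator_of_mem hm]
      rw [this]; linarith [hn (conj z)]

/-- Each flattening has its purpose: constancy near ±π/2 removes the singularity of `arcsin` on the
slit, and vanishing near 0 gives compact support because the reflected potential tends to 0 at
infinity. The cutoff takes care of the origin. -/
lemma isTest_cutoff_mul_plateau {r : ℝ} (hr : 0 < r) (n : ℕ) :
    IsTest (fun z => cutoff r z * plateau n (reflPotential z)) := by
  refine ⟨contDiff_iff_contDiffAt.2 fun z => ?_, ?_⟩
  · rcases eq_or_ne z 0 with rfl | hz
    · refine contDiffAt_const.congr_of_eventuallyEq (f := fun _ => (0 : ℝ)) ?_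
      filter_upwards [cutoff_eventuallyEq_zero hr] with y hy
      rw [hy, zero_mul]
    refine (contDiff_cutoff r).contDiffAt.mul ?_
    have hcont := (continuousAt_reflPotential hz).tendsto
    rcases (abs_ellB_le_one hz).lt_or_eq with h | h
    · exact (contDiff_plateau n).contDiffAt.comp z (contDiffAt_reflPotential hz h)
    · rcases eq_or_eq_neg_of_abs_eq h with h | h
      · have hp : reflPotential z = Real.pi / 2 := by rw [reflPotential, h, Real.arcsin_one]
        rw [hp] at hcont
        exact contDiffAt_const.congr_of_eventuallyEq
          (hcont.eventually (plateau_eventuallyEq_pi_div_two n))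
      · have hp : reflPotential z = -(Real.pi / 2) := by
          rw [reflPotential, h, Real.arcsin_neg, Real.arcsin_one]
        rw [hp] at hcont
        exact contDiffAt_const.congr_of_eventuallyEq
          (hcont.eventually (plateau_eventuallyEq_neg_pi_div_two n))
  · have h : Tendsto reflPotential (Bornology.cobounded ℂ) (𝓝 0) := by
      have := (Real.continuous_arcsin.tendsto 0).comp tendsto_ellB_cobounded
      rw [Real.arcsin_zero] at this
      exact this
    have h2 := h.eventually (plateau_eventuallyEq_zero n)
    rw [hasCompactSupport_iff_eventuallyEq, coclosedCompact_eq_cocompact,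
      ← Metric.cobounded_eq_cocompact]
    filter_upwards [h2] with z hz
    rw [hz]; simp

lemma continuous_cutoff_mul_reflPotential {r : ℝ} (hr : 0 < r) :
    Continuous (fun z => cutoff r z * reflPotential z) := by
  refine continuous_iff_continuousAt.2 fun z => ?_
  rcases eq_or_ne z 0 with rfl | hz
  · refine continuousAt_const.congr (f := fun _ => (0 : ℝ)) ?_
    filter_upwards [cutoff_eventuallyEq_zero hr] with y hy
    rw [hy, zero_mul]
  · exact (contDiff_cutoff r).continuous.continuousAt.mul (continuousAt_reflPotential hz)

lemma tendsto_eLpNorm_two_zero {α E : Type*} [MeasurableSpace α] [NormedAddCommGroup E]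
    [MeasurableSpace E] [OpensMeasurableSpace E] {μ : Measure α} {f : ℕ → α → E} {bd : α → ℝ}
    (hf : ∀ n, Measurable (f n)) (hbd : MemLp bd 2 μ) (hle : ∀ n, ∀ᵐ x ∂μ, ‖f n x‖ ≤ bd x)
    (hlim : ∀ᵐ x ∂μ, ∀ᶠ n in atTop, f n x = 0) :
    Tendsto (fun n => eLpNorm (f n) 2 μ) atTop (𝓝 0) := by
  have h1 : Tendsto (fun n => ∫⁻ x, ‖f n x‖ₑ ^ 2 ∂μ) atTop (𝓝 (∫⁻ _, 0 ∂μ)) := by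
    refine tendsto_lintegral_of_dominated_convergence (fun x => ‖bd x‖ₑ ^ 2)
      (fun n => (hf n).enorm.pow_const 2) (fun n => ?_) ?_ ?_
    · filter_upwards [hle n] with x hx
      have : ‖f n x‖ₑ ≤ ‖bd x‖ₑ := by
        rw [← ofReal_norm, ← ofReal_norm]
        exact ENNReal.ofReal_le_ofReal (hx.trans (le_abs_self _))
      gcongr
    · rw [← eLpNorm_two_sq]
      exact ENNReal.pow_ne_top hbd.2.ne
    · filter_upwards [hlim] with x hx
      refine tendsto_const_nhds.congr' ?_
      filter_upwards [hx] with n hn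
      simp [hn]
  rw [lintegral_zero] at h1
  have h2 := (ENNReal.continuous_rpow_const (y := (1 / 2 : ℝ))).tendsto 0 |>.comp h1
  rw [ENNReal.zero_rpow_of_pos (by norm_num)] at h2
  refine h2.congr fun n => ?_
  simp only [Function.comp_apply]
  rw [← eLpNorm_two_sq, ← ENNReal.rpow_natCast, ← ENNReal.rpow_mul]
  norm_num

/-- Off both axes the value of the reflected potential is neither 0 nor ±π/2, and near any such
value `plateau n` is eventually the identity. -/
lemma ae_gradient_plateau (r : ℝ) : ∀ᵐ z : ℂ, ∀ᶠ n : ℕ in atTop,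
    plateau n (reflPotential z) = reflPotential z ∧
    gradient (fun z => cutoff r z * plateau n (reflPotential z)) z =
      gradient (fun z => cutoff r z * reflPotential z) z := by
  filter_upwards [ae_im_ne_zero, ae_re_ne_zero] with z him hre
  have h0 : z ≠ 0 := fun h => him (by simp [h])
  filter_upwards [eventually_plateau_eventuallyEq (reflPotential_ne_zero hre)
    (abs_reflPotential_lt (abs_ellB_lt_one_of_im_ne him))] with n hn
  refine ⟨hn.eq_of_nhds, Filter.EventuallyEq.gradient_eq ?_⟩
  filter_upwards [(continuousAt_reflPotential h0).tendsto.eventually hn] with y hy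
  rw [hy]; rfl

lemma memHomSobolev_cutoff_mul_reflPotential {r : ℝ} (hr : 0 < r) :
    MemHomSobolev (fun z => cutoff r z * reflPotential z) := by
  obtain ⟨K, hK1, hK⟩ := exists_abs_deriv_plateau_le
  set φ : ℕ → ℂ → ℝ := fun n z => cutoff r z * plateau n (reflPotential z) with hφ
  set w : ℂ → ℝ := fun z => cutoff r z * reflPotential z with hw
  -- A square integrable bound for all approximating gradients at once; the factor 2π bounds
  -- `plateau` where its argument is at most π/2 in modulus.
  set bd : ℂ → ℝ := fun z => K * (cutoff r z * ‖gradient reflPotential z‖) +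
    2 * Real.pi * ‖gradient (cutoff r) z‖ with hbd
  have hbdL : MemLp bd 2 volume := ((memLp_cutoff_mul_norm_gradient hr).const_mul K).add
    (((continuous_gradient_cutoff r).memLp_of_hasCompactSupport
      (hasCompactSupport_gradient_cutoff hr)).norm.const_mul _)
  have hle : ∀ n, ∀ᵐ z, ‖gradient (φ n) z‖ ≤ bd z := fun n => by
    filter_upwards [ae_im_ne_zero] with z him
    have h0 : z ≠ 0 := fun h => him (by simp [h])
    have hd : DifferentiableAt ℝ reflPotential z :=
      (contDiffAt_reflPotential h0 (abs_ellB_lt_one_of_im_ne him)).differentiableAt (by norm_cast)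
    have hd2 : DifferentiableAt ℝ (fun z => plateau n (reflPotential z)) z :=
      (differentiable_plateau n _).comp z hd
    have hd3 : DifferentiableAt ℝ (cutoff r) z :=
      (contDiff_cutoff r).differentiable (by norm_cast) z
    simp only [hφ]
    rw [gradient_mul hd3 hd2, gradient_comp_real (differentiable_plateau n _) hd]
    refine (norm_add_le _ _).trans (add_le_add ?_ ?_)
    · rw [norm_smul, norm_smul, Real.norm_eq_abs, Real.norm_eq_abs,
        abs_of_nonneg (cutoff_nonneg r z), mul_left_comm]
      exact mul_le_mul_of_nonneg_right (hK n _)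
        (mul_nonneg (cutoff_nonneg r z) (norm_nonneg _))
    · rw [norm_smul, Real.norm_eq_abs]
      exact mul_le_mul_of_nonneg_right (abs_plateau_le n (abs_reflPotential_le z)) (norm_nonneg _)
  have hae := ae_gradient_plateau r
  have hlew : ∀ᵐ z, ‖gradient w z‖ ≤ bd z := by
    filter_upwards [hae, ae_all_iff.2 hle] with z hz hz2
    obtain ⟨n, hn⟩ := hz.exists
    rw [← hn.2]; exact hz2 n
  have hGL : MemLp (gradient w) 2 volume := hbdL.mono' (measurable_gradient _).aestronglyMeasurable
    hlew
  have htest : ∀ n, IsTest (φ n) := isTest_cutoff_mul_plateau hr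
  have hwc : Continuous w := continuous_cutoff_mul_reflPotential hr
  refine ⟨gradient w, ⟨?_, ?_, fun ψ hψ _ => ?_⟩, hGL, φ, htest, ?_⟩
  · exact locallyIntegrableOn_univ.2 hwc.locallyIntegrable
  · exact locallyIntegrableOn_univ.2 (hGL.locallyIntegrable (by norm_num))
  · simp only [Measure.restrict_univ]
    -- Integration by parts is exact for the smooth approximants and survives the limit. This
    -- identifies the pointwise gradient as the weak one, although the limit need not be
    -- differentiable across the slit.
    have e : ∀ n, ∫ z, φ n z • gradient ψ z = - ∫ z, ψ z • gradient (φ n) z := fun n => by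
      have h1 : IsTest (fun z => φ n z * ψ z) := hψ.mul_left (htest n).1
      have h2 := h1.integral_gradient
      have h3 : ∀ z, gradient (fun z => φ n z * ψ z) z =
          φ n z • gradient ψ z + ψ z • gradient (φ n) z := fun z =>
        gradient_mul ((htest n).differentiable z) (hψ.differentiable z)
      simp only [h3] at h2
      rw [integral_add] at h2
      · exact eq_neg_of_add_eq_zero_left h2
      · exact ((htest n).1.continuous.smul hψ.continuous_gradient).integrable_of_hasCompactSupport
          ((htest n).2.smul_right)
      · exact (hψ.1.continuous.smul
          (htest n).continuous_gradient).integrable_of_hasCompactSupport (hψ.2.smul_right)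
    have hL := tendsto_integral_of_dominated_convergence (μ := (volume : Measure ℂ))
      (F := fun n z => φ n z • gradient ψ z) (f := fun z => w z • gradient ψ z)
      (fun z => 2 * Real.pi * ‖gradient ψ z‖)
      (fun n => ((htest n).1.continuous.smul hψ.continuous_gradient).aestronglyMeasurable)
      (hψ.integrable_gradient.norm.const_mul _)
      (fun n => Eventually.of_forall fun z => by
        rw [norm_smul, Real.norm_eq_abs]
        refine mul_le_mul_of_nonneg_right ?_ (norm_nonneg _)
        simp only [hφ, abs_mul, abs_of_nonneg (cutoff_nonneg r z)]
        exact (mul_le_of_le_one_left (abs_nonneg _) (cutoff_le_one r z)).trans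
          (abs_plateau_le n (abs_reflPotential_le z)))
      (by
        filter_upwards [hae] with z hz
        refine tendsto_const_nhds.congr' ?_
        filter_upwards [hz] with n hn
        simp only [hφ, hw, hn.1])
    have hR := tendsto_integral_of_dominated_convergence (μ := (volume : Measure ℂ))
      (F := fun n z => ψ z • gradient (φ n) z) (f := fun z => ψ z • gradient w z)
      (fun z => |ψ z| * bd z)
      (fun n => (hψ.1.continuous.smul (htest n).continuous_gradient).aestronglyMeasurable)
      ((hψ.1.continuous.memLp_of_hasCompactSupport (p := 2) hψ.2).abs.integrable_mul hbdL)
      (fun n => by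
        filter_upwards [hle n] with z hz
        rw [norm_smul, Real.norm_eq_abs]
        exact mul_le_mul_of_nonneg_left hz (abs_nonneg _))
      (by
        filter_upwards [hae] with z hz
        refine tendsto_const_nhds.congr' ?_
        filter_upwards [hz] with n hn
        rw [← hn.2])
    simp only [e] at hL
    exact tendsto_nhds_unique hL hR.neg
  · refine tendsto_eLpNorm_two_zero (bd := fun z => bd z + bd z)
      (fun n => (measurable_gradient _).sub (measurable_gradient _)) (hbdL.add hbdL)
      (fun n => ?_) ?_
    · filter_upwards [hle n, hlew] with z h1 h2
      exact (norm_sub_le _ _).trans (add_le_add h1 h2)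
    · filter_upwards [hae] with z hz
      filter_upwards [hz] with n hn
      rw [hn.2, sub_self]

/-! ### Weak gradients of smooth functions, and the potential as a solution. -/

lemma contDiffAt_potential {z : ℂ} (hz : z ∈ halfPlane) : ContDiffAt ℝ ∞ potential z := by
  refine (contDiffAt_reflPotential (ne_zero_of_mem_halfPlane hz)
    (abs_ellB_lt_one_of_mem hz)).congr_of_eventuallyEq ?_
  filter_upwards [isOpen_halfPlane.mem_nhds hz] with y hy using potential_eq_arcsin hy

lemma continuousAt_gradient {f : ℂ → ℝ} {z : ℂ} (hf : ContDiffAt ℝ ∞ f z) :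
    ContinuousAt (gradient f) z :=
  (InnerProductSpace.toDual ℝ ℂ).symm.continuous.continuousAt.comp
    (hf.continuousAt_fderiv (by norm_cast))

lemma integrableOn_smul_of_tsupport_subset {E : Type*} [NormedAddCommGroup E] [NormedSpace ℝ E]
    {s : Set ℂ} (hs : IsOpen s) {g : ℂ → ℝ} {f : ℂ → E} (hg : Continuous g)
    (hgc : HasCompactSupport g) (hsupp : tsupport g ⊆ s) (hf : ContinuousOn f s) :
    IntegrableOn (fun z => g z • f z) s := by
  have h := (hg.continuousOn.smul (hf.mono hsupp)).integrableOn_compact (μ := volume) hgc.isCompact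
  refine h.of_forall_sdiff_eq_zero hs.measurableSet fun z hz => ?_
  rw [Pi.smul_apply', image_eq_zero_of_notMem_tsupport hz.2, zero_smul]

/-- Integration by parts for a function which is smooth in an open set. -/
lemma isWeakGradientOn_gradient {s : Set ℂ} (hs : IsOpen s) {f : ℂ → ℝ}
    (hf : ∀ z ∈ s, ContDiffAt ℝ ∞ f z) : IsWeakGradientOn s f (gradient f) := by
  have hfc : ContinuousOn f s := fun z hz => (hf z hz).continuousAt.continuousWithinAt
  have hgc : ContinuousOn (gradient f) s := fun z hz =>
    (continuousAt_gradient (hf z hz)).continuousWithinAt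
  refine ⟨hfc.locallyIntegrableOn hs.measurableSet, hgc.locallyIntegrableOn hs.measurableSet,
    fun φ hφ hsupp => ?_⟩
  have htest : IsTest (fun z => f z * φ z) := by
    refine ⟨contDiff_iff_contDiffAt.2 fun z => ?_, hφ.2.mul_left⟩
    by_cases hz : z ∈ tsupport φ
    · exact (hf z (hsupp hz)).mul hφ.1.contDiffAt
    · refine contDiffAt_const.congr_of_eventuallyEq (f := fun _ => (0 : ℝ)) ?_
      filter_upwards [(isClosed_tsupport φ).isOpen_compl.mem_nhds hz] with y hy
      rw [image_eq_zero_of_notMem_tsupport hy, mul_zero]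
  have h1 : ∀ z ∈ s, gradient (fun z => f z * φ z) z =
      f z • gradient φ z + φ z • gradient f z := fun z hz =>
    gradient_mul ((hf z hz).differentiableAt (by norm_cast)) (hφ.differentiable z)
  have h2 : ∫ z in s, gradient (fun z => f z * φ z) z = 0 := by
    rw [← htest.integral_gradient]
    refine setIntegral_eq_integral_of_forall_compl_eq_zero fun z hz => ?_
    exact gradient_eq_zero_of_notMem fun h => hz (hsupp (tsupport_mul_subset_right h))
  have hi1 : IntegrableOn (fun z => f z • gradient φ z) s := by
    have h := (hfc.mono hsupp).smul hφ.continuous_gradient.continuousOn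
    refine (h.integrableOn_compact (μ := volume) hφ.2.isCompact).of_forall_sdiff_eq_zero
      hs.measurableSet fun z hz => ?_
    rw [Pi.smul_apply', gradient_eq_zero_of_notMem hz.2, smul_zero]
  have hi2 := integrableOn_smul_of_tsupport_subset hs hφ.1.continuous hφ.2 hsupp hgc
  rw [setIntegral_congr_fun hs.measurableSet h1, integral_add hi1 hi2] at h2
  exact eq_neg_of_add_eq_zero_left h2

lemma isSolution_potential : IsSolution potential := by
  refine ⟨gradient potential, ⟨isWeakGradientOn_gradient isOpen_halfPlane
    (fun z => contDiffAt_potential), fun r hr => ?_,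
    2 * Real.pi, fun r hr => ?_⟩, hasTraceOn_potential_left, hasTraceOn_potential_right,
    isWeaklyHarmonicNeumann_potential⟩
  · refine ⟨_, memHomSobolev_cutoff_mul_reflPotential hr, ?_⟩
    filter_upwards [ae_restrict_mem (measurableSet_outer r)] with z hz
    rw [cutoff_of_ge hr (norm_ge_of_mem_outer hz), one_mul, reflPotential,
      potential_eq_arcsin (outer_subset_halfPlane r hz)]
  · rw [eLpNorm_two_sq]
    refine le_trans (le_of_eq ?_) (lintegral_deriv_Finv_le hr)
    refine setLIntegral_congr_fun (measurableSet_outer r) fun z hz => ?_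
    rw [gradient_potential (outer_subset_halfPlane r hz), enorm_neg, enorm_mul]
    simp [enorm]

/-! ### Solutions of the homogeneous problem -/

/-- `d`, with weak gradient `H`, solves the boundary value problem with zero Dirichlet data and has
at most logarithmic growth of the Dirichlet energy at the origin. -/
structure IsHomogeneousSolution (d : ℂ → ℝ) (H : ℂ → ℂ) : Prop where
  locallyIntegrableOn : LocallyIntegrableOn d halfPlane
  integrableOn_smul : ∀ g : ℂ → ℂ, Continuous g → HasCompactSupport g → (0 : ℂ) ∉ tsupport g →
    IntegrableOn (fun z => d z • g z) halfPlane
  memLp : ∀ r : ℝ, 0 < r → MemLp H 2 (volume.restrict (outer r))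
  energy : ∃ C : ℝ, 0 ≤ C ∧ ∀ r : ℝ, 0 < r →
    ∫⁻ z in outer r, ‖H z‖ₑ ^ 2 ≤ ENNReal.ofReal (C * Real.log (1 / r + 2))
  trace_left : HasTraceOn d H (Set.Ioo (-1) 0) 0
  trace_right : HasTraceOn d H (Set.Ioo 0 1) 0
  neumann : IsWeaklyHarmonicNeumann H

lemma MemWStar.memLp {v : ℂ → ℝ} {G : ℂ → ℂ} (h : MemWStar v G) {r : ℝ} (hr : 0 < r) :
    MemLp G 2 (volume.restrict (outer r)) := by
  obtain ⟨C, hC⟩ := h.2.2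
  refine ⟨(h.1.2.1.aestronglyMeasurable).mono_set (outer_subset_halfPlane r), ?_⟩
  exact ((ENNReal.pow_lt_top_iff (n := 2)).1 ((hC r hr).trans_lt ENNReal.ofReal_lt_top)).resolve_right
    two_ne_zero

/-- A weak gradient in the open half-plane gives no integrability up to the boundary. That comes
from agreement on `outer r` with a function locally integrable on the whole plane. -/
lemma MemWStar.integrableOn_smul {v : ℂ → ℝ} {G : ℂ → ℂ} (h : MemWStar v G) {g : ℂ → ℂ}
    (hg : Continuous g) (hgc : HasCompactSupport g) (h0 : (0 : ℂ) ∉ tsupport g) :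
    IntegrableOn (fun z => v z • g z) halfPlane := by
  refine integrableOn_halfPlane_of_outer (fun r hr => ?_) h0 (fun z hz => by simp [hz])
  obtain ⟨w, ⟨G', ⟨hw, -⟩, -⟩, hwv⟩ := h.2.1 r hr
  have h1 : Integrable (fun z => w z • g z) :=
    (locallyIntegrableOn_univ.1 hw).integrable_smul_right_of_hasCompactSupport hg hgc
  refine (h1.integrableOn (s := outer r)).congr ?_
  filter_upwards [hwv] with z hz
  rw [hz]

lemma smul_I_zero_integral {J : Set ℝ} {ζ : ℂ → ℝ} :
    (((∫ t in J, 0 * ζ (t : ℂ) : ℝ) : ℂ) * I) = 0 := by simp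

lemma IsTest.zero_notMem_tsupport_gradient {ζ : ℂ → ℝ} (h0 : (0 : ℂ) ∉ tsupport ζ) :
    (0 : ℂ) ∉ tsupport (gradient ζ) := fun h => h0 (tsupport_gradient_subset ζ h)

lemma hasTraceOn_sub {v u : ℂ → ℝ} {G K : ℂ → ℂ} (hv : MemWStar v G) (hu : MemWStar u K)
    {J : Set ℝ} (hJ : (0 : ℝ) ∉ J) {c : ℝ} (h1 : HasTraceOn v G J c) (h2 : HasTraceOn u K J c) :
    HasTraceOn (fun z => v z - u z) (fun z => G z - K z) J 0 := by
  intro ζ hζ hs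
  have h0 : (0 : ℂ) ∉ tsupport ζ := fun h => hJ (hs 0 (by simpa using h))
  have hg0 := IsTest.zero_notMem_tsupport_gradient h0
  have e := h1 ζ hζ hs
  rw [← h2 ζ hζ hs] at e
  have i1 : IntegrableOn (fun z => v z • gradient ζ z + ζ z • G z) halfPlane :=
    (hv.integrableOn_smul hζ.continuous_gradient hζ.hasCompactSupport_gradient hg0).add
      (integrableOn_halfPlane_smul hζ.1.continuous hζ.2 h0 fun r hr => hv.memLp hr)
  have i2 : IntegrableOn (fun z => u z • gradient ζ z + ζ z • K z) halfPlane :=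
    (hu.integrableOn_smul hζ.continuous_gradient hζ.hasCompactSupport_gradient hg0).add
      (integrableOn_halfPlane_smul hζ.1.continuous hζ.2 h0 fun r hr => hu.memLp hr)
  rw [smul_I_zero_integral, neg_zero, ← sub_eq_zero.2 e, ← integral_sub i1 i2]
  refine integral_congr_ae (Eventually.of_forall fun z => ?_)
  simp only [sub_smul, smul_sub]
  abel

lemma MemWStar.energy_sub {v u : ℂ → ℝ} {G K : ℂ → ℂ} (hv : MemWStar v G) (hu : MemWStar u K) :
    ∃ C : ℝ, 0 ≤ C ∧ ∀ r : ℝ, 0 < r →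
    ∫⁻ z in outer r, ‖G z - K z‖ₑ ^ 2 ≤ ENNReal.ofReal (C * Real.log (1 / r + 2)) := by
  obtain ⟨A, hA⟩ := hv.2.2
  obtain ⟨B, hB⟩ := hu.2.2
  refine ⟨2 * (|A| + |B|), by positivity, fun r hr => ?_⟩
  have hL : 0 ≤ Real.log (1 / r + 2) := by
    have : 0 < 1 / r := by positivity
    exact Real.log_nonneg (by linarith)
  have h1 := eLpNorm_sub_le (μ := volume.restrict (outer r)) (p := 2) (hv.memLp hr).1
    (hu.memLp hr).1 (by norm_num)
  calc ∫⁻ z in outer r, ‖G z - K z‖ₑ ^ 2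
      = eLpNorm (G - K) 2 (volume.restrict (outer r)) ^ 2 := (eLpNorm_two_sq _ _).symm
    _ ≤ (eLpNorm G 2 (volume.restrict (outer r)) + eLpNorm K 2 (volume.restrict (outer r))) ^ 2 := by
        gcongr
    _ ≤ 2 * (eLpNorm G 2 (volume.restrict (outer r)) ^ 2 +
          eLpNorm K 2 (volume.restrict (outer r)) ^ 2) := by
        have := ENNReal.rpow_add_le_mul_rpow_add_rpow
          (eLpNorm G 2 (volume.restrict (outer r))) (eLpNorm K 2 (volume.restrict (outer r)))
          (p := 2) (by norm_num)
        norm_num at this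
        exact this
    _ ≤ 2 * (ENNReal.ofReal (|A| * Real.log (1 / r + 2)) +
          ENNReal.ofReal (|B| * Real.log (1 / r + 2))) := by
        gcongr
        · exact (hA r hr).trans (ENNReal.ofReal_le_ofReal
            (mul_le_mul_of_nonneg_right (le_abs_self A) hL))
        · exact (hB r hr).trans (ENNReal.ofReal_le_ofReal
            (mul_le_mul_of_nonneg_right (le_abs_self B) hL))
    _ = ENNReal.ofReal (2 * (|A| + |B|) * Real.log (1 / r + 2)) := by
        rw [← ENNReal.ofReal_add (by positivity) (by positivity), ← ENNReal.ofReal_ofNat,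
          ← ENNReal.ofReal_mul (by norm_num)]
        congr 1; ring

lemma IsSolution.sub {v u : ℂ → ℝ} (hv : IsSolution v) (hu : IsSolution u) :
    ∃ H : ℂ → ℂ, IsHomogeneousSolution (fun z => v z - u z) H := by
  obtain ⟨G, hG, hG1, hG2, hGN⟩ := hv
  obtain ⟨K, hK, hK1, hK2, hKN⟩ := hu
  refine ⟨fun z => G z - K z, hG.1.1.sub hK.1.1, fun g hg hgc h0 => ?_, fun r hr => ?_,
    hG.energy_sub hK, hasTraceOn_sub hG hK (by simp) hG1 hK1,
    hasTraceOn_sub hG hK (by simp) hG2 hK2, fun ζ hζ hs => ?_⟩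
  · simp only [sub_smul]
    exact (hG.integrableOn_smul hg hgc h0).sub (hK.integrableOn_smul hg hgc h0)
  · exact (hG.memLp hr).sub (hK.memLp hr)
  · have h0 : (0 : ℂ) ∉ tsupport ζ := fun h => by
      rcases hs 0 (by simpa using h) with h | h <;> norm_num at h
    have hg0 := IsTest.zero_notMem_tsupport_gradient h0
    simp only [inner_sub_left]
    rw [integral_sub, hGN ζ hζ hs, hKN ζ hζ hs, sub_zero]
    · exact integrableOn_halfPlane_inner hζ.continuous_gradient hζ.hasCompactSupport_gradient hg0
        fun r hr => hG.memLp hr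
    · exact integrableOn_halfPlane_inner hζ.continuous_gradient hζ.hasCompactSupport_gradient hg0
        fun r hr => hK.memLp hr

namespace IsHomogeneousSolution

variable {d : ℂ → ℝ} {H : ℂ → ℂ}

lemma integrableOn_product (h : IsHomogeneousSolution d H) {ξ : ℂ → ℝ} (hξ : IsTest ξ)
    (h0 : (0 : ℂ) ∉ tsupport ξ) :
    IntegrableOn (fun z => d z • gradient ξ z + ξ z • H z) halfPlane :=
  (h.integrableOn_smul _ hξ.continuous_gradient hξ.hasCompactSupport_gradient
    (IsTest.zero_notMem_tsupport_gradient h0)).add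
      (integrableOn_halfPlane_smul hξ.1.continuous hξ.2 h0 h.memLp)

/-- Glues the two one-sided trace conditions. Only the origin separates the two Dirichlet intervals,
and ξ vanishes near it, so ξ can be split there. -/
lemma setIntegral_product_eq_zero (h : IsHomogeneousSolution d H) {ξ : ℂ → ℝ} (hξ : IsTest ξ)
    (h0 : (0 : ℂ) ∉ tsupport ξ) (hs : ∀ t : ℝ, (t : ℂ) ∈ tsupport ξ → |t| < 1) :
    ∫ z in halfPlane, (d z • gradient ξ z + ξ z • H z) = 0 := by
  obtain ⟨ρ, hρ, hball⟩ := Metric.isOpen_iff.1 (isClosed_tsupport ξ).isOpen_compl 0 h0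
  have hge : ∀ t : ℝ, (t : ℂ) ∈ tsupport ξ → ρ ≤ |t| := fun t ht => by
    by_contra! hlt
    exact hball (by simpa using hlt) ht
  -- The transition takes place in |Re z| ≤ ρ/2, while the support of ξ meets the real line only at
  -- distance at least ρ from 0. Each piece therefore meets the line inside a single interval.
  set χ : ℂ → ℝ := fun z => Real.smoothTransition (z.re / ρ + 1 / 2) with hχ
  have hχc : ContDiff ℝ ∞ χ :=
    Real.smoothTransition.contDiff.comp ((reCLM.contDiff.div_const ρ).add contDiff_const)
  have hχ0 : ∀ z : ℂ, z.re < -(ρ / 2) → χ z = 0 := fun z hz => by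
    refine Real.smoothTransition.zero_of_nonpos ?_
    have : z.re / ρ ≤ -(1 / 2) := by rw [div_le_iff₀ hρ]; linarith
    linarith
  have hχ1 : ∀ z : ℂ, ρ / 2 < z.re → χ z = 1 := fun z hz => by
    refine Real.smoothTransition.one_of_one_le ?_
    have : 1 / 2 ≤ z.re / ρ := by rw [le_div_iff₀ hρ]; linarith
    linarith
  have ht1 : IsTest (fun z => χ z * ξ z) := hξ.mul_left hχc
  have ht2 : IsTest (fun z => (1 - χ z) * ξ z) := hξ.mul_left (contDiff_const.sub hχc)
  have hs1 : tsupport (fun z => χ z * ξ z) ⊆ tsupport ξ := tsupport_mul_subset_right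
  have hs2 : tsupport (fun z => (1 - χ z) * ξ z) ⊆ tsupport ξ := tsupport_mul_subset_right
  have e1 := h.trace_right _ ht1 fun t ht => by
    have hlt := abs_lt.1 (hs t (hs1 ht))
    refine ⟨?_, hlt.2⟩
    by_contra! hneg
    have h2 := hge t (hs1 ht)
    rw [abs_of_nonpos hneg] at h2
    refine notMem_tsupport_iff_eventuallyEq.2 ?_ ht
    have hre : (t : ℂ).re < -(ρ / 2) := by rw [ofReal_re]; linarith
    filter_upwards [(isOpen_lt continuous_re continuous_const).mem_nhds hre] with y hy
    rw [hχ0 y hy, zero_mul]; rfl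
  have e2 := h.trace_left _ ht2 fun t ht => by
    have hlt := abs_lt.1 (hs t (hs2 ht))
    refine ⟨hlt.1, ?_⟩
    by_contra! hneg
    have h2 := hge t (hs2 ht)
    rw [abs_of_nonneg hneg] at h2
    refine notMem_tsupport_iff_eventuallyEq.2 ?_ ht
    have hre : ρ / 2 < (t : ℂ).re := by rw [ofReal_re]; linarith
    filter_upwards [(isOpen_lt continuous_const continuous_re).mem_nhds hre] with y hy
    rw [hχ1 y hy, sub_self, zero_mul]; rfl
  simp only [zero_mul, integral_zero, ofReal_zero, neg_zero] at e1 e2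
  have i1 := h.integrableOn_product ht1 (fun hh => h0 (hs1 hh))
  have i2 := h.integrableOn_product ht2 (fun hh => h0 (hs2 hh))
  have e3 := integral_add i1 i2
  rw [e1, e2, add_zero] at e3
  rw [← e3]
  refine integral_congr_ae (Eventually.of_forall fun z => ?_)
  have hg : gradient ξ z = gradient (fun z => χ z * ξ z) z +
      gradient (fun z => (1 - χ z) * ξ z) z := by
    have hd : DifferentiableAt ℝ χ z := hχc.differentiable (by norm_cast) z
    rw [gradient_mul hd (hξ.differentiable z),
      gradient_mul (hd.const_sub 1) (hξ.differentiable z), gradient_const_sub]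
    simp only [sub_smul, one_smul, smul_neg]
    abel
  simp only [hg, smul_add, sub_mul, one_mul, sub_smul]
  abel

/-- Only derivatives of ζ enter the argument, so ζ may equal a nonzero constant near 0. This freedom
encodes that the traces on both sides of 0 agree, and it is what eliminates the zeroth cosine
coefficient. -/
lemma setIntegral_inner_rotated_gradient (h : IsHomogeneousSolution d H) {ζ : ℂ → ℝ}
    (hζ : IsTest ζ) {c : ℝ} (h0 : ζ =ᶠ[𝓝 0] fun _ => c)
    (hs : ∀ t : ℝ, (t : ℂ) ∈ tsupport ζ → |t| < 1) :
    ∫ z in halfPlane, inner ℝ (H z) (I * gradient ζ z) = 0 := by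
  have hn : ∀ v : ℂ, (0 : ℂ) ∉ tsupport (fun z => fderiv ℝ ζ z v) := fun v => by
    refine notMem_tsupport_iff_eventuallyEq.2 ?_
    filter_upwards [h0.fderiv (𝕜 := ℝ)] with y hy
    rw [hy]; simp
  exact integral_inner_rotated_gradient_eq_zero hζ
    (fun v => h.integrableOn_product (hζ.fderiv_apply v) (hn v))
    (fun v => h.setIntegral_product_eq_zero (hζ.fderiv_apply v) (hn v)
      fun t ht => hs t (tsupport_fderiv_apply_subset' ζ v ht))

end IsHomogeneousSolution

/-! ### Pull-back to the strip -/

/-- The pull-back of a gradient field under `F`. -/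
noncomputable def pullback (H : ℂ → ℂ) (w : ℂ) : ℂ := conj (sinh w / cosh w ^ 2) * H (F w)

lemma image_F_strip : F '' strip = halfPlane := bijOn_F.image_eq

/-- Conformal invariance of the Dirichlet form: the Jacobian |F′|² is absorbed by one factor conj F′
in each argument of the inner product, and multiplication by c commutes with these factors. -/
lemma setIntegral_halfPlane_inner_eq {H : ℂ → ℂ} {ζ : ℂ → ℝ} (c : ℂ)
    (hζ : ∀ z ∈ halfPlane, DifferentiableAt ℝ ζ z) :
    ∫ z in halfPlane, inner ℝ (H z) (c * gradient ζ z) =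
      ∫ w in strip, inner ℝ (pullback H w) (c * gradient (fun w => ζ (F w)) w) := by
  rw [← image_F_strip, integral_image_eq_integral_abs_det_fderiv_smul volume
    isOpen_strip.measurableSet (fun w hw => (hasFDerivAt_real_of_hasDerivAt
      (hasDerivAt_F (cosh_ne_zero_of_mem_strip hw))).hasFDerivWithinAt) bijOn_F.injOn]
  refine setIntegral_congr_fun isOpen_strip.measurableSet fun w hw => ?_
  rw [det_smul_one, abs_of_nonneg (sq_nonneg _), gradient_comp_holomorphic
    (hasDerivAt_F (cosh_ne_zero_of_mem_strip hw)) (hζ _ (bijOn_F.mapsTo hw)), pullback]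
  set f' := sinh w / cosh w ^ 2
  rw [← normSq_eq_norm_sq, normSq_apply, inner_eq, inner_eq]
  simp only [mul_re, mul_im, conj_re, conj_im, smul_eq_mul]
  ring

lemma integrableOn_strip_inner_iff {H : ℂ → ℂ} {ζ : ℂ → ℝ} (c : ℂ)
    (hζ : ∀ z ∈ halfPlane, DifferentiableAt ℝ ζ z) :
    IntegrableOn (fun z => inner ℝ (H z) (c * gradient ζ z)) halfPlane ↔
    IntegrableOn (fun w => inner ℝ (pullback H w) (c * gradient (fun w => ζ (F w)) w)) strip := by
  rw [← image_F_strip, integrableOn_image_iff_integrableOn_abs_det_fderiv_smul volume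
    isOpen_strip.measurableSet (fun w hw => (hasFDerivAt_real_of_hasDerivAt
      (hasDerivAt_F (cosh_ne_zero_of_mem_strip hw))).hasFDerivWithinAt) bijOn_F.injOn]
  refine integrableOn_congr_fun (fun w hw => ?_) isOpen_strip.measurableSet
  rw [det_smul_one, abs_of_nonneg (sq_nonneg _), gradient_comp_holomorphic
    (hasDerivAt_F (cosh_ne_zero_of_mem_strip hw)) (hζ _ (bijOn_F.mapsTo hw)), pullback]
  set f' := sinh w / cosh w ^ 2
  rw [← normSq_eq_norm_sq, normSq_apply, inner_eq, inner_eq]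
  simp only [mul_re, mul_im, conj_re, conj_im, smul_eq_mul]
  ring

lemma lintegral_pullback_eq {H : ℂ → ℂ} {s : Set ℂ} (hm : MeasurableSet s) (hs : s ⊆ strip) :
    ∫⁻ w in s, ‖pullback H w‖ₑ ^ 2 = ∫⁻ z in F '' s, ‖H z‖ₑ ^ 2 := by
  rw [lintegral_image_eq_lintegral_abs_det_fderiv_mul volume hm
    (fun w hw => (hasFDerivAt_real_of_hasDerivAt
      (hasDerivAt_F (cosh_ne_zero_of_mem_strip (hs hw)))).hasFDerivWithinAt)
    (bijOn_F.injOn.mono hs) (fun z => ‖H z‖ₑ ^ 2)]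
  refine lintegral_congr fun w => ?_
  rw [det_smul_one, abs_of_nonneg (sq_nonneg _), ENNReal.ofReal_pow (norm_nonneg _), ofReal_norm,
    pullback, enorm_mul, mul_pow]
  congr 2
  rw [← ofReal_norm, ← ofReal_norm, norm_conj]

/-- For w₁ < L one has |cosh w| ≤ cosh L, so `F` keeps the truncated strip at distance at least 1 /
cosh L from the origin. -/
lemma lintegral_pullback_le {H : ℂ → ℂ} {L : ℝ} (hL : 0 ≤ L) :
    ∫⁻ w in strip ∩ {w | w.re < L}, ‖pullback H w‖ₑ ^ 2 ≤
      ∫⁻ z in outer (1 / Real.cosh L), ‖H z‖ₑ ^ 2 := by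
  rw [lintegral_pullback_eq (isOpen_strip.inter
    (isOpen_lt continuous_re continuous_const)).measurableSet Set.inter_subset_left]
  refine lintegral_mono_set ?_
  rintro _ ⟨w, hw, rfl⟩
  refine ⟨bijOn_F.mapsTo hw.1, ?_⟩
  have hc := norm_pos_iff.2 (cosh_ne_zero_of_mem_strip hw.1)
  rw [Metric.mem_ball, dist_zero_right, norm_F, not_lt]
  refine one_div_le_one_div_of_le hc ?_
  calc ‖cosh w‖ ≤ Real.cosh w.re := by
        rw [← abs_of_pos (Real.cosh_pos w.re), ← abs_norm, ← sq_le_sq, normSq_cosh, Real.cosh_sq]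
        linarith [Real.cos_sq_le_one w.im]
    _ ≤ Real.cosh L := by
        rw [Real.cosh_le_cosh, abs_of_pos hw.1.1, abs_of_nonneg hL]
        exact le_of_lt hw.2

/-! ### Test functions in elliptic coordinates -/

lemma gradient_re_mul_im {a s : ℝ → ℝ} (ha : Differentiable ℝ a) (hs : Differentiable ℝ s) (w : ℂ) :
    gradient (fun w : ℂ => a w.re * s w.im) w = ⟨deriv a w.re * s w.im, a w.re * deriv s w.im⟩ := by
  have h1 : DifferentiableAt ℝ (fun w : ℂ => a w.re) w :=
    (ha _).comp w reCLM.differentiableAt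
  have h2 : DifferentiableAt ℝ (fun w : ℂ => s w.im) w :=
    (hs _).comp w imCLM.differentiableAt
  rw [gradient_mul h1 h2, gradient_comp_real (f := fun w => w.re) (ha _) reCLM.differentiableAt,
    gradient_comp_real (f := fun w => w.im) (hs _) imCLM.differentiableAt, gradient_reCLM, gradient_imCLM]
  apply Complex.ext <;> simp [mul_comm]

lemma coordX_eq_zero_iff {z : ℂ} (hz : z ≠ 0) : coordX z = 0 ↔ ellA z = 1 :=
  Real.arcosh_eq_zero_iff (one_le_ellA hz)

lemma tendsto_coordX_zero (M : ℝ) : ∀ᶠ z in 𝓝 (0 : ℂ), z ≠ 0 → M < coordX z := by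
  have hc := Real.cosh_pos M
  filter_upwards [Metric.ball_mem_nhds (0 : ℂ) (one_div_pos.2 hc)] with z hz hz0
  have hn := norm_pos_iff.2 hz0
  rw [Metric.mem_ball, dist_zero_right, lt_one_div hn hc] at hz
  have h1 := hz.trans_le (inv_norm_le_ellA hz0)
  rw [← cosh_coordX hz0, Real.cosh_lt_cosh, abs_of_nonneg (coordX_nonneg hz0)] at h1
  exact (le_abs_self M).trans_lt h1

lemma tendsto_coordX_cobounded : Tendsto coordX (Bornology.cobounded ℂ) (𝓝 0) := by
  have hne : ∀ᶠ z : ℂ in Bornology.cobounded ℂ, z ≠ 0 := by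
    filter_upwards [(tendsto_norm_cobounded_atTop (E := ℂ)).eventually_gt_atTop 0] with z hz
    exact norm_pos_iff.1 hz
  have h1 : Tendsto (fun z : ℂ => 1 + 1 / ‖z‖) (Bornology.cobounded ℂ) (𝓝 1) := by
    simpa [Function.comp_def] using
      (tendsto_inv_atTop_zero.comp (tendsto_norm_cobounded_atTop (E := ℂ))).const_add 1
  have h2 : Tendsto ellA (Bornology.cobounded ℂ) (𝓝 1) :=
    tendsto_of_tendsto_of_tendsto_of_le_of_le' tendsto_const_nhds h1
      (hne.mono fun z => one_le_ellA) (hne.mono fun z => ellA_le)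
  have h3 : Tendsto ellA (Bornology.cobounded ℂ) (𝓝[Set.Ici 1] 1) :=
    tendsto_nhdsWithin_iff.2 ⟨h2, hne.mono fun z => one_le_ellA⟩
  have h4 := (Real.continuousOn_arcosh 1 Set.self_mem_Ici).tendsto.comp h3
  rw [Real.arcosh_zero] at h4
  exact h4

/-- The function `a(w₁) s(w₂)` as a function of `z = F(w)`, with the value `c` at the origin. -/
noncomputable def ellProd (a s : ℝ → ℝ) (c : ℝ) (z : ℂ) : ℝ :=
  if z = 0 then c else a (coordX z) * s (coordY z)

lemma ellProd_of_ne {a s : ℝ → ℝ} {c : ℝ} {z : ℂ} (hz : z ≠ 0) :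
    ellProd a s c z = a (coordX z) * s (coordY z) := if_neg hz

lemma ellProd_eventuallyEq {a s : ℝ → ℝ} {c : ℝ} {z : ℂ} (hz : z ≠ 0) :
    ellProd a s c =ᶠ[𝓝 z] fun z => a (coordX z) * s (coordY z) := by
  filter_upwards [isOpen_ne.mem_nhds hz] with y hy using ellProd_of_ne hy

lemma F_ne_zero {w : ℂ} (hw : w ∈ strip) : F w ≠ 0 :=
  ne_zero_of_mem_halfPlane (bijOn_F.mapsTo hw)

lemma ellProd_F {a s : ℝ → ℝ} {c : ℝ} {w : ℂ} (hw : w ∈ strip) :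
    ellProd a s c (F w) = a w.re * s w.im := by
  rw [ellProd_of_ne (F_ne_zero hw), coordX_F hw, coordY_F hw]

lemma gradient_ellProd_F {a s : ℝ → ℝ} {c : ℝ} (ha : Differentiable ℝ a) (hs : Differentiable ℝ s)
    {w : ℂ} (hw : w ∈ strip) :
    gradient (fun w => ellProd a s c (F w)) w =
      ⟨deriv a w.re * s w.im, a w.re * deriv s w.im⟩ := by
  rw [← gradient_re_mul_im ha hs]
  apply Filter.EventuallyEq.gradient_eq
  filter_upwards [isOpen_strip.mem_nhds hw] with y hy using ellProd_F hy

/-- `coordX` tends to infinity at 0, so `a` has reached its final value there. The limit is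
independent of the direction only if that value is 0 or the angular factor is 1. -/
lemma ellProd_eventuallyEq_zero {a s : ℝ → ℝ} {c M : ℝ} (h : ∀ x, M < x → a x = c)
    (hcs : c = 0 ∨ ∀ y, s y = 1) : ellProd a s c =ᶠ[𝓝 0] fun _ => c := by
  filter_upwards [tendsto_coordX_zero M] with z hz
  by_cases h0 : z = 0
  · rw [ellProd, if_pos h0]
  · rw [ellProd_of_ne h0, h _ (hz h0)]
    rcases hcs with h1 | h1 <;> simp [h1]

/-! #### Functions vanishing on the Dirichlet part -/

lemma ellProd_eventuallyEq_zero_of_slit {a s : ℝ → ℝ} {M : ℝ} (haM : ∀ x, M < x → a x = 0)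
    (hs0 : s =ᶠ[𝓝 0] 0) (hsπ : s =ᶠ[𝓝 Real.pi] 0) {z : ℂ} (hz : z = 0 ∨ |ellB z| = 1) :
    ellProd a s 0 =ᶠ[𝓝 z] fun _ => 0 := by
  rcases eq_or_ne z 0 with rfl | h0
  · exact ellProd_eventuallyEq_zero haM (Or.inl rfl)
  have hB := hz.resolve_left h0
  have hc := (continuousAt_coordY h0).tendsto
  have hs : s =ᶠ[𝓝 (coordY z)] 0 := by
    rcases eq_or_eq_neg_of_abs_eq hB with h | h
    · rwa [coordY, h, Real.arccos_one]
    · rwa [coordY, h, Real.arccos_neg_one]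
  filter_upwards [ellProd_eventuallyEq h0, hc.eventually hs] with y hy1 hy2
  rw [hy1, hy2]; simp

/-- Vanishing of s near 0 and π removes the non-smoothness of `coordY` on the slit, and constancy of
`a` near 0 removes that of `coordX` on the outer rays. The value c on these rays is free, as suits a
Neumann condition; compactness of the support is not claimed. -/
lemma contDiff_ellProd {a s : ℝ → ℝ} {c M : ℝ} (ha : ContDiff ℝ ∞ a) (hs : ContDiff ℝ ∞ s)
    (ha0 : a =ᶠ[𝓝 0] fun _ => c) (haM : ∀ x, M < x → a x = 0)
    (hs0 : s =ᶠ[𝓝 0] 0) (hsπ : s =ᶠ[𝓝 Real.pi] 0) : ContDiff ℝ ∞ (ellProd a s 0) := by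
  refine contDiff_iff_contDiffAt.2 fun z => ?_
  by_cases hz : z = 0 ∨ |ellB z| = 1
  · exact contDiffAt_const.congr_of_eventuallyEq
      (ellProd_eventuallyEq_zero_of_slit haM hs0 hsπ hz)
  · push Not at hz
    have hB := lt_of_le_of_ne (abs_ellB_le_one hz.1) hz.2
    have h2 := hs.contDiffAt.comp z (contDiffAt_coordY hz.1 hB)
    rcases (one_le_ellA hz.1).lt_or_eq with hA | hA
    · exact ((ha.contDiffAt.comp z (contDiffAt_coordX hA)).mul h2).congr_of_eventuallyEq
        (ellProd_eventuallyEq hz.1)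
    · have hX : coordX z = 0 := (coordX_eq_zero_iff hz.1).2 hA.symm
      have hc := (continuousAt_coordX hz.1).tendsto
      rw [hX] at hc
      refine (contDiffAt_const (c := c) |>.mul h2).congr_of_eventuallyEq ?_
      filter_upwards [ellProd_eventuallyEq hz.1, hc.eventually ha0] with y hy1 hy2
      rw [hy1, hy2]; rfl

/-! #### Functions vanishing on the Neumann part -/

/-- The angle `coordY` is not smooth across the slit, but cos(n w₂) is the Chebyshev polynomial T_n
in cos w₂ = `ellB`, which is. -/
lemma ellProd_cos_eventuallyEq {a : ℝ → ℝ} {c : ℝ} (n : ℕ) {z : ℂ} (hz : z ≠ 0) :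
    ellProd a (fun y => Real.cos (n * y)) c =ᶠ[𝓝 z]
      fun z => a (coordX z) * (Polynomial.Chebyshev.T ℝ n).eval (ellB z) := by
  filter_upwards [isOpen_ne.mem_nhds hz] with y hy
  obtain ⟨h1, h2⟩ := abs_le.1 (abs_ellB_le_one hy)
  rw [ellProd_of_ne hy]
  have := Polynomial.Chebyshev.T_real_cos (coordY y) n
  simp only [Int.cast_natCast] at this
  rw [← this, coordY, Real.cos_arccos h1 h2]

/-- `coordX` vanishes on the outer rays and tends to 0 at infinity, so vanishing of `b` near 0 gives
smoothness across the rays, compact support and the support condition. The value c at the origin may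
be nonzero only for n = 0. -/
lemma isTest_ellProd_cos {b : ℝ → ℝ} {c M : ℝ} {n : ℕ} (hb : ContDiff ℝ ∞ b)
    (hb0 : b =ᶠ[𝓝 0] 0) (hbM : ∀ x, M < x → b x = c) (hcn : c = 0 ∨ n = 0) :
    IsTest (ellProd b (fun y => Real.cos (n * y)) c) ∧
    ellProd b (fun y => Real.cos (n * y)) c =ᶠ[𝓝 0] (fun _ => c) ∧
    ∀ t : ℝ, (t : ℂ) ∈ tsupport (ellProd b (fun y => Real.cos (n * y)) c) → |t| < 1 := by
  have h0 : ellProd b (fun y => Real.cos (n * y)) c =ᶠ[𝓝 0] (fun _ => c) :=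
    ellProd_eventuallyEq_zero hbM (hcn.imp_right fun h y => by simp [h])
  have h1 : ∀ z, z ≠ 0 → ellA z = 1 →
      ellProd b (fun y => Real.cos (n * y)) c =ᶠ[𝓝 z] fun _ => 0 := fun z hz hA => by
    have hX : coordX z = 0 := (coordX_eq_zero_iff hz).2 hA
    have hc := (continuousAt_coordX hz).tendsto
    rw [hX] at hc
    filter_upwards [ellProd_eventuallyEq hz, hc.eventually hb0] with y hy1 hy2
    rw [hy1, hy2]; simp
  refine ⟨⟨contDiff_iff_contDiffAt.2 fun z => ?_, ?_⟩, h0, fun t ht => ?_⟩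
  · rcases eq_or_ne z 0 with rfl | hz
    · exact contDiffAt_const.congr_of_eventuallyEq h0
    · rcases (one_le_ellA hz).lt_or_eq with hA | hA
      · obtain ⟨_, h2, h3⟩ := ellA_ne_one_ne hA
        refine ContDiffAt.congr_of_eventuallyEq ?_ (ellProd_cos_eventuallyEq n hz)
        refine (hb.contDiffAt.comp z (contDiffAt_coordX hA)).mul ?_
        have h4 : ContDiff ℝ ∞ fun x : ℝ => (Polynomial.Chebyshev.T ℝ n).eval x :=
          (Polynomial.contDiff_aeval _ _)
        exact h4.contDiffAt.comp z (contDiffAt_ellB hz h2 h3)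
      · exact contDiffAt_const.congr_of_eventuallyEq (h1 z hz hA.symm)
  · rw [hasCompactSupport_iff_eventuallyEq, coclosedCompact_eq_cocompact,
      ← Metric.cobounded_eq_cocompact]
    filter_upwards [tendsto_coordX_cobounded.eventually hb0,
      (tendsto_norm_cobounded_atTop (E := ℂ)).eventually_gt_atTop 0] with z hz hz0
    rw [ellProd_of_ne (norm_pos_iff.1 hz0), hz]; simp
  · by_contra! hge
    have ht0 : (t : ℂ) ≠ 0 := by
      rw [Ne, ofReal_eq_zero]; rintro rfl; simp at hge; linarith
    exact notMem_tsupport_iff_eventuallyEq.2 (h1 t ht0 (ellA_ofReal_of_one_le hge)) ht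

/-! ### Integrability of the pulled-back field -/

lemma strip_eq : strip = Set.Ioi 0 ×ℂ Set.Ioo 0 Real.pi := by
  ext w; simp [strip, mem_reProdIm]

lemma volume_strip_inter_lt (L : ℝ) : volume (strip ∩ {w : ℂ | w.re < L}) < ⊤ := by
  have : strip ∩ {w : ℂ | w.re < L} ⊆ Set.Ioo 0 L ×ℂ Set.Ioo 0 Real.pi := by
    rintro w ⟨h1, h2⟩
    exact ⟨⟨h1.1, h2⟩, h1.2⟩
  refine (measure_mono this).trans_lt ?_
  rw [volume_reProdIm, Real.volume_Ioo, Real.volume_Ioo]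
  exact ENNReal.mul_lt_top ENNReal.ofReal_lt_top ENNReal.ofReal_lt_top

lemma measurable_pullback {H : ℂ → ℂ} (hm : Measurable H) : Measurable (pullback H) := by
  have h1 : Measurable F := measurable_const.div continuous_cosh.measurable
  have h2 : Measurable fun w => sinh w / cosh w ^ 2 :=
    continuous_sinh.measurable.div (continuous_cosh.measurable.pow_const 2)
  exact (continuous_conj.measurable.comp h2).mul (hm.comp h1)

namespace IsHomogeneousSolution

variable {d : ℂ → ℝ} {H : ℂ → ℂ}

lemma aestronglyMeasurable (h : IsHomogeneousSolution d H) :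
    AEStronglyMeasurable H (volume.restrict halfPlane) := by
  have : halfPlane = ⋃ n : ℕ, outer (1 / ((n : ℝ) + 1)) := by
    refine Set.Subset.antisymm (fun z hz => ?_) (Set.iUnion_subset fun n => outer_subset_halfPlane _)
    obtain ⟨n, hn⟩ := exists_nat_one_div_lt (norm_pos_iff.2 (ne_zero_of_mem_halfPlane hz))
    exact Set.mem_iUnion.2 ⟨n, hz, by simpa using hn.le⟩
  rw [this, aestronglyMeasurable_iUnion_iff]
  exact fun n => (h.memLp _ (by positivity)).1

/-- The field is later composed with `F` and restricted to vertical lines, which is safest for an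
everywhere measurable representative. -/
lemma exists_measurable (h : IsHomogeneousSolution d H) :
    ∃ H' : ℂ → ℂ, Measurable H' ∧ IsHomogeneousSolution d H' ∧
      H =ᵐ[volume.restrict halfPlane] H' := by
  have hm := h.aestronglyMeasurable
  have hae := hm.ae_eq_mk
  have haer : ∀ r, H =ᵐ[volume.restrict (outer r)] hm.mk H := fun r =>
    ae_restrict_of_ae_restrict_of_subset (outer_subset_halfPlane r) hae
  have htr : ∀ J, HasTraceOn d H J 0 → HasTraceOn d (hm.mk H) J 0 := fun J hJ ζ hζ hs => by
    rw [← hJ ζ hζ hs]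
    refine integral_congr_ae ?_
    filter_upwards [hae] with z hz
    rw [hz]
  refine ⟨hm.mk H, hm.stronglyMeasurable_mk.measurable, ⟨h.locallyIntegrableOn,
    h.integrableOn_smul, fun r hr => (memLp_congr_ae (haer r)).1 (h.memLp r hr), ?_,
    htr _ h.trace_left, htr _ h.trace_right, fun ζ hζ hs => ?_⟩, hae⟩
  · obtain ⟨C, hC, hC2⟩ := h.energy
    refine ⟨C, hC, fun r hr => le_trans (le_of_eq ?_) (hC2 r hr)⟩
    refine lintegral_congr_ae ?_
    filter_upwards [haer r] with z hz
    rw [hz]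
  · rw [← h.neumann ζ hζ hs]
    refine integral_congr_ae ?_
    filter_upwards [hae] with z hz
    rw [hz]

/-- The radius 1 / cosh L turns logarithmic growth at the origin into linear growth in the length of
the strip, through cosh L + 2 ≤ exp(L + 2). -/
lemma lintegral_pullback_lt_le (h : IsHomogeneousSolution d H) :
    ∃ C : ℝ, 0 ≤ C ∧ ∀ L : ℝ, 0 ≤ L →
      ∫⁻ w in strip ∩ {w | w.re < L}, ‖pullback H w‖ₑ ^ 2 ≤ ENNReal.ofReal (C * (L + 2)) := by
  obtain ⟨C, hC, hC2⟩ := h.energy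
  refine ⟨C, hC, fun L hL => (lintegral_pullback_le hL).trans
    ((hC2 _ (one_div_pos.2 (Real.cosh_pos L))).trans (ENNReal.ofReal_le_ofReal ?_))⟩
  refine mul_le_mul_of_nonneg_left ?_ hC
  rw [one_div_one_div, ← Real.exp_le_exp, Real.exp_log (by positivity), Real.exp_add]
  have h1 : Real.cosh L ≤ Real.exp L := by
    rw [Real.cosh_eq]
    linarith [Real.exp_le_exp.2 (by linarith : -L ≤ L)]
  have h2 := Real.add_one_le_exp (2 : ℝ)
  have h3 := Real.one_le_exp hL
  nlinarith

lemma memLp_pullback (h : IsHomogeneousSolution d H) (hm : Measurable H) (L : ℝ) :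
    MemLp (pullback H) 2 (volume.restrict (strip ∩ {w | w.re < L})) := by
  obtain ⟨C, hC, hC2⟩ := h.lintegral_pullback_lt_le
  have h1 : MemLp (pullback H) 2 (volume.restrict (strip ∩ {w | w.re < max L 0})) :=
    memLp_two_of_lintegral (measurable_pullback hm).aestronglyMeasurable
      ((hC2 _ (le_max_right _ _)).trans_lt ENNReal.ofReal_lt_top)
  have h2 : strip ∩ {w : ℂ | w.re < L} ⊆ strip ∩ {w : ℂ | w.re < max L 0} := fun w hw =>
    ⟨hw.1, lt_of_lt_of_le (show w.re < L from hw.2) (le_max_left _ _)⟩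
  exact h1.mono_measure (Measure.restrict_mono h2 le_rfl)

lemma integrableOn_pullback (h : IsHomogeneousSolution d H) (hm : Measurable H) (L : ℝ) :
    IntegrableOn (pullback H) (strip ∩ {w | w.re < L}) := by
  have : IsFiniteMeasure (volume.restrict (strip ∩ {w : ℂ | w.re < L})) :=
    ⟨by rw [Measure.restrict_apply_univ]; exact volume_strip_inter_lt L⟩
  exact (h.memLp_pullback hm L).integrable (by norm_num)

/-- Bounded multiples of the pulled-back field with bounded support are integrable. -/
lemma integrableOn_strip_of_le (h : IsHomogeneousSolution d H) (hm : Measurable H) {f : ℂ → ℝ}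
    {M K : ℝ} (hf : Measurable f) (hM : ∀ w ∈ strip, M < w.re → f w = 0)
    (hle : ∀ w ∈ strip, |f w| ≤ K * ‖pullback H w‖) : IntegrableOn f strip := by
  have h1 : IntegrableOn f (strip ∩ {w | w.re < M + 1}) := by
    refine Integrable.mono' ((h.integrableOn_pullback hm (M + 1)).norm.const_mul K)
      hf.aestronglyMeasurable ?_
    filter_upwards [ae_restrict_mem
      (isOpen_strip.inter (isOpen_lt continuous_re continuous_const)).measurableSet] with w hw
    exact hle w hw.1
  refine h1.of_forall_sdiff_eq_zero isOpen_strip.measurableSet fun w hw => hM w hw.1 ?_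
  have : ¬ w.re < M + 1 := fun hlt => hw.2 ⟨hw.1, hlt⟩
  linarith

lemma strip_integrand_integrable (h : IsHomogeneousSolution d H) (hm : Measurable H)
    {a b s t : ℝ → ℝ} {M Ka Kb Ks Kt : ℝ} (ha : Measurable a) (hb : Measurable b)
    (hs : Measurable s) (ht : Measurable t)
    (haM : ∀ x, M < x → a x = 0) (hbM : ∀ x, M < x → b x = 0)
    (hKa : ∀ x, |a x| ≤ Ka) (hKb : ∀ x, |b x| ≤ Kb) (hKs : ∀ x, |s x| ≤ Ks)
    (hKt : ∀ x, |t x| ≤ Kt) :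
    IntegrableOn (fun w => (pullback H w).re * (a w.re * s w.im) +
      (pullback H w).im * (b w.re * t w.im)) strip := by
  have hp := measurable_pullback hm
  refine h.integrableOn_strip_of_le hm (M := M) (K := Ka * Ks + Kb * Kt) ?_ (fun w _ hw => ?_)
    (fun w _ => ?_)
  · exact ((measurable_re.comp hp).mul ((ha.comp measurable_re).mul (hs.comp measurable_im))).add
      ((measurable_im.comp hp).mul ((hb.comp measurable_re).mul (ht.comp measurable_im)))
  · rw [haM _ hw, hbM _ hw]; ring
  · have h1 := abs_re_le_norm (pullback H w)
    have h2 := abs_im_le_norm (pullback H w)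
    have hKa0 := (abs_nonneg _).trans (hKa 0)
    have hKb0 := (abs_nonneg _).trans (hKb 0)
    refine (abs_add_le _ _).trans ?_
    rw [add_mul, abs_mul, abs_mul, abs_mul, abs_mul]
    refine add_le_add ?_ ?_
    · rw [mul_comm]
      exact mul_le_mul (mul_le_mul (hKa _) (hKs _) (abs_nonneg _) hKa0) h1 (abs_nonneg _)
        (mul_nonneg hKa0 ((abs_nonneg _).trans (hKs 0)))
    · rw [mul_comm]
      exact mul_le_mul (mul_le_mul (hKb _) (hKt _) (abs_nonneg _) hKb0) h2 (abs_nonneg _)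
        (mul_nonneg hKb0 ((abs_nonneg _).trans (hKt 0)))

/-- The curl equation on the strip. -/
lemma setIntegral_strip_curl (h : IsHomogeneousSolution d H) {b : ℝ → ℝ} {c M : ℝ} {n : ℕ}
    (hb : ContDiff ℝ ∞ b) (hb0 : b =ᶠ[𝓝 0] 0) (hbM : ∀ x, M < x → b x = c)
    (hcn : c = 0 ∨ n = 0) :
    ∫ w in strip, ((pullback H w).re * (n * b w.re * Real.sin (n * w.im)) +
      (pullback H w).im * (deriv b w.re * Real.cos (n * w.im))) = 0 := by
  obtain ⟨ht, h0, hs⟩ := isTest_ellProd_cos hb hb0 hbM hcn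
  have e := h.setIntegral_inner_rotated_gradient ht h0 hs
  rw [setIntegral_halfPlane_inner_eq I (fun z _ => ht.differentiable z)] at e
  rw [← e]
  refine setIntegral_congr_fun isOpen_strip.measurableSet fun w hw => ?_
  have hd : ∀ y : ℝ, HasDerivAt (fun y : ℝ => Real.cos (n * y)) (-Real.sin (n * y) * n) y :=
    fun y => (Real.hasDerivAt_cos _).comp y (by simpa using (hasDerivAt_id y).const_mul (n : ℝ))
  rw [gradient_ellProd_F (hb.differentiable (by norm_cast)) (fun y => (hd y).differentiableAt) hw,
    (hd w.im).deriv, inner_eq]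
  simp only [mul_re, mul_im, I_re, I_im]
  ring

end IsHomogeneousSolution

/-! ### Cutoffs at infinity and the divergence equation on the strip. -/

lemma norm_gradient_cutoff_le : ∃ K : ℝ, 0 ≤ K ∧ ∀ R : ℝ, 0 < R → ∀ z,
    ‖gradient (cutoff R) z‖ ≤ K / R := by
  obtain ⟨K, hK⟩ := (hasCompactSupport_gradient_cutoff one_pos).exists_bound_of_continuous
    (continuous_gradient_cutoff 1)
  refine ⟨K, (norm_nonneg _).trans (hK 0), fun R hR z => ?_⟩
  have h1 : cutoff R = fun z => cutoff 1 (z / (R : ℂ)) := by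
    ext z
    simp only [cutoff]
    rw [norm_div, norm_real, Real.norm_eq_abs, abs_of_pos hR, div_pow, one_pow, div_one]
  have hd : HasDerivAt (fun z : ℂ => z / (R : ℂ)) (1 / R) z := (hasDerivAt_id z).div_const _
  rw [h1, gradient_comp_holomorphic (ψ := cutoff 1) hd
    ((contDiff_cutoff 1).differentiable (by norm_cast) _), norm_mul, norm_conj, norm_div, norm_one,
    norm_real, Real.norm_eq_abs, abs_of_pos hR, one_div_mul_eq_div]
  gcongr
  exact hK _

lemma gradient_cutoff_eq_zero {R : ℝ} (hR : 0 < R) {z : ℂ} (hz : ‖z‖ < R / 2 ∨ R < ‖z‖) :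
    gradient (cutoff R) z = 0 := by
  rcases hz with hz | hz
  · have : cutoff R =ᶠ[𝓝 z] fun _ => 0 := by
      filter_upwards [(isOpen_lt continuous_norm continuous_const).mem_nhds hz] with y hy
      exact cutoff_of_le hR (le_of_lt hy)
    rw [this.gradient_eq, gradient_fun_const]
  · have : cutoff R =ᶠ[𝓝 z] fun _ => 1 := by
      filter_upwards [(isOpen_lt continuous_const continuous_norm).mem_nhds hz] with y hy
      exact cutoff_of_ge hR (le_of_lt hy)
    rw [this.gradient_eq, gradient_fun_const]

/-- The Dirichlet energy is scale invariant in the plane: the bound (K/R)² on a disc of area πR²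
does not depend on R. -/
lemma integral_sq_norm_gradient_cutoff_le {K R : ℝ} (hR : 0 < R)
    (hK : ∀ z, ‖gradient (cutoff R) z‖ ≤ K / R) (s : Set ℂ) :
    ∫ z in s, ‖gradient (cutoff R) z‖ ^ (2 : ℝ) ≤ K ^ 2 * Real.pi := by
  have hi : Integrable (fun z => ‖gradient (cutoff R) z‖ ^ (2 : ℝ)) := by
    have := ((continuous_gradient_cutoff R).memLp_of_hasCompactSupport (μ := volume) (p := 2)
      (hasCompactSupport_gradient_cutoff hR)).integrable_norm_rpow (by norm_num) (by norm_num)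
    simpa using this
  have h1 : ∫ z in s, ‖gradient (cutoff R) z‖ ^ (2 : ℝ) ≤
      ∫ z, ‖gradient (cutoff R) z‖ ^ (2 : ℝ) :=
    setIntegral_le_integral hi (Eventually.of_forall fun z => by positivity)
  have h2 : ∫ z, ‖gradient (cutoff R) z‖ ^ (2 : ℝ) =
      ∫ z in Metric.closedBall (0 : ℂ) R, ‖gradient (cutoff R) z‖ ^ (2 : ℝ) := by
    refine (setIntegral_eq_integral_of_forall_compl_eq_zero fun z hz => ?_).symm
    rw [gradient_cutoff_eq_zero hR (Or.inr (by simpa using hz))]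
    simp
  have h3 : ∫ z in Metric.closedBall (0 : ℂ) R, ‖gradient (cutoff R) z‖ ^ (2 : ℝ) ≤
      ∫ z in Metric.closedBall (0 : ℂ) R, (K / R) ^ 2 := by
    refine setIntegral_mono hi.integrableOn
      (integrableOn_const measure_closedBall_lt_top.ne) fun z => ?_
    simp only [Real.rpow_two]
    exact pow_le_pow_left₀ (norm_nonneg _) (hK z) 2
  refine h1.trans (h2.trans_le (h3.trans (le_of_eq ?_)))
  rw [setIntegral_const, Measure.real, Complex.volume_closedBall, ENNReal.toReal_mul,
    ENNReal.toReal_pow, ENNReal.toReal_ofReal hR.le]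
  simp
  field_simp

/-- The gradients of the cutoffs at infinity are asymptotically orthogonal to square integrable
fields. -/
lemma tendsto_setIntegral_cutoff_gradient {H : ℂ → ℂ} {ψ : ℂ → ℝ} {K : ℝ}
    (hH : MemLp H 2 (volume.restrict (outer 1))) (hψ : ∀ z ∈ halfPlane, |ψ z| ≤ K) :
    Tendsto (fun n : ℕ => ∫ z in halfPlane,
      ψ z * inner ℝ (H z) (gradient (cutoff ((n : ℝ) + 2)) z)) atTop (𝓝 0) := by
  obtain ⟨C, hC0, hC⟩ := norm_gradient_cutoff_le
  have hK0 : 0 ≤ K := (abs_nonneg _).trans (hψ I (by simp [halfPlane]))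
  set r : ℕ → ℝ := fun n => ((n : ℝ) + 2) / 2 with hr
  have hr1 : ∀ n, 1 ≤ r n := fun n => by
    have : (0 : ℝ) ≤ n := n.cast_nonneg
    simp only [hr]; linarith
  have hHn : ∀ n, MemLp H 2 (volume.restrict (outer (r n))) := fun n =>
    hH.mono_measure (Measure.restrict_mono (outer_anti (hr1 n)) le_rfl)
  -- The exteriors decrease to the empty set, so the energy of H on them tends to 0. By
  -- Cauchy–Schwarz this is paired with the bounded energy of the cutoffs.
  have hE : Tendsto (fun n => ∫ z in outer (r n), ‖H z‖ ^ (2 : ℝ)) atTop (𝓝 0) := by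
    have h1 := tendsto_setIntegral_of_antitone (μ := (volume : Measure ℂ))
      (f := fun z => ‖H z‖ ^ (2 : ℝ)) (s := fun n => outer (r n))
      (fun n => measurableSet_outer _) (fun m n hmn => outer_anti (by simp only [hr]; gcongr))
      ⟨0, by
        have := (hHn 0).integrable_norm_rpow (by norm_num) (by norm_num)
        simpa [IntegrableOn] using this⟩
    have h2 : ⋂ n, outer (r n) = ∅ := by
      refine Set.eq_empty_of_forall_notMem fun z hz => ?_
      obtain ⟨n, hn⟩ := exists_nat_gt (2 * ‖z‖)
      have := norm_ge_of_mem_outer (Set.mem_iInter.1 hz n)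
      simp only [hr] at this
      linarith
    rw [h2] at h1
    simpa using h1
  have hlim : Tendsto (fun n => K * ((∫ z in outer (r n), ‖H z‖ ^ (2 : ℝ)) ^ (1 / (2 : ℝ)) *
      (C ^ 2 * Real.pi) ^ (1 / (2 : ℝ)))) atTop (𝓝 0) := by
    have h1 := hE.rpow_const (p := 1 / (2 : ℝ)) (Or.inr (by norm_num))
    rw [Real.zero_rpow (by norm_num)] at h1
    simpa using (h1.mul_const ((C ^ 2 * Real.pi) ^ (1 / (2 : ℝ)))).const_mul K
  refine squeeze_zero_norm (fun n => ?_) hlim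
  have hR : (0 : ℝ) < (n : ℝ) + 2 := by positivity
  have hgL : MemLp (gradient (cutoff ((n : ℝ) + 2))) 2 (volume.restrict (outer (r n))) :=
    ((continuous_gradient_cutoff _).memLp_of_hasCompactSupport
      (hasCompactSupport_gradient_cutoff hR)).restrict _
  have hsub : ∫ z in halfPlane, ψ z * inner ℝ (H z) (gradient (cutoff ((n : ℝ) + 2)) z) =
      ∫ z in outer (r n), ψ z * inner ℝ (H z) (gradient (cutoff ((n : ℝ) + 2)) z) := by
    refine setIntegral_eq_of_subset_of_forall_sdiff_eq_zero isOpen_halfPlane.measurableSet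
      (outer_subset_halfPlane _) fun z hz => ?_
    have hlt : ‖z‖ < ((n : ℝ) + 2) / 2 := by
      by_contra hge
      exact hz.2 ⟨hz.1, by simpa [hr] using hge⟩
    rw [gradient_cutoff_eq_zero hR (Or.inl hlt)]
    simp
  rw [hsub]
  have hi : IntegrableOn (fun z => ‖H z‖ * ‖gradient (cutoff ((n : ℝ) + 2)) z‖) (outer (r n)) :=
    (hHn n).norm.integrable_mul hgL.norm
  have h2 : (2 : ENNReal) = ENNReal.ofReal 2 := by simp
  have hH2 := (hHn n).norm
  have hg2 := hgL.norm
  rw [h2] at hH2 hg2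
  calc _ ≤ ∫ z in outer (r n), K * (‖H z‖ * ‖gradient (cutoff ((n : ℝ) + 2)) z‖) := by
        refine norm_integral_le_of_norm_le (hi.const_mul K) ?_
        filter_upwards [ae_restrict_mem (measurableSet_outer _)] with z hz
        rw [norm_mul, Real.norm_eq_abs]
        exact mul_le_mul (hψ z (outer_subset_halfPlane _ hz)) (norm_inner_le_norm _ _)
          (norm_nonneg _) hK0
    _ = K * ∫ z in outer (r n), ‖H z‖ * ‖gradient (cutoff ((n : ℝ) + 2)) z‖ :=
        integral_const_mul _ _
    _ ≤ _ := by
        refine mul_le_mul_of_nonneg_left ?_ hK0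
        refine (integral_mul_le_Lp_mul_Lq_of_nonneg Real.HolderConjugate.two_two
          (Eventually.of_forall fun z => norm_nonneg _)
          (Eventually.of_forall fun z => norm_nonneg _) hH2 hg2).trans ?_
        refine mul_le_mul_of_nonneg_left (Real.rpow_le_rpow
          (integral_nonneg fun z => by positivity)
          (integral_sq_norm_gradient_cutoff_le hR (hC _ hR) _) (by norm_num))
          (Real.rpow_nonneg (integral_nonneg fun z => by positivity) _)

/-- The divergence equation on the strip, for test functions vanishing near the horizontal
boundary. -/
lemma IsHomogeneousSolution.setIntegral_strip_div_of_eventuallyEq {d : ℂ → ℝ} {H : ℂ → ℂ}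
    (h : IsHomogeneousSolution d H) (hm : Measurable H) {a s : ℝ → ℝ} {c M Ka Kb Ks Kt : ℝ}
    (ha : ContDiff ℝ ∞ a) (hs : ContDiff ℝ ∞ s) (ha0 : a =ᶠ[𝓝 0] fun _ => c)
    (haM : ∀ x, M < x → a x = 0) (hs0 : s =ᶠ[𝓝 0] 0) (hsπ : s =ᶠ[𝓝 Real.pi] 0)
    (hKa : ∀ x, |deriv a x| ≤ Ka) (hKb : ∀ x, |a x| ≤ Kb) (hKs : ∀ x, |s x| ≤ Ks)
    (hKt : ∀ x, |deriv s x| ≤ Kt) :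
    ∫ w in strip, ((pullback H w).re * (deriv a w.re * s w.im) +
      (pullback H w).im * (a w.re * deriv s w.im)) = 0 := by
  set ψ := ellProd a s 0 with hψ
  have hψc : ContDiff ℝ ∞ ψ := contDiff_ellProd ha hs ha0 haM hs0 hsπ
  have hψd : Differentiable ℝ ψ := hψc.differentiable (by norm_cast)
  have had : Differentiable ℝ a := ha.differentiable (by norm_cast)
  have hsd : Differentiable ℝ s := hs.differentiable (by norm_cast)
  have hψb : ∀ z ∈ halfPlane, |ψ z| ≤ Kb * Ks := fun z hz => by
    rw [hψ, ellProd_of_ne (ne_zero_of_mem_halfPlane hz), abs_mul]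
    exact mul_le_mul (hKb _) (hKs _) (abs_nonneg _) ((abs_nonneg _).trans (hKb 0))
  have hdM : ∀ x, M < x → deriv a x = 0 := fun x hx => by
    have : a =ᶠ[𝓝 x] fun _ => 0 := by
      filter_upwards [lt_mem_nhds hx] with y hy using haM y hy
    rw [this.deriv_eq, deriv_const]
  have hgF : ∀ w ∈ strip, inner ℝ (pullback H w) (1 * gradient (fun w => ψ (F w)) w) =
      (pullback H w).re * (deriv a w.re * s w.im) +
      (pullback H w).im * (a w.re * deriv s w.im) := fun w hw => by
    rw [gradient_ellProd_F had hsd hw, one_mul, inner_eq]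
  have hiS := h.strip_integrand_integrable hm (measurable_deriv a) ha.continuous.measurable
    hs.continuous.measurable (measurable_deriv s) hdM haM hKa hKb hKs hKt
  have hiH : IntegrableOn (fun z => inner ℝ (H z) (1 * gradient ψ z)) halfPlane := by
    rw [integrableOn_strip_inner_iff 1 (fun z _ => hψd z)]
    exact hiS.congr_fun (fun w hw => (hgF w hw).symm) isOpen_strip.measurableSet
  have hval := setIntegral_halfPlane_inner_eq (H := H) 1 (fun z _ => hψd z)
  rw [setIntegral_congr_fun isOpen_strip.measurableSet hgF] at hval
  rw [← hval]
  simp only [one_mul] at hiH ⊢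
  -- test with the product of `ψ` and a cutoff at infinity
  have htest : ∀ n : ℕ, ∫ z in halfPlane, (1 - cutoff ((n : ℝ) + 2) z) * inner ℝ (H z) (gradient ψ z) =
      ∫ z in halfPlane, ψ z * inner ℝ (H z) (gradient (cutoff ((n : ℝ) + 2)) z) := fun n => by
    have hR : (0 : ℝ) < (n : ℝ) + 2 := by positivity
    have hcd : Differentiable ℝ (cutoff ((n : ℝ) + 2)) :=
      (contDiff_cutoff _).differentiable (by norm_cast)
    have ht : IsTest (fun z => (1 - cutoff ((n : ℝ) + 2) z) * ψ z) := by
      refine ⟨(contDiff_const.sub (contDiff_cutoff _)).mul hψc, ?_⟩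
      refine HasCompactSupport.intro (isCompact_closedBall (0 : ℂ) ((n : ℝ) + 2)) fun z hz => ?_
      rw [cutoff_of_ge hR (by simp at hz; exact hz.le), sub_self, zero_mul]
    have hsupp : ∀ t : ℝ, (t : ℂ) ∈ tsupport (fun z => (1 - cutoff ((n : ℝ) + 2) z) * ψ z) →
        t < -1 ∨ 1 < t := fun t ht => by
      have ht' : (t : ℂ) ∈ tsupport ψ := tsupport_mul_subset_right ht
      by_contra! hcon
      refine notMem_tsupport_iff_eventuallyEq.2
        (ellProd_eventuallyEq_zero_of_slit haM hs0 hsπ ?_) ht'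
      rcases lt_trichotomy t 0 with h0 | h0 | h0
      · exact Or.inr (by rw [ellB_ofReal_of_neg hcon.1 h0, abs_one])
      · exact Or.inl (by simp [h0])
      · exact Or.inr (by rw [ellB_ofReal_of_pos hcon.2 h0, abs_neg, abs_one])
    have e := h.neumann _ ht hsupp
    have hg : ∀ z, inner ℝ (H z) (gradient (fun z => (1 - cutoff ((n : ℝ) + 2) z) * ψ z) z) =
        (1 - cutoff ((n : ℝ) + 2) z) * inner ℝ (H z) (gradient ψ z) -
        ψ z * inner ℝ (H z) (gradient (cutoff ((n : ℝ) + 2)) z) := fun z => by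
      rw [gradient_mul ((hcd z).const_sub 1) (hψd z), gradient_const_sub, inner_add_right,
        inner_smul_right, inner_smul_right, inner_neg_right]
      ring
    simp only [hg] at e
    rw [integral_sub] at e
    · exact sub_eq_zero.1 e
    · refine hiH.bdd_mul (c := 1)
        (continuous_const.sub (contDiff_cutoff _).continuous).aestronglyMeasurable
        (Eventually.of_forall fun z => ?_)
      rw [Real.norm_eq_abs, abs_le]
      constructor <;> linarith [cutoff_nonneg ((n : ℝ) + 2) z, cutoff_le_one ((n : ℝ) + 2) z]
    · have h0 : (0 : ℂ) ∉ tsupport (gradient (cutoff ((n : ℝ) + 2))) := fun hh => by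
        refine notMem_tsupport_iff_eventuallyEq.2 ?_ hh
        filter_upwards [Metric.ball_mem_nhds (0 : ℂ) (half_pos hR)] with z hz
        exact gradient_cutoff_eq_zero hR (Or.inl (by simpa using hz))
      refine (integrableOn_halfPlane_inner (continuous_gradient_cutoff _)
        (hasCompactSupport_gradient_cutoff hR) h0 h.memLp).bdd_mul (c := Kb * Ks)
        hψc.continuous.aestronglyMeasurable ?_
      filter_upwards [ae_restrict_mem isOpen_halfPlane.measurableSet] with z hz using hψb z hz
  have hlim1 := tendsto_setIntegral_cutoff_gradient (h.memLp 1 one_pos) hψb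
  have hlim2 := tendsto_integral_of_dominated_convergence (μ := volume.restrict halfPlane)
    (F := fun (n : ℕ) z => (1 - cutoff ((n : ℝ) + 2) z) * inner ℝ (H z) (gradient ψ z))
    (f := fun z => inner ℝ (H z) (gradient ψ z)) (fun z => ‖(inner ℝ (H z) (gradient ψ z) : ℝ)‖)
    (fun n => (continuous_const.sub (contDiff_cutoff _).continuous).aestronglyMeasurable.mul hiH.1)
    hiH.norm
    (fun n => Eventually.of_forall fun z => by
      rw [norm_mul]
      refine mul_le_of_le_one_left (norm_nonneg _) ?_
      rw [Real.norm_eq_abs, abs_le]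
      constructor <;> linarith [cutoff_nonneg ((n : ℝ) + 2) z, cutoff_le_one ((n : ℝ) + 2) z])
    (Eventually.of_forall fun z => by
      refine tendsto_const_nhds.congr' ?_
      obtain ⟨N, hN⟩ := exists_nat_gt (2 * ‖z‖)
      filter_upwards [eventually_ge_atTop N] with n hn
      have hn' : (N : ℝ) ≤ n := by exact_mod_cast hn
      rw [cutoff_of_le (by positivity) (by linarith), sub_zero, one_mul])
  simp only [htest] at hlim2
  exact tendsto_nhds_unique hlim2 hlim1

/-! ### Ordinary differential equations in the sense of distributions -/

lemma integrableOn_Ioi_mul {g q : ℝ → ℝ} (hg : LocallyIntegrableOn g (Set.Ioi 0))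
    (hq : Continuous q) (hc : HasCompactSupport q) (hs : tsupport q ⊆ Set.Ioi 0) :
    IntegrableOn (fun x => g x * q x) (Set.Ioi 0) := by
  have h1 : IntegrableOn g (tsupport q) := hg.integrableOn_compact_subset hs hc
  refine (h1.mul_continuousOn hq.continuousOn hc).of_forall_sdiff_eq_zero measurableSet_Ioi
    fun x hx => ?_
  rw [image_eq_zero_of_notMem_tsupport hx.2, mul_zero]

/-- The primitive vanishes near 0 and is eventually equal to the total mass. With mass zero it is
again a test function; with nonzero mass it is an admissible `b` in the curl equation for n = 0. -/
lemma exists_primitive {q : ℝ → ℝ} (hq : ContDiff ℝ ∞ q) (hc : HasCompactSupport q)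
    (hs : tsupport q ⊆ Set.Ioi 0) :
    ∃ b : ℝ → ℝ, ContDiff ℝ ∞ b ∧ deriv b = q ∧ (∃ ε, 0 < ε ∧ ∀ x, x < ε → b x = 0) ∧
      ∃ M, ∀ x, M < x → b x = ∫ t in Set.Ioi 0, q t := by
  have hd : deriv (fun x => ∫ t in (0 : ℝ)..x, q t) = q :=
    funext fun x => hq.continuous.deriv_integral q 0 x
  obtain ⟨ε, hε, hε2⟩ : ∃ ε, 0 < ε ∧ ∀ x, x < ε → q x = 0 := by
    have h0 : (0 : ℝ) ∉ tsupport q := fun h => lt_irrefl (0 : ℝ) (hs h)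
    obtain ⟨ε, hε, hb⟩ := Metric.isOpen_iff.1 (isClosed_tsupport q).isOpen_compl 0 h0
    refine ⟨ε, hε, fun x hx => image_eq_zero_of_notMem_tsupport fun hx2 => ?_⟩
    have hx0 : 0 < x := hs hx2
    exact hb (by simpa [abs_of_pos hx0] using hx) hx2
  obtain ⟨M, hM⟩ := hc.isBounded.subset_closedBall 0
  have hM2 : ∀ x, M < x → q x = 0 := fun x hx => image_eq_zero_of_notMem_tsupport fun hx2 => by
    have := hM hx2
    rw [Metric.mem_closedBall, dist_zero_right, Real.norm_eq_abs] at this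
    exact absurd (le_abs_self x) (by linarith)
  refine ⟨fun x => ∫ t in (0 : ℝ)..x, q t, contDiff_infty_iff_deriv.2
    ⟨fun x => (hq.continuous.integral_hasStrictDerivAt 0 x).hasDerivAt.differentiableAt,
      by rwa [hd]⟩, hd, ⟨ε, hε, fun x hx => ?_⟩, max M 0, fun x hx => ?_⟩
  · refine (intervalIntegral.integral_congr (g := fun _ => 0) fun t ht => hε2 t ?_).trans (by simp)
    rw [Set.uIcc, Set.mem_Icc] at ht
    exact ht.2.trans_lt (max_lt hε hx)
  · simp only
    rw [intervalIntegral.integral_of_le ((le_max_right _ _).trans hx.le)]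
    refine (setIntegral_eq_of_subset_of_forall_sdiff_eq_zero measurableSet_Ioi
      Set.Ioc_subset_Ioi_self fun t ht => hM2 t ?_).symm
    have h1 : ¬ t ≤ x := fun h => ht.2 ⟨ht.1, h⟩
    exact (le_max_left _ _).trans_lt (hx.trans (not_le.1 h1))

/-- Du Bois-Reymond's argument: subtracting from q its mass times a fixed bump p of mass one leaves
a function of mass zero, hence the derivative of a test function. The constant is the mean of g
against p. -/
lemma exists_ae_eq_const {g : ℝ → ℝ} (hg : LocallyIntegrableOn g (Set.Ioi 0))
    (h : ∀ α : ℝ → ℝ, ContDiff ℝ ∞ α → HasCompactSupport α → tsupport α ⊆ Set.Ioi 0 →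
      ∫ x in Set.Ioi 0, g x * deriv α x = 0) :
    ∃ c, ∀ᵐ x : ℝ, x ∈ Set.Ioi (0 : ℝ) → g x = c := by
  let B : ContDiffBump (1 : ℝ) := ⟨1 / 4, 1 / 2, by norm_num, by norm_num⟩
  set p : ℝ → ℝ := B.normed volume with hp
  have hpc : ContDiff ℝ ∞ p := B.contDiff_normed
  have hps : HasCompactSupport p := B.hasCompactSupport_normed
  have hpt : tsupport p ⊆ Set.Ioi 0 := by
    rw [hp, B.tsupport_normed_eq]
    intro x hx
    rw [Metric.mem_closedBall, Real.dist_eq, abs_le] at hx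
    have : B.rOut = 1 / 2 := rfl
    rw [this] at hx
    exact Set.mem_Ioi.2 (by linarith [hx.1])
  have hz : ∀ {q : ℝ → ℝ}, tsupport q ⊆ Set.Ioi 0 → ∀ f : ℝ → ℝ,
      ∫ x in Set.Ioi 0, q x * f x = ∫ x, q x * f x := fun hq f =>
    setIntegral_eq_integral_of_forall_compl_eq_zero fun x hx => by
      rw [image_eq_zero_of_notMem_tsupport (fun h => hx (hq h)), zero_mul]
  have hp1 : ∫ x in Set.Ioi 0, p x = 1 := by
    have := hz hpt 1
    simp only [Pi.one_apply, mul_one] at this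
    rw [this]
    exact B.integral_normed
  set c := ∫ x in Set.Ioi 0, g x * p x with hcdef
  refine ⟨c, ?_⟩
  have key := isOpen_Ioi.ae_eq_zero_of_integral_contDiff_smul_eq_zero
    (f := fun x => g x - c) (μ := volume) (U := Set.Ioi (0 : ℝ))
    (hg.sub (continuousOn_const.locallyIntegrableOn measurableSet_Ioi)) fun q hq hqc hqs => ?_
  · filter_upwards [key] with x hx hx0
    exact sub_eq_zero.1 (hx hx0)
  set A := ∫ x in Set.Ioi 0, q x with hA
  have hr : ContDiff ℝ ∞ (fun x => q x - A * p x) := hq.sub (contDiff_const.mul hpc)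
  have hrs : tsupport (fun x => q x - A * p x) ⊆ Set.Ioi 0 :=
    (tsupport_sub _ _).trans (Set.union_subset hqs (tsupport_mul_subset_right.trans hpt))
  have hrc : HasCompactSupport (fun x => q x - A * p x) := hqc.sub hps.mul_left
  have hqi : IntegrableOn q (Set.Ioi 0) :=
    (hq.continuous.integrable_of_hasCompactSupport hqc).integrableOn
  have hpi : IntegrableOn p (Set.Ioi 0) :=
    (hpc.continuous.integrable_of_hasCompactSupport hps).integrableOn
  have hr0 : ∫ x in Set.Ioi 0, (q x - A * p x) = 0 := by
    rw [integral_sub hqi (hpi.const_mul A), integral_const_mul, hp1]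
    ring
  obtain ⟨α, hα, hαd, ⟨ε, hε, hαε⟩, M, hαM⟩ := exists_primitive hr hrc hrs
  have hα0 : ∀ x, x ∉ Set.Icc ε M → α x = 0 := fun x hx => by
    rw [Set.mem_Icc, not_and_or, not_le, not_le] at hx
    rcases hx with hx | hx
    · exact hαε x hx
    · rw [hαM x hx, hr0]
  have hαt : tsupport α ⊆ Set.Icc ε M := closure_minimal
    (fun x hx => by_contra fun hx2 => hx (hα0 x hx2)) isClosed_Icc
  have e := h α hα (HasCompactSupport.intro isCompact_Icc fun x hx => hα0 x hx)
    (hαt.trans fun x hx => hε.trans_le hx.1)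
  rw [hαd] at e
  have i1 := integrableOn_Ioi_mul hg hq.continuous hqc hqs
  have i2 := integrableOn_Ioi_mul hg hpc.continuous hps hpt
  have e2 : ∫ x in Set.Ioi 0, g x * (q x - A * p x) = (∫ x in Set.Ioi 0, g x * q x) - A * c := by
    rw [hcdef, ← integral_const_mul, ← integral_sub i1 (i2.const_mul A)]
    exact integral_congr_ae (Eventually.of_forall fun x => by ring)
  simp only [smul_eq_mul]
  rw [← hz hqs]
  have e3 : ∫ x in Set.Ioi 0, q x * (g x - c) = (∫ x in Set.Ioi 0, g x * q x) - A * c := by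
    rw [hA, mul_comm _ c, ← integral_const_mul, ← integral_sub i1 (hqi.const_mul c)]
    exact integral_congr_ae (Eventually.of_forall fun x => by ring)
  rw [e3, ← e2, e]

/-- Weak solutions of `f' = l f` on `(0, ∞)`. -/
lemma exists_ae_eq_exp {f : ℝ → ℝ} (l : ℝ) (hf : LocallyIntegrableOn f (Set.Ioi 0))
    (h : ∀ a : ℝ → ℝ, ContDiff ℝ ∞ a → HasCompactSupport a → tsupport a ⊆ Set.Ioi 0 →
      ∫ x in Set.Ioi 0, f x * (deriv a x + l * a x) = 0) :
    ∃ c, ∀ᵐ x, x ∈ Set.Ioi (0 : ℝ) → f x = c * Real.exp (l * x) := by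
  have he : ContDiff ℝ ∞ (fun x : ℝ => Real.exp (-(l * x))) := by fun_prop
  -- The integrating factor exp(-l x), moved onto the test function, reduces the equation to g′ = 0.
  obtain ⟨c, hc⟩ := exists_ae_eq_const (g := fun x => f x * Real.exp (-(l * x)))
    (hf.mul_continuousOn he.continuous.continuousOn isOpen_Ioi.isLocallyClosed)
    fun α hα hαc hαs => by
      refine (integral_congr_ae (Eventually.of_forall fun x => ?_)).trans
        (h (fun x => Real.exp (-(l * x)) * α x) (he.mul hα) hαc.mul_left
        (tsupport_mul_subset_right.trans hαs))
      have hd : HasDerivAt (fun x : ℝ => Real.exp (-(l * x)))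
          (Real.exp (-(l * x)) * -(l * 1)) x := (((hasDerivAt_id x).const_mul l).neg).exp
      have hd2 : HasDerivAt _ _ x := hd.mul (hα.differentiable (by norm_cast) x).hasDerivAt
      simp only [Pi.mul_def] at hd2
      rw [hd2.deriv]
      ring
  refine ⟨c, ?_⟩
  filter_upwards [hc] with x hx hx0
  rw [← hx hx0, mul_assoc, ← Real.exp_add]
  simp

/-! ### Completeness of the trigonometric system on `(0, π)` -/

/-- Induction on the power with the frequency left free, by 2 cos y cos((n+1)y) = cos((n+2)y) +
cos(ny). Frequency 0 is separate, because there the extra cosine simply becomes frequency 1. -/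
lemma setIntegral_mul_cos_pow {f : ℝ → ℝ} (hf : IntegrableOn f (Set.Ioo 0 Real.pi))
    (h : ∀ n : ℕ, ∫ y in Set.Ioo 0 Real.pi, f y * Real.cos (n * y) = 0) (m : ℕ) :
    ∀ n : ℕ, ∫ y in Set.Ioo 0 Real.pi, f y * (Real.cos y ^ m * Real.cos (n * y)) = 0 := by
  have hi : ∀ m n : ℕ, IntegrableOn (fun y => f y * (Real.cos y ^ m * Real.cos (n * y)))
      (Set.Ioo 0 Real.pi) := fun m n => by
    refine hf.mul_bdd (c := 1) (by fun_prop) (Eventually.of_forall fun y => ?_)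
    rw [norm_mul, norm_pow]
    exact mul_le_one₀ (pow_le_one₀ (norm_nonneg _) (Real.abs_cos_le_one _)) (norm_nonneg _)
      (Real.abs_cos_le_one _)
  induction m with
  | zero => simpa using h
  | succ m ih =>
    rintro (_ | n)
    · refine (integral_congr_ae (Eventually.of_forall fun y => ?_)).trans (ih 1)
      simp [pow_succ]
    · have e : ∀ y, f y * (Real.cos y ^ (m + 1) * Real.cos ((n + 1 : ℕ) * y)) =
          1 / 2 * (f y * (Real.cos y ^ m * Real.cos ((n + 2 : ℕ) * y)) +
          f y * (Real.cos y ^ m * Real.cos (n * y))) := fun y => by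
        have e1 : ((n + 2 : ℕ) : ℝ) * y = (n + 1 : ℕ) * y + y := by push_cast; ring
        have e2 : (n : ℝ) * y = (n + 1 : ℕ) * y - y := by push_cast; ring
        rw [e1, e2, Real.cos_add, Real.cos_sub]
        ring
      simp only [e]
      rw [integral_const_mul, integral_add (hi m (n + 2)) (hi m n), ih, ih]
      simp

lemma setIntegral_mul_eval_cos {f : ℝ → ℝ} (hf : IntegrableOn f (Set.Ioo 0 Real.pi))
    (h : ∀ n : ℕ, ∫ y in Set.Ioo 0 Real.pi, f y * Real.cos (n * y) = 0) (p : Polynomial ℝ) :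
    ∫ y in Set.Ioo 0 Real.pi, f y * p.eval (Real.cos y) = 0 := by
  simp only [Polynomial.eval_eq_sum_range, Finset.mul_sum]
  have hi : ∀ m : ℕ, IntegrableOn (fun y => f y * (p.coeff m * Real.cos y ^ m))
      (Set.Ioo 0 Real.pi) := fun m => by
    refine hf.mul_bdd (c := ‖p.coeff m‖) (by fun_prop) (Eventually.of_forall fun y => ?_)
    rw [norm_mul, norm_pow]
    exact mul_le_of_le_one_right (norm_nonneg _)
      (pow_le_one₀ (norm_nonneg _) (Real.abs_cos_le_one _))
  rw [integral_finsetSum _ fun m _ => hi m]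
  refine Finset.sum_eq_zero fun m _ => ?_
  have := setIntegral_mul_cos_pow hf h m 0
  simp only [Nat.cast_zero, zero_mul, Real.cos_zero, mul_one] at this
  simp only [mul_left_comm _ (p.coeff m)]
  rw [integral_const_mul, this, mul_zero]

/-- On (0, π) every test function g is a continuous function of cos y, namely g ∘ arccos, so
Weierstrass approximates it uniformly by polynomials in cos y, to which f is orthogonal. -/
lemma ae_eq_zero_of_cos {f : ℝ → ℝ} (hf : IntegrableOn f (Set.Ioo 0 Real.pi))
    (h : ∀ n : ℕ, ∫ y in Set.Ioo 0 Real.pi, f y * Real.cos (n * y) = 0) :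
    ∀ᵐ y, y ∈ Set.Ioo 0 Real.pi → f y = 0 := by
  refine isOpen_Ioo.ae_eq_zero_of_integral_contDiff_smul_eq_zero hf.locallyIntegrableOn
    fun g hg hgc hgs => ?_
  have e0 : ∫ y, g y • f y = ∫ y in Set.Ioo 0 Real.pi, f y * g y := by
    rw [← setIntegral_eq_integral_of_forall_compl_eq_zero (s := Set.Ioo 0 Real.pi)]
    · simp only [smul_eq_mul, mul_comm]
    · intro x hx
      rw [image_eq_zero_of_notMem_tsupport (fun h => hx (hgs h)), zero_smul]
  rw [e0]
  have hc : ContinuousOn (fun t => g (Real.arccos t)) (Set.Icc (-1) 1) :=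
    (hg.continuous.comp Real.continuous_arccos).continuousOn
  set A := ∫ y in Set.Ioo 0 Real.pi, ‖f y‖ with hA
  have hA0 : 0 ≤ A := integral_nonneg fun y => norm_nonneg _
  obtain ⟨K, hK⟩ := hgc.exists_bound_of_continuous hg.continuous
  have hle : ∀ ε, 0 < ε → |∫ y in Set.Ioo 0 Real.pi, f y * g y| ≤ A * ε := fun ε hε => by
    obtain ⟨p, hp⟩ := exists_polynomial_near_of_continuousOn (-1) 1 _ hc ε hε
    have hpb : ∀ y ∈ Set.Ioo 0 Real.pi, |g y - p.eval (Real.cos y)| ≤ ε := fun y hy => by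
      have := hp (Real.cos y) ⟨Real.neg_one_le_cos y, Real.cos_le_one y⟩
      rw [Real.arccos_cos hy.1.le hy.2.le] at this
      rw [abs_sub_comm]
      exact this.le
    have i1 : IntegrableOn (fun y => f y * g y) (Set.Ioo 0 Real.pi) :=
      hf.mul_bdd hg.continuous.aestronglyMeasurable (Eventually.of_forall hK)
    have i3 : IntegrableOn (fun y => f y * (g y - p.eval (Real.cos y))) (Set.Ioo 0 Real.pi) := by
      refine hf.mul_bdd (c := ε) (hg.continuous.sub
        (p.continuous.comp Real.continuous_cos)).aestronglyMeasurable ?_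
      filter_upwards [ae_restrict_mem measurableSet_Ioo] with y hy using hpb y hy
    have i2 : IntegrableOn (fun y => f y * p.eval (Real.cos y)) (Set.Ioo 0 Real.pi) := by
      refine (i1.sub i3).congr (Eventually.of_forall fun y => ?_)
      simp only [Pi.sub_apply]
      ring
    have e : ∫ y in Set.Ioo 0 Real.pi, f y * g y =
        ∫ y in Set.Ioo 0 Real.pi, f y * (g y - p.eval (Real.cos y)) := by
      have := integral_sub i1 i2
      rw [setIntegral_mul_eval_cos hf h p, sub_zero] at this
      rw [← this]
      exact integral_congr_ae (Eventually.of_forall fun y => by ring)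
    rw [e, hA, ← integral_mul_const, ← Real.norm_eq_abs]
    refine norm_integral_le_of_norm_le (hf.norm.mul_const ε) ?_
    filter_upwards [ae_restrict_mem measurableSet_Ioo] with y hy
    rw [norm_mul]
    exact mul_le_mul_of_nonneg_left (hpb y hy) (norm_nonneg _)
  have h0 : |∫ y in Set.Ioo 0 Real.pi, f y * g y| ≤ 0 := by
    refine le_of_forall_pos_le_add fun δ hδ => ?_
    have := hle (δ / (A + 1)) (by positivity)
    refine this.trans ?_
    rw [zero_add, mul_div_assoc', div_le_iff₀ (by positivity)]
    nlinarith
  exact abs_eq_zero.1 (le_antisymm h0 (abs_nonneg _))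

/-- Reduces to cosines for f · sin, since 2 sin y cos((n+1)y) = sin((n+2)y) - sin(ny), and sin is
positive on (0, π). -/
lemma ae_eq_zero_of_sin {f : ℝ → ℝ} (hf : IntegrableOn f (Set.Ioo 0 Real.pi))
    (h : ∀ n : ℕ, ∫ y in Set.Ioo 0 Real.pi, f y * Real.sin ((n + 1 : ℕ) * y) = 0) :
    ∀ᵐ y, y ∈ Set.Ioo 0 Real.pi → f y = 0 := by
  have hi : ∀ c : ℝ, IntegrableOn (fun y => f y * Real.sin (c * y)) (Set.Ioo 0 Real.pi) :=
    fun c => hf.mul_bdd (c := 1) (by fun_prop) (Eventually.of_forall fun y => Real.abs_sin_le_one _)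
  have h' : ∀ n : ℕ, ∫ y in Set.Ioo 0 Real.pi, f y * Real.sin (n * y) = 0 := by
    rintro (_ | n)
    · simp
    · exact h n
  have key := ae_eq_zero_of_cos (f := fun y => f y * Real.sin y) (by simpa using hi 1) fun n => ?_
  · filter_upwards [key] with y hy hy0
    exact (mul_eq_zero.1 (hy hy0)).resolve_right (Real.sin_pos_of_pos_of_lt_pi hy0.1 hy0.2).ne'
  · rcases n with _ | n
    · simpa using h 0
    · have e : ∀ y, f y * Real.sin y * Real.cos ((n + 1 : ℕ) * y) =
          1 / 2 * (f y * Real.sin ((n + 2 : ℕ) * y) - f y * Real.sin (n * y)) := fun y => by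
        have e1 : ((n + 2 : ℕ) : ℝ) * y = (n + 1 : ℕ) * y + y := by push_cast; ring
        have e2 : (n : ℝ) * y = (n + 1 : ℕ) * y - y := by push_cast; ring
        rw [e1, e2, Real.sin_add, Real.sin_sub]
        ring
      simp only [e]
      rw [integral_const_mul, integral_sub (hi _) (hi _), h', h']
      simp

/-! ### Fourier coefficients of the pulled-back field -/

lemma exists_abs_eval_cos_le (p : Polynomial ℝ) : ∃ B, ∀ y, |p.eval (Real.cos y)| ≤ B := by
  obtain ⟨B, hB⟩ := (isCompact_Icc (a := (-1 : ℝ)) (b := 1)).exists_bound_of_continuousOn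
    p.continuous.continuousOn
  exact ⟨B, fun y => hB _ ⟨Real.neg_one_le_cos y, Real.cos_le_one y⟩⟩

lemma strip_inter_lt (L : ℝ) :
    strip ∩ {w : ℂ | w.re < L} = Set.Ioo 0 L ×ℂ Set.Ioo 0 Real.pi := by
  ext w
  simp only [strip, Set.mem_inter_iff, Set.mem_ofPred_eq, mem_reProdIm, Set.mem_Ioo]
  tauto

lemma setIntegral_strip_mul {f : ℂ → ℝ} {α s : ℝ → ℝ}
    (hi : IntegrableOn (fun w => f w * (α w.re * s w.im)) strip) :
    ∫ w in strip, f w * (α w.re * s w.im) =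
      ∫ x in Set.Ioi 0, (∫ y in Set.Ioo 0 Real.pi, f ⟨x, y⟩ * s y) * α x := by
  rw [strip_eq, integrableOn_reProdIm] at hi
  rw [strip_eq, setIntegral_reProdIm]
  refine (setIntegral_prod _ hi).trans (integral_congr_ae (Eventually.of_forall fun x => ?_))
  simp only
  rw [← integral_mul_const]
  exact integral_congr_ae (Eventually.of_forall fun y => by ring)

lemma integrableOn_setIntegral_mul {f : ℂ → ℝ} {L : ℝ} {s : ℝ → ℝ}
    (hf : IntegrableOn f (strip ∩ {w | w.re < L})) (hs : Continuous s) (hs1 : ∀ y, |s y| ≤ 1) :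
    IntegrableOn (fun x => ∫ y in Set.Ioo 0 Real.pi, f ⟨x, y⟩ * s y) (Set.Ioo 0 L) ∧
    ∫ x in Set.Ioo 0 L, |∫ y in Set.Ioo 0 Real.pi, f ⟨x, y⟩ * s y| ≤
      ∫ w in strip ∩ {w | w.re < L}, |f w| := by
  have hf' : IntegrableOn (fun w => f w * s w.im) (strip ∩ {w | w.re < L}) :=
    hf.mul_bdd (hs.comp continuous_im).aestronglyMeasurable (Eventually.of_forall fun w => hs1 _)
  have hle : ∫ w in strip ∩ {w | w.re < L}, |f w * s w.im| ≤
      ∫ w in strip ∩ {w | w.re < L}, |f w| :=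
    integral_mono hf'.abs hf.abs fun w => by
      simp only [abs_mul]
      exact mul_le_of_le_one_right (abs_nonneg _) (hs1 _)
  rw [strip_inter_lt] at hf' hle ⊢
  have hab : IntegrableOn (fun w => |f w * s w.im|) (Set.Ioo 0 L ×ℂ Set.Ioo 0 Real.pi) := hf'.abs
  rw [setIntegral_reProdIm] at hle
  rw [integrableOn_reProdIm] at hf' hab
  have h1 : IntegrableOn (fun x => ∫ y in Set.Ioo 0 Real.pi, f ⟨x, y⟩ * s y) (Set.Ioo 0 L) := by
    rw [IntegrableOn, Measure.volume_eq_prod, ← Measure.prod_restrict] at hf'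
    exact hf'.integral_prod_left
  have h2 : IntegrableOn (fun x => ∫ y in Set.Ioo 0 Real.pi, |f ⟨x, y⟩ * s y|) (Set.Ioo 0 L) := by
    have hab' := hab
    rw [IntegrableOn, Measure.volume_eq_prod, ← Measure.prod_restrict] at hab'
    exact hab'.integral_prod_left
  refine ⟨h1, le_trans ?_ hle⟩
  refine le_of_le_of_eq ?_ (setIntegral_prod _ hab).symm
  exact integral_mono h1.abs h2 fun x => abs_integral_le_integral_abs

namespace IsHomogeneousSolution

variable {d : ℂ → ℝ} {H : ℂ → ℂ}

/-- The divergence equation on the strip. -/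
lemma setIntegral_strip_div (h : IsHomogeneousSolution d H) (hm : Measurable H) {a : ℝ → ℝ}
    {c : ℝ} (ha : ContDiff ℝ ∞ a) (hac : HasCompactSupport a) (ha0 : a =ᶠ[𝓝 0] fun _ => c)
    (n : ℕ) :
    ∫ w in strip, ((pullback H w).re * (deriv a w.re * Real.sin ((n + 1 : ℕ) * w.im)) +
      (pullback H w).im * (a w.re * ((n + 1 : ℕ) * Real.cos ((n + 1 : ℕ) * w.im)))) = 0 := by
  obtain ⟨M, hM⟩ := hac.isBounded.subset_closedBall 0
  have hM' : ∀ x, M < x → x ∉ tsupport a := fun x hx hx2 => by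
    have := hM hx2
    rw [Metric.mem_closedBall, dist_zero_right, Real.norm_eq_abs] at this
    exact absurd (le_abs_self x) (by linarith)
  have haM : ∀ x, M < x → a x = 0 := fun x hx => image_eq_zero_of_notMem_tsupport (hM' x hx)
  have hdM : ∀ x, M < x → deriv a x = 0 := fun x hx =>
    image_eq_zero_of_notMem_tsupport fun h => hM' x hx (tsupport_deriv_subset h)
  obtain ⟨Kb, hKb⟩ := hac.exists_bound_of_continuous ha.continuous
  obtain ⟨Ka, hKa⟩ := hac.deriv.exists_bound_of_continuous (ha.continuous_deriv (by norm_cast))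
  simp only [Real.norm_eq_abs] at hKa hKb
  have hKa0 : 0 ≤ Ka := (abs_nonneg _).trans (hKa 0)
  have hKb0 : 0 ≤ Kb := (abs_nonneg _).trans (hKb 0)
  set p := Polynomial.Chebyshev.U ℝ n with hp
  have hsin : ∀ y, Real.sin y * p.eval (Real.cos y) = Real.sin ((n + 1 : ℕ) * y) := fun y => by
    rw [mul_comm, hp, Polynomial.Chebyshev.U_real_cos]
    push_cast
    rfl
  obtain ⟨B, hB⟩ := exists_abs_eval_cos_le p
  obtain ⟨B', hB'⟩ := exists_abs_eval_cos_le p.derivative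
  have hB0 : 0 ≤ B := (abs_nonneg _).trans (hB 0)
  have hB0' : 0 ≤ B' := (abs_nonneg _).trans (hB' 0)
  obtain ⟨K, hK1, hK⟩ := exists_abs_deriv_trunc_le
  -- Writing sin((n+1)y) = sin y · U_n(cos y) and truncating only the factor sin y gives functions
  -- vanishing near 0 and π whose derivatives are bounded uniformly in m.
  set s : ℕ → ℝ → ℝ := fun m y => trunc m (Real.sin y) * p.eval (Real.cos y) with hs
  have hpc : ContDiff ℝ ∞ fun x => p.eval x := by simpa using p.contDiff_aeval (𝕜 := ℝ) ∞
  have hsc : ∀ m, ContDiff ℝ ∞ (s m) := fun m =>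
    ((contDiff_trunc m).comp Real.contDiff_sin).mul (hpc.comp Real.contDiff_cos)
  have hsd : ∀ m y, deriv (s m) y = deriv (trunc m) (Real.sin y) * Real.cos y *
      p.eval (Real.cos y) + trunc m (Real.sin y) * (p.derivative.eval (Real.cos y) *
        -Real.sin y) := fun m y =>
    ((((differentiable_trunc m) _).hasDerivAt.comp y (Real.hasDerivAt_sin y)).mul
      ((p.hasDerivAt _).comp y (Real.hasDerivAt_cos y))).deriv
  have htr : ∀ m y, |trunc m (Real.sin y)| ≤ 1 := fun m y =>
    (abs_trunc_le _ _).trans (Real.abs_sin_le_one y)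
  have hKs : ∀ m y, |s m y| ≤ B := fun m y => by
    simp only [hs, abs_mul]
    exact (mul_le_of_le_one_left (abs_nonneg _) (htr m y)).trans (hB y)
  have hKt : ∀ m y, |deriv (s m) y| ≤ K * B + B' := fun m y => by
    rw [hsd]
    refine (abs_add_le _ _).trans (add_le_add ?_ ?_)
    · rw [abs_mul, abs_mul]
      refine mul_le_mul ((mul_le_of_le_one_right (abs_nonneg _) (Real.abs_cos_le_one y)).trans
        (hK _ _)) (hB y) (abs_nonneg _) (by linarith)
    · rw [abs_mul, abs_mul, abs_neg]
      exact (mul_le_of_le_one_left (by positivity) (htr m y)).trans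
        ((mul_le_of_le_one_right (abs_nonneg _) (Real.abs_sin_le_one y)).trans (hB' y))
  have hs0 : ∀ m y, Real.sin y = 0 → s m =ᶠ[𝓝 y] 0 := fun m y hy => by
    have h1 : trunc m =ᶠ[𝓝 (Real.sin y)] 0 := trunc_eventuallyEq_zero (by rw [hy]; simp)
    filter_upwards [(Real.continuous_sin.tendsto y).eventually h1] with x hx
    simp only [hs, hx, Pi.zero_apply, zero_mul]
  have hz : ∀ m, _ := fun m => h.setIntegral_strip_div_of_eventuallyEq hm ha (hsc m) ha0 haM
    (hs0 m 0 (by simp)) (hs0 m Real.pi (by simp)) hKa hKb (hKs m) (hKt m)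
  have hp := measurable_pullback hm
  have hlim := tendsto_integral_of_dominated_convergence (μ := volume.restrict strip)
    (F := fun m w => (pullback H w).re * (deriv a w.re * s m w.im) +
      (pullback H w).im * (a w.re * deriv (s m) w.im))
    (f := fun w => (pullback H w).re * (deriv a w.re * Real.sin ((n + 1 : ℕ) * w.im)) +
      (pullback H w).im * (a w.re * ((n + 1 : ℕ) * Real.cos ((n + 1 : ℕ) * w.im))))
    (fun w => (if w.re ≤ M then 1 else 0) * ((Ka * B + Kb * (K * B + B')) * ‖pullback H w‖))
    (fun m => (h.strip_integrand_integrable hm (measurable_deriv a) ha.continuous.measurable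
      (hsc m).continuous.measurable (measurable_deriv _) hdM haM hKa hKb (hKs m) (hKt m)).1)
    ?_ (fun m => Eventually.of_forall fun w => ?_) ?_
  · simp only [hz] at hlim
    exact tendsto_nhds_unique hlim tendsto_const_nhds
  · refine h.integrableOn_strip_of_le hm (M := M) (K := Ka * B + Kb * (K * B + B')) ?_
      (fun w _ hw => ?_) fun w _ => ?_
    · exact (Measurable.ite (measurableSet_le measurable_re measurable_const) measurable_const
        measurable_const).mul (hp.norm.const_mul _)
    · rw [if_neg (not_le.2 hw), zero_mul]
    · rw [abs_of_nonneg (by split_ifs <;> positivity)]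
      exact mul_le_of_le_one_left (by positivity) (by split_ifs <;> norm_num)
  · split_ifs with hw
    · rw [one_mul, add_mul, Real.norm_eq_abs]
      refine (abs_add_le _ _).trans (add_le_add ?_ ?_)
      · rw [abs_mul, abs_mul, mul_comm]
        exact mul_le_mul (mul_le_mul (hKa _) (hKs _ _) (abs_nonneg _) hKa0) (abs_re_le_norm _)
          (abs_nonneg _) (by positivity)
      · rw [abs_mul, abs_mul, mul_comm]
        exact mul_le_mul (mul_le_mul (hKb _) (hKt _ _) (abs_nonneg _) hKb0) (abs_im_le_norm _)
          (abs_nonneg _) (by positivity)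
    · rw [haM _ (not_le.1 hw), hdM _ (not_le.1 hw)]
      simp
  · filter_upwards [ae_restrict_mem isOpen_strip.measurableSet] with w hw
    refine tendsto_const_nhds.congr' ?_
    filter_upwards [eventually_trunc_eventuallyEq
      (Real.sin_pos_of_pos_of_lt_pi hw.2.1 hw.2.2)] with m hm2
    have h1 : s m =ᶠ[𝓝 w.im] fun y => Real.sin ((n + 1 : ℕ) * y) := by
      filter_upwards [(Real.continuous_sin.tendsto w.im).eventually hm2] with y hy
      simp only [hs, hy, id_eq, hsin]
    have hd : HasDerivAt (fun y : ℝ => Real.sin ((n + 1 : ℕ) * y))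
        (Real.cos ((n + 1 : ℕ) * w.im) * (n + 1 : ℕ)) w.im :=
      (Real.hasDerivAt_sin _).comp w.im
        (by simpa using (hasDerivAt_id w.im).const_mul ((n + 1 : ℕ) : ℝ))
    rw [h1.deriv_eq, hd.deriv, h1.eq_of_nhds, mul_comm (Real.cos _)]

end IsHomogeneousSolution

/-- The sine coefficients of the first component of the pulled-back field on vertical lines. -/
noncomputable def sinCoeff (H : ℂ → ℂ) (n : ℕ) (x : ℝ) : ℝ :=
  ∫ y in Set.Ioo 0 Real.pi, (pullback H ⟨x, y⟩).re * Real.sin (n * y)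

/-- The cosine coefficients of the second component of the pulled-back field on vertical lines. -/
noncomputable def cosCoeff (H : ℂ → ℂ) (n : ℕ) (x : ℝ) : ℝ :=
  ∫ y in Set.Ioo 0 Real.pi, (pullback H ⟨x, y⟩).im * Real.cos (n * y)

lemma locallyIntegrableOn_Ioi {f : ℝ → ℝ} (h : ∀ L, IntegrableOn f (Set.Ioo 0 L)) :
    LocallyIntegrableOn f (Set.Ioi 0) := fun x hx =>
  ⟨Set.Ioo 0 (x + 1), mem_nhdsWithin_of_mem_nhds (Ioo_mem_nhds hx (by linarith)), h _⟩

/-- A linearly growing exponential primitive vanishes. -/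
lemma eq_zero_of_setIntegral_exp_le {f : ℝ → ℝ} {c A : ℝ} (n : ℕ)
    (hf : ∀ᵐ x, x ∈ Set.Ioi (0 : ℝ) → f x = c * Real.exp ((n + 1 : ℕ) * x))
    (hi : ∀ L, IntegrableOn f (Set.Ioo 0 L))
    (hle : ∀ L, 0 ≤ L → ∫ x in Set.Ioo 0 L, |f x| ≤ A * (L + 1)) : c = 0 := by
  by_contra hc
  have hc' : 0 < |c| := abs_pos.2 hc
  have hA : 0 ≤ A := by
    have := hle 0 le_rfl
    simpa using this
  -- Already exp((n+1)x) ≥ x makes the integral at least quadratic in L, against a linear bound.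
  have key : ∀ L, 0 ≤ L → |c| * (L ^ 2 / 2) ≤ A * (L + 1) := fun L hL => by
    refine le_trans ?_ (hle L hL)
    have e : |c| * (L ^ 2 / 2) = ∫ x in Set.Ioo 0 L, |c| * x := by
      rw [integral_const_mul, ← integral_Ioc_eq_integral_Ioo,
        ← intervalIntegral.integral_of_le hL, integral_id]
      ring
    rw [e]
    refine setIntegral_mono_on_ae ?_ (hi L).abs measurableSet_Ioo ?_
    · exact ((continuous_const.mul continuous_id).integrableOn_Icc (a := 0) (b := L)).mono_set
        Set.Ioo_subset_Icc_self
    · filter_upwards [hf] with x hx hxL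
      rw [hx hxL.1, abs_mul, Real.abs_exp]
      refine mul_le_mul_of_nonneg_left ?_ hc'.le
      have h1 := Real.add_one_le_exp (((n + 1 : ℕ) : ℝ) * x)
      have h2 : (0 : ℝ) ≤ n * x := mul_nonneg n.cast_nonneg hxL.1.le
      push_cast at h1 ⊢
      nlinarith
  -- At this length the quadratic lower bound strictly exceeds A (L + 1).
  have h1 := key (4 * A / |c| + 2) (by positivity)
  have e : |c| * (4 * A / |c|) = 4 * A := mul_div_cancel₀ _ hc'.ne'
  have h2 : 0 ≤ 4 * A / |c| := by positivity
  set L := 4 * A / |c| with hL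
  nlinarith

namespace IsHomogeneousSolution

variable {d : ℂ → ℝ} {H : ℂ → ℂ}

/-- By t ≤ 1 + t², the area and the energy of the truncated strip, both linearly bounded, control
the L¹ norm. -/
lemma setIntegral_norm_pullback_le (h : IsHomogeneousSolution d H) (hm : Measurable H) :
    ∃ A : ℝ, ∀ L : ℝ, 0 ≤ L → ∫ w in strip ∩ {w | w.re < L}, ‖pullback H w‖ ≤ A * (L + 1) := by
  obtain ⟨C, hC, hC2⟩ := h.lintegral_pullback_lt_le
  refine ⟨Real.pi + 2 * C, fun L hL => ?_⟩
  have hpi := Real.pi_pos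
  rw [integral_norm_eq_lintegral_enorm (measurable_pullback hm).aestronglyMeasurable]
  refine ENNReal.toReal_le_of_le_ofReal (by positivity) ?_
  have hle : ∀ x : ENNReal, x ≤ 1 + x ^ 2 := fun x => by
    rcases le_total x 1 with hx | hx
    · exact hx.trans le_self_add
    · refine le_add_of_nonneg_of_le zero_le ?_
      rw [pow_two]
      exact le_mul_of_one_le_right' hx
  calc ∫⁻ w in strip ∩ {w | w.re < L}, ‖pullback H w‖ₑ
      ≤ ∫⁻ w in strip ∩ {w | w.re < L}, (1 + ‖pullback H w‖ₑ ^ 2) :=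
        lintegral_mono fun w => hle _
    _ = volume (strip ∩ {w | w.re < L}) +
        ∫⁻ w in strip ∩ {w | w.re < L}, ‖pullback H w‖ₑ ^ 2 := by
        rw [lintegral_add_left measurable_const, setLIntegral_one]
    _ ≤ ENNReal.ofReal (L * Real.pi) + ENNReal.ofReal (C * (L + 2)) := by
        refine add_le_add ?_ (hC2 L hL)
        rw [strip_inter_lt, volume_reProdIm, Real.volume_Ioo, Real.volume_Ioo,
          ENNReal.ofReal_mul hL]
        simp
    _ = ENNReal.ofReal (L * Real.pi + C * (L + 2)) :=
        (ENNReal.ofReal_add (by positivity) (by positivity)).symm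
    _ ≤ _ := ENNReal.ofReal_le_ofReal (by nlinarith)

lemma integrableOn_sinCoeff (h : IsHomogeneousSolution d H) (hm : Measurable H) (n : ℕ) (L : ℝ) :
    IntegrableOn (sinCoeff H n) (Set.Ioo 0 L) ∧ ∫ x in Set.Ioo 0 L, |sinCoeff H n x| ≤
      ∫ w in strip ∩ {w | w.re < L}, ‖pullback H w‖ := by
  have hi := h.integrableOn_pullback hm L
  obtain ⟨h1, h2⟩ := integrableOn_setIntegral_mul (s := fun y => Real.sin (n * y)) hi.re
    (by fun_prop) fun y => Real.abs_sin_le_one _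
  exact ⟨h1, h2.trans (integral_mono hi.re.abs hi.norm fun w => abs_re_le_norm _)⟩

lemma integrableOn_cosCoeff (h : IsHomogeneousSolution d H) (hm : Measurable H) (n : ℕ) (L : ℝ) :
    IntegrableOn (cosCoeff H n) (Set.Ioo 0 L) ∧ ∫ x in Set.Ioo 0 L, |cosCoeff H n x| ≤
      ∫ w in strip ∩ {w | w.re < L}, ‖pullback H w‖ := by
  have hi := h.integrableOn_pullback hm L
  obtain ⟨h1, h2⟩ := integrableOn_setIntegral_mul (s := fun y => Real.cos (n * y)) hi.im
    (by fun_prop) fun y => Real.abs_cos_le_one _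
  exact ⟨h1, h2.trans (integral_mono hi.im.abs hi.norm fun w => abs_im_le_norm _)⟩

lemma integrableOn_pullback_mul (h : IsHomogeneousSolution d H) (hm : Measurable H)
    {a s : ℝ → ℝ} {K : ℝ} (ha : Continuous a) (hac : HasCompactSupport a) (hs : Continuous s)
    (hK : ∀ y, |s y| ≤ K) :
    IntegrableOn (fun w => (pullback H w).re * (a w.re * s w.im)) strip ∧
    IntegrableOn (fun w => (pullback H w).im * (a w.re * s w.im)) strip := by
  obtain ⟨M, hM⟩ := hac.isBounded.subset_closedBall 0
  have haM : ∀ x, M < x → a x = 0 := fun x hx => image_eq_zero_of_notMem_tsupport fun hx2 => by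
    have := hM hx2
    rw [Metric.mem_closedBall, dist_zero_right, Real.norm_eq_abs] at this
    exact absurd (le_abs_self x) (by linarith)
  obtain ⟨Ka, hKa⟩ := hac.exists_bound_of_continuous ha
  have h0 : ∀ x : ℝ, M < x → (0 : ℝ → ℝ) x = 0 := fun _ _ => rfl
  have h1 : ∀ x : ℝ, |(0 : ℝ → ℝ) x| ≤ 0 := fun _ => by simp
  constructor
  · simpa using h.strip_integrand_integrable hm (b := 0) (t := 0) ha.measurable measurable_const
      hs.measurable measurable_const haM h0 hKa h1 hK h1
  · simpa using h.strip_integrand_integrable hm (a := 0) (s := 0) measurable_const ha.measurable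
      measurable_const hs.measurable h0 haM h1 hKa h1 hK

/-! ### The first-order system for the Fourier coefficients. -/

/-- The weak form of P′ = (n+1) Q. Because `a` need not vanish at 0, it also contains the boundary
condition P(0) = 0, which is the Neumann condition on the side w₁ = 0. -/
lemma integral_coeff_div (h : IsHomogeneousSolution d H) (hm : Measurable H) {a : ℝ → ℝ}
    {c : ℝ} (ha : ContDiff ℝ ∞ a) (hac : HasCompactSupport a) (ha0 : a =ᶠ[𝓝 0] fun _ => c)
    (n : ℕ) :
    (∫ x in Set.Ioi 0, sinCoeff H (n + 1) x * deriv a x) +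
      (n + 1 : ℕ) * ∫ x in Set.Ioi 0, cosCoeff H (n + 1) x * a x = 0 := by
  obtain ⟨i1, -⟩ := h.integrableOn_pullback_mul hm (s := fun y => Real.sin ((n + 1 : ℕ) * y))
    (ha.continuous_deriv (by norm_cast)) hac.deriv (by fun_prop) fun y => Real.abs_sin_le_one _
  obtain ⟨-, i2⟩ := h.integrableOn_pullback_mul hm (s := fun y => Real.cos ((n + 1 : ℕ) * y))
    ha.continuous hac (by fun_prop) fun y => Real.abs_cos_le_one _
  have e := h.setIntegral_strip_div hm ha hac ha0 n
  have e' : ∀ w : ℂ, (pullback H w).im * (a w.re * ((n + 1 : ℕ) * Real.cos ((n + 1 : ℕ) * w.im))) =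
      (n + 1 : ℕ) * ((pullback H w).im * (a w.re * Real.cos ((n + 1 : ℕ) * w.im))) :=
    fun w => by ring
  simp only [e'] at e
  rw [integral_add i1 (i2.const_mul _), integral_const_mul] at e
  refine Eq.trans ?_ e
  congr 1
  · exact (setIntegral_strip_mul (f := fun w => (pullback H w).re) (α := deriv a)
      (s := fun y => Real.sin ((n + 1 : ℕ) * y)) i1).symm
  · congr 1
    exact (setIntegral_strip_mul (f := fun w => (pullback H w).im) (α := a)
      (s := fun y => Real.cos ((n + 1 : ℕ) * y)) i2).symm

/-- The weak form of Q′ = nP. No boundary condition is contained in it, since `b` is supported in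
(0, ∞). -/
lemma integral_coeff_curl (h : IsHomogeneousSolution d H) (hm : Measurable H) {b : ℝ → ℝ}
    (hb : ContDiff ℝ ∞ b) (hbc : HasCompactSupport b) (hbs : tsupport b ⊆ Set.Ioi 0) (n : ℕ) :
    (n * ∫ x in Set.Ioi 0, sinCoeff H n x * b x) +
      ∫ x in Set.Ioi 0, cosCoeff H n x * deriv b x = 0 := by
  obtain ⟨i1, -⟩ := h.integrableOn_pullback_mul hm (s := fun y => Real.sin (n * y))
    hb.continuous hbc (by fun_prop) fun y => Real.abs_sin_le_one _
  obtain ⟨-, i2⟩ := h.integrableOn_pullback_mul hm (s := fun y => Real.cos (n * y))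
    (hb.continuous_deriv (by norm_cast)) hbc.deriv (by fun_prop) fun y => Real.abs_cos_le_one _
  obtain ⟨M, hM⟩ := hbc.isBounded.subset_closedBall 0
  have hbM : ∀ x, M < x → b x = 0 := fun x hx => image_eq_zero_of_notMem_tsupport fun hx2 => by
    have := hM hx2
    rw [Metric.mem_closedBall, dist_zero_right, Real.norm_eq_abs] at this
    exact absurd (le_abs_self x) (by linarith)
  have e := h.setIntegral_strip_curl hb
    (notMem_tsupport_iff_eventuallyEq.1 fun h => lt_irrefl (0 : ℝ) (hbs h)) hbM (Or.inl rfl) (n := n)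
  have e' : ∀ w : ℂ, (pullback H w).re * (n * b w.re * Real.sin (n * w.im)) =
      n * ((pullback H w).re * (b w.re * Real.sin (n * w.im))) := fun w => by ring
  simp only [e'] at e
  rw [integral_add (i1.const_mul _) i2, integral_const_mul] at e
  refine Eq.trans ?_ e
  congr 1
  · congr 1
    exact (setIntegral_strip_mul (f := fun w => (pullback H w).re) (α := b)
      (s := fun y => Real.sin (n * y)) i1).symm
  · exact (setIntegral_strip_mul (f := fun w => (pullback H w).im) (α := deriv b)
      (s := fun y => Real.cos (n * y)) i2).symm

/-- For n = 0 the function `b` may tend to a nonzero constant, so its derivative q is an arbitrary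
test function and the coefficient itself vanishes, not just its derivative. A constant coefficient
would be compatible with linear energy growth; it corresponds to a jump between the two Dirichlet
values. -/
lemma cosCoeff_zero (h : IsHomogeneousSolution d H) (hm : Measurable H) :
    ∀ᵐ x, x ∈ Set.Ioi (0 : ℝ) → cosCoeff H 0 x = 0 := by
  have hl := locallyIntegrableOn_Ioi fun L => (h.integrableOn_cosCoeff hm 0 L).1
  refine isOpen_Ioi.ae_eq_zero_of_integral_contDiff_smul_eq_zero hl fun q hq hqc hqs => ?_
  obtain ⟨b, hb, hbd, ⟨ε, hε, hbε⟩, M, hbM⟩ := exists_primitive hq hqc hqs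
  have e := h.setIntegral_strip_curl (n := 0) hb
    ((eventually_lt_nhds hε).mono fun x hx => hbε x hx) hbM (Or.inr rfl)
  obtain ⟨-, i2⟩ := h.integrableOn_pullback_mul hm (s := fun y => Real.cos ((0 : ℕ) * y))
    hq.continuous hqc (by fun_prop) fun y => Real.abs_cos_le_one _
  rw [hbd] at e
  simp only [Nat.cast_zero, zero_mul, mul_zero, zero_add] at e i2
  have e2 := setIntegral_strip_mul (f := fun w => (pullback H w).im) (s := fun y => Real.cos (0 * y))
    (by simpa using i2)
  rw [← setIntegral_eq_integral_of_forall_compl_eq_zero (s := Set.Ioi (0 : ℝ))]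
  · simp only [cosCoeff, Nat.cast_zero, zero_mul, smul_eq_mul] at e2 ⊢
    rw [e] at e2
    refine Eq.trans ?_ e2.symm
    exact integral_congr_ae (Eventually.of_forall fun x => mul_comm (q x) _)
  · intro x hx
    rw [image_eq_zero_of_notMem_tsupport (fun h => hx (hqs h)), zero_smul]

lemma sinCoeff_cosCoeff_succ (h : IsHomogeneousSolution d H) (hm : Measurable H) (n : ℕ) :
    ∀ᵐ x, x ∈ Set.Ioi (0 : ℝ) → sinCoeff H (n + 1) x = 0 ∧ cosCoeff H (n + 1) x = 0 := by
  set P := sinCoeff H (n + 1) with hP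
  set Q := cosCoeff H (n + 1) with hQ
  have hPi := h.integrableOn_sinCoeff hm (n + 1)
  have hQi := h.integrableOn_cosCoeff hm (n + 1)
  rw [← hP] at hPi
  rw [← hQ] at hQi
  have hPl := locallyIntegrableOn_Ioi fun L => (hPi L).1
  have hQl := locallyIntegrableOn_Ioi fun L => (hQi L).1
  have hz : ∀ {a : ℝ → ℝ}, tsupport a ⊆ Set.Ioi 0 → a =ᶠ[𝓝 0] fun _ => 0 := fun has =>
    notMem_tsupport_iff_eventuallyEq.1 fun h => lt_irrefl (0 : ℝ) (has h)
  have hdt : ∀ {a : ℝ → ℝ}, tsupport a ⊆ Set.Ioi 0 → tsupport (deriv a) ⊆ Set.Ioi 0 := fun has =>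
    tsupport_deriv_subset.trans has
  -- Adding and subtracting the two equations diagonalizes the system, with exponents ±(n+1).
  obtain ⟨c₁, hc₁⟩ := exists_ae_eq_exp (f := fun x => P x + Q x) ((n + 1 : ℕ) : ℝ) (hPl.add hQl)
    fun a ha hac has => by
      have hd := ha.continuous_deriv (n := ∞) (by norm_cast)
      have e1 := h.integral_coeff_div hm ha hac (hz has) n
      have e2 := h.integral_coeff_curl hm ha hac has (n + 1)
      have j1 := integrableOn_Ioi_mul hPl hd hac.deriv (hdt has)
      have j2 := integrableOn_Ioi_mul hQl hd hac.deriv (hdt has)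
      have j3 := (integrableOn_Ioi_mul hPl ha.continuous hac has).const_mul ((n + 1 : ℕ) : ℝ)
      have j4 := (integrableOn_Ioi_mul hQl ha.continuous hac has).const_mul ((n + 1 : ℕ) : ℝ)
      rw [← integral_const_mul, ← integral_add j1 j4] at e1
      rw [← integral_const_mul, ← integral_add j3 j2] at e2
      refine (integral_congr_ae (Eventually.of_forall fun x => ?_)).trans
        ((integral_add (j1.add j4) (j3.add j2)).trans
        ((congrArg₂ (· + ·) e1 e2).trans (add_zero 0)))
      simp only [Pi.add_apply]
      ring
  obtain ⟨c₂, hc₂⟩ := exists_ae_eq_exp (f := fun x => P x - Q x) (-((n + 1 : ℕ) : ℝ)) (hPl.sub hQl)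
    fun a ha hac has => by
      have hd := ha.continuous_deriv (n := ∞) (by norm_cast)
      have e1 := h.integral_coeff_div hm ha hac (hz has) n
      have e2 := h.integral_coeff_curl hm ha hac has (n + 1)
      have j1 := integrableOn_Ioi_mul hPl hd hac.deriv (hdt has)
      have j2 := integrableOn_Ioi_mul hQl hd hac.deriv (hdt has)
      have j3 := (integrableOn_Ioi_mul hPl ha.continuous hac has).const_mul ((n + 1 : ℕ) : ℝ)
      have j4 := (integrableOn_Ioi_mul hQl ha.continuous hac has).const_mul ((n + 1 : ℕ) : ℝ)
      rw [← integral_const_mul, ← integral_add j1 j4] at e1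
      rw [← integral_const_mul, ← integral_add j3 j2] at e2
      refine (integral_congr_ae (Eventually.of_forall fun x => ?_)).trans
        ((integral_sub (j1.add j4) (j3.add j2)).trans
        ((congrArg₂ (· - ·) e1 e2).trans (sub_zero 0)))
      simp only [Pi.add_apply]
      ring
  have hc₁0 : c₁ = 0 := by
    obtain ⟨A, hA⟩ := h.setIntegral_norm_pullback_le hm
    refine eq_zero_of_setIntegral_exp_le (A := 2 * A) n hc₁ (fun L => (hPi L).1.add (hQi L).1)
      fun L hL => ?_
    calc ∫ x in Set.Ioo 0 L, |P x + Q x| ≤ ∫ x in Set.Ioo 0 L, (|P x| + |Q x|) :=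
          integral_mono ((hPi L).1.add (hQi L).1).abs ((hPi L).1.abs.add (hQi L).1.abs)
            fun x => abs_add_le _ _
      _ = (∫ x in Set.Ioo 0 L, |P x|) + ∫ x in Set.Ioo 0 L, |Q x| :=
          integral_add (hPi L).1.abs (hQi L).1.abs
      _ ≤ 2 * A * (L + 1) := by linarith [(hPi L).2, (hQi L).2, hA L hL]
  -- The decaying mode is excluded by P(0) = 0: test with a bump equal to 1 near 0. Integrating the
  -- derivative of exp(-(n+1)x) times the bump leaves the boundary value -1, so the equation reads
  -- -c₂/2 = 0.
  have hc₂0 : c₂ = 0 := by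
    let B : ContDiffBump (0 : ℝ) := ⟨1, 2, by norm_num, by norm_num⟩
    have hB : ContDiff ℝ ∞ B := B.contDiff
    have hB0 : (B : ℝ → ℝ) =ᶠ[𝓝 0] fun _ => 1 := B.eventuallyEq_one
    have e := h.integral_coeff_div hm hB B.hasCompactSupport hB0 n
    have he : ContDiff ℝ ∞ fun x : ℝ => Real.exp (-((n + 1 : ℕ) : ℝ) * x) := by fun_prop
    have hd : ∀ x : ℝ, deriv (fun x => Real.exp (-((n + 1 : ℕ) : ℝ) * x) * B x) x =
        Real.exp (-((n + 1 : ℕ) : ℝ) * x) * deriv B x -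
        (n + 1 : ℕ) * (Real.exp (-((n + 1 : ℕ) : ℝ) * x) * B x) := fun x => by
      have h1 : HasDerivAt (fun x : ℝ => Real.exp (-((n + 1 : ℕ) : ℝ) * x))
          (Real.exp (-((n + 1 : ℕ) : ℝ) * x) * (-((n + 1 : ℕ) : ℝ) * 1)) x :=
        ((hasDerivAt_id x).const_mul _).exp
      refine (h1.mul (hB.differentiable (by norm_cast) x).hasDerivAt).deriv.trans ?_
      ring
    have hint := HasCompactSupport.integral_Ioi_deriv_eq ((he.mul hB).of_le (by norm_cast))
      (B.hasCompactSupport.mul_left (f := fun x : ℝ => Real.exp (-((n + 1 : ℕ) : ℝ) * x))) 0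
    have k1 : IntegrableOn (fun x : ℝ => Real.exp (-((n + 1 : ℕ) : ℝ) * x) * deriv B x)
        (Set.Ioi 0) := ((he.continuous.mul (hB.continuous_deriv (by norm_cast)))
      |>.integrable_of_hasCompactSupport B.hasCompactSupport.deriv.mul_left).integrableOn
    have k2 : IntegrableOn (fun x : ℝ => Real.exp (-((n + 1 : ℕ) : ℝ) * x) * B x)
        (Set.Ioi 0) := ((he.continuous.mul hB.continuous)
      |>.integrable_of_hasCompactSupport B.hasCompactSupport.mul_left).integrableOn
    simp only [hd] at hint
    rw [integral_sub k1 (k2.const_mul _), integral_const_mul, hB0.eq_of_nhds] at hint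
    simp only [mul_zero, Real.exp_zero, mul_one] at hint
    have hPQ : ∀ᵐ x, x ∈ Set.Ioi (0 : ℝ) → P x = c₂ / 2 * Real.exp (-((n + 1 : ℕ) : ℝ) * x) ∧
        Q x = -(c₂ / 2) * Real.exp (-((n + 1 : ℕ) : ℝ) * x) := by
      filter_upwards [hc₁, hc₂] with x h1 h2 hx
      have h1 := h1 hx
      have h2 := h2 hx
      rw [hc₁0, zero_mul] at h1
      constructor <;> linarith
    have e1 : ∫ x in Set.Ioi 0, P x * deriv B x =
        c₂ / 2 * ∫ x in Set.Ioi 0, Real.exp (-((n + 1 : ℕ) : ℝ) * x) * deriv B x := by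
      rw [← integral_const_mul]
      refine setIntegral_congr_ae measurableSet_Ioi ?_
      filter_upwards [hPQ] with x hx hx0
      rw [(hx hx0).1]
      ring
    have e2 : ∫ x in Set.Ioi 0, Q x * B x =
        -(c₂ / 2) * ∫ x in Set.Ioi 0, Real.exp (-((n + 1 : ℕ) : ℝ) * x) * B x := by
      rw [← integral_const_mul]
      refine setIntegral_congr_ae measurableSet_Ioi ?_
      filter_upwards [hPQ] with x hx hx0
      rw [(hx hx0).2]
      ring
    rw [e1, e2] at e
    linear_combination (-2) * e + c₂ * hint
  filter_upwards [hc₁, hc₂] with x h1 h2 hx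
  have h1 := h1 hx
  have h2 := h2 hx
  rw [hc₁0, zero_mul] at h1
  rw [hc₂0, zero_mul] at h2
  constructor <;> linarith

end IsHomogeneousSolution

/-! ### Uniqueness -/

/-- The integral of a test function along segments. -/
lemma IsTest.exists_segment_primitive {φ : ℂ → ℝ} (hφ : IsTest φ) (e : ℂ) {T : ℝ} (hT : 0 ≤ T) :
    ∃ ξ : ℂ → ℝ, IsTest ξ ∧ (∀ z ∈ tsupport ξ, ∃ t ∈ Set.Icc 0 T, z + t * e ∈ tsupport φ) ∧
      ∀ z, fderiv ℝ ξ z e = φ (z + T * e) - φ z := by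
  have hg : Continuous fun t : ℝ => -((t : ℂ) * e) := by fun_prop
  let μ : Measure ℂ := (volume.restrict (Set.Ioc 0 T)).map fun t : ℝ => -((t : ℂ) * e)
  -- Averaging along the segment is convolution with the image of Lebesgue measure on (0, T], so
  -- smoothness is inherited from φ.
  set ξ : ℂ → ℝ := MeasureTheory.convolution (fun _ => (1 : ℝ)) φ (ContinuousLinearMap.lsmul ℝ ℝ) μ
  have hξ : ∀ z, ξ z = ∫ t in (0 : ℝ)..T, φ (z + t * e) := fun z => by
    have hc : Continuous fun w => (1 : ℝ) • φ (z - w) :=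
      (hφ.1.continuous.comp (continuous_const.sub continuous_id)).const_smul (1 : ℝ)
    rw [intervalIntegral.integral_of_le hT]
    refine (integral_map hg.measurable.aemeasurable hc.aestronglyMeasurable).trans ?_
    simp
  have hξc : ContDiff ℝ ∞ ξ := hφ.2.contDiff_convolution_right _
    (locallyIntegrable_const _) hφ.1
  set S : Set ℂ := (fun p : ℂ × ℝ => p.1 - p.2 * e) '' (tsupport φ ×ˢ Set.Icc 0 T) with hS
  have hSc : IsCompact S := (hφ.2.prod isCompact_Icc).image (by fun_prop)
  have hξS : ∀ z, z ∉ S → ξ z = 0 := fun z hz => by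
    rw [hξ]
    refine (intervalIntegral.integral_congr (g := fun _ => 0) fun t ht => ?_).trans (by simp)
    rw [Set.uIcc_of_le hT] at ht
    refine image_eq_zero_of_notMem_tsupport fun hmem => hz ⟨(z + t * e, t), ⟨hmem, ht⟩, ?_⟩
    simp
  refine ⟨ξ, ⟨hξc, HasCompactSupport.intro hSc hξS⟩, fun z hz => ?_, fun z => ?_⟩
  · have hts : tsupport ξ ⊆ S := closure_minimal
      (fun w hw => by_contra fun hw2 => hw (hξS w hw2)) hSc.isClosed
    obtain ⟨⟨y, t⟩, ⟨hy, ht⟩, rfl⟩ := hts hz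
    exact ⟨t, ht, by simpa using hy⟩
  · have hl : HasDerivAt (fun s : ℝ => z + s * e) e 0 := by
      simpa using ((ofRealCLM.hasDerivAt (x := 0)).mul_const e).const_add z
    have h1 : HasDerivAt (fun s : ℝ => ξ (z + s * e)) (fderiv ℝ ξ z e) 0 := by
      have h2 : HasFDerivAt ξ (fderiv ℝ ξ z) (z + (0 : ℝ) * e) := by
        simpa using (hξc.differentiable (by norm_cast) z).hasFDerivAt
      exact h2.comp_hasDerivAt 0 hl
    have hφl : Continuous fun t : ℝ => φ (z + t * e) := hφ.1.continuous.comp (by fun_prop)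
    -- Moving z by s e shifts the integration window, so the derivative along e is the difference of
    -- the end-point values.
    have h3 : ∀ s : ℝ, ξ (z + s * e) =
        (∫ t in (0 : ℝ)..(T + s), φ (z + t * e)) - ∫ t in (0 : ℝ)..s, φ (z + t * e) := fun s => by
      rw [intervalIntegral.integral_interval_sub_left (hφl.intervalIntegrable _ _)
        (hφl.intervalIntegrable _ _), hξ]
      have := intervalIntegral.integral_comp_add_right (a := 0) (b := T)
        (fun t : ℝ => φ (z + t * e)) s
      rw [zero_add] at this
      rw [← this]
      refine intervalIntegral.integral_congr fun t _ => ?_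
      push_cast
      ring_nf
    have h4 : HasDerivAt (fun s : ℝ => ξ (z + s * e))
        (φ (z + T * e) - φ (z + (0 : ℝ) * e)) 0 := by
      simp only [h3]
      refine HasDerivAt.sub ?_ (hφl.integral_hasStrictDerivAt 0 0).hasDerivAt
      have h5 := (hφl.integral_hasStrictDerivAt 0 (T + 0)).hasDerivAt
      have h6 := h5.comp_const_add T 0
      simpa using h6
    rw [h1.unique h4]
    simp

namespace IsHomogeneousSolution

variable {d : ℂ → ℝ} {H : ℂ → ℂ}

/-- On almost every vertical line all relevant coefficients vanish at once, countably many
conditions; completeness gives zero on the line and Fubini zero on the strip. -/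
lemma pullback_ae_eq_zero (h : IsHomogeneousSolution d H) (hm : Measurable H) :
    ∀ᵐ w ∂volume.restrict strip, pullback H w = 0 := by
  have hslice : ∀ᵐ x, x ∈ Set.Ioi (0 : ℝ) →
      IntegrableOn (fun y : ℝ => pullback H ⟨x, y⟩) (Set.Ioo 0 Real.pi) := by
    have h1 : ∀ L : ℕ, ∀ᵐ x, x ∈ Set.Ioo (0 : ℝ) L →
        IntegrableOn (fun y : ℝ => pullback H ⟨x, y⟩) (Set.Ioo 0 Real.pi) := fun L => by
      have hi := h.integrableOn_pullback hm L
      rw [strip_inter_lt, integrableOn_reProdIm, IntegrableOn, Measure.volume_eq_prod,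
        ← Measure.prod_restrict] at hi
      exact (ae_restrict_iff' measurableSet_Ioo).1 hi.prod_right_ae
    filter_upwards [ae_all_iff.2 h1] with x hx hx0
    obtain ⟨L, hL⟩ := exists_nat_gt x
    exact hx L ⟨hx0, hL⟩
  have hcoef : ∀ᵐ x, x ∈ Set.Ioi (0 : ℝ) →
      ∀ᵐ y, y ∈ Set.Ioo 0 Real.pi → pullback H ⟨x, y⟩ = 0 := by
    filter_upwards [hslice, h.cosCoeff_zero hm,
      ae_all_iff.2 fun n => h.sinCoeff_cosCoeff_succ hm n] with x h1 h2 h3 hx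
    have hr := ae_eq_zero_of_sin (h1 hx).re fun n => (h3 n hx).1
    have hi := ae_eq_zero_of_cos (h1 hx).im fun n => by
      rcases n with _ | n
      · exact h2 hx
      · exact (h3 n hx).2
    filter_upwards [hr, hi] with y hy1 hy2 hy
    exact Complex.ext (hy1 hy) (hy2 hy)
  have hms : MeasurableSet {p : ℝ × ℝ | p ∈ Set.Ioi (0 : ℝ) ×ˢ Set.Ioo 0 Real.pi →
      pullback H ⟨p.1, p.2⟩ = 0} := by
    refine (measurableSet_Ioi.prod measurableSet_Ioo).imp ?_
    exact (measurable_pullback hm).comp measurableEquivRealProd.symm.measurable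
      (measurableSet_singleton 0)
  have hprod : ∀ᵐ p : ℝ × ℝ, p ∈ Set.Ioi (0 : ℝ) ×ˢ Set.Ioo 0 Real.pi →
      pullback H ⟨p.1, p.2⟩ = 0 := by
    rw [Measure.volume_eq_prod, Measure.ae_prod_iff_ae_ae hms]
    filter_upwards [hcoef] with x hx
    by_cases hx0 : x ∈ Set.Ioi (0 : ℝ)
    · filter_upwards [hx hx0] with y hy hxy using hy hxy.2
    · exact Eventually.of_forall fun y hxy => absurd hxy.1 hx0
  rw [ae_restrict_iff' isOpen_strip.measurableSet]
  have := Complex.volume_preserving_equiv_real_prod.quasiMeasurePreserving.ae hprod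
  filter_upwards [this] with w hw hws
  rw [strip_eq] at hws
  exact hw hws

lemma gradient_ae_eq_zero (h : IsHomogeneousSolution d H) :
    ∀ᵐ z ∂volume.restrict halfPlane, H z = 0 := by
  obtain ⟨H', hm, h', hae⟩ := h.exists_measurable
  have e := lintegral_pullback_eq (H := H') isOpen_strip.measurableSet subset_rfl
  rw [bijOn_F.image_eq, lintegral_congr_ae (g := 0)] at e
  · simp only [Pi.zero_apply, lintegral_zero] at e
    have e2 := (lintegral_eq_zero_iff (hm.enorm.pow_const 2)).1 e.symm
    filter_upwards [hae, e2] with z hz hz2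
    rw [hz]
    simpa using hz2
  · filter_upwards [h'.pullback_ae_eq_zero hm] with w hw
    simp [hw]

/-- With zero gradient, the trace formula says that d annihilates every derivative of a suitable
test function. Any φ supported near z₀ is, up to sign, such a derivative in the half-plane, once it
is swept along a segment that leaves through the Dirichlet part. -/
lemma ae_eq_zero (h : IsHomogeneousSolution d H) : d =ᵐ[volume.restrict halfPlane] 0 := by
  have hH := h.gradient_ae_eq_zero
  have hloc : ∀ z₀ ∈ halfPlane, ∃ r, 0 < r ∧ ∀ᵐ z, z ∈ Metric.ball z₀ r → d z = 0 := by
    intro z₀ hz₀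
    have hy : 0 < z₀.im := hz₀
    -- The direction from -1/2, the midpoint of the left Dirichlet interval, to z₀.
    set e : ℂ := z₀ + 1 / 2 with he
    have him : e.im = z₀.im := by simp [he]
    have hc : 0 < 1 + ‖e‖ / z₀.im := by positivity
    -- The second entry makes segments from the ball meet the real line within 1/4 of -1/2; the
    -- first keeps the ball inside the half-plane and below height 2 Im z₀.
    set r := min z₀.im (1 / (4 * (1 + ‖e‖ / z₀.im))) with hr
    have hr0 : 0 < r := by positivity
    have hr1 : r ≤ z₀.im := min_le_left _ _
    have hr2 : r * (1 + ‖e‖ / z₀.im) ≤ 1 / 4 := by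
      have := min_le_right z₀.im (1 / (4 * (1 + ‖e‖ / z₀.im)))
      rw [← hr, le_div_iff₀ (by positivity)] at this
      linarith
    have himb : ∀ y ∈ Metric.ball z₀ r, |y.im - z₀.im| < r := fun y hy => by
      rw [← sub_im]
      exact (abs_im_le_norm _).trans_lt (by simpa [dist_eq_norm] using hy)
    have hball : Metric.ball z₀ r ⊆ halfPlane := fun y hy => by
      have := abs_lt.1 (himb y hy)
      exact show 0 < y.im by linarith [this.1]
    refine ⟨r, hr0, Metric.isOpen_ball.ae_eq_zero_of_integral_contDiff_smul_eq_zero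
      (h.locallyIntegrableOn.mono_set hball) fun φ hφ hφc hφs => ?_⟩
    -- For T = 3 the forward end point z + 3e of any z in the half-plane is higher than the ball, so
    -- there the derivative of ξ along e is exactly -φ.
    obtain ⟨ξ, hξ, hξs, hξd⟩ := IsTest.exists_segment_primitive ⟨hφ, hφc⟩ e (T := 3) (by norm_num)
    have hreal : ∀ t : ℝ, (t : ℂ) ∈ tsupport ξ → |t + 1 / 2| < 1 / 2 := fun t ht => by
      obtain ⟨s, -, hs⟩ := hξs _ ht
      have hb := hφs hs
      have h1 := himb _ hb
      have h2 : ((t : ℂ) + s * e).im = s * z₀.im := by simp [him]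
      -- Comparing heights, a real point t carried into the ball after time s has |s - 1| < r / Im
      -- z₀, so t + e stays close to z₀, that is, t close to -1/2.
      rw [h2, ← sub_one_mul, abs_mul, abs_of_pos hy, ← lt_div_iff₀ hy] at h1
      have h3 : ((t + 1 / 2 : ℝ) : ℂ) = (t + s * e - z₀) + (1 - s : ℝ) * e := by
        push_cast
        rw [he]
        ring
      have h4 : |t + 1 / 2| = ‖((t + 1 / 2 : ℝ) : ℂ)‖ := by rw [norm_real, Real.norm_eq_abs]
      rw [h4, h3]
      refine (norm_add_le _ _).trans_lt ?_
      have h5 : ‖(t : ℂ) + s * e - z₀‖ < r := by simpa [dist_eq_norm] using hb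
      have h6 : ‖((1 - s : ℝ) : ℂ) * e‖ ≤ r / z₀.im * ‖e‖ := by
        rw [norm_mul, norm_real, Real.norm_eq_abs, abs_sub_comm]
        gcongr
      have h7 : r * (1 + ‖e‖ / z₀.im) = r + r / z₀.im * ‖e‖ := by ring
      linarith
    have h0 : (0 : ℂ) ∉ tsupport ξ := fun hh => by
      have := hreal 0 (by simpa using hh)
      norm_num at this
    have key := h.setIntegral_product_eq_zero hξ h0 fun t ht => by
      have := abs_lt.1 (hreal t ht)
      rw [abs_lt]
      constructor <;> linarith [this.1, this.2]
    have hi : IntegrableOn (fun z => d z • gradient ξ z) halfPlane :=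
      h.integrableOn_smul _ hξ.continuous_gradient hξ.hasCompactSupport_gradient
        (IsTest.zero_notMem_tsupport_gradient h0)
    have key2 : ∫ z in halfPlane, d z • gradient ξ z = 0 := by
      rw [← key]
      refine integral_congr_ae ?_
      filter_upwards [hH] with z hz
      rw [hz, smul_zero, add_zero]
    have key3 : ∫ z in halfPlane, inner ℝ e (d z • gradient ξ z) = 0 := by
      rw [integral_inner hi, key2, inner_zero_right]
    have e1 : ∀ z ∈ halfPlane, inner ℝ e (d z • gradient ξ z) = -(φ z • d z) := fun z hz => by
      have hz' : 0 < z.im := hz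
      have h1 : φ (z + (3 : ℝ) * e) = 0 := image_eq_zero_of_notMem_tsupport fun hh => by
        have := abs_lt.1 (himb _ (hφs hh))
        have h2 : (z + (3 : ℝ) * e).im = z.im + 3 * z₀.im := by simp [him]
        rw [h2] at this
        linarith [this.2]
      rw [inner_smul_right, real_inner_comm, inner_gradient_left, hξd, h1, smul_eq_mul]
      ring
    rw [setIntegral_congr_fun isOpen_halfPlane.measurableSet e1, integral_neg, neg_eq_zero] at key3
    rw [← key3]
    refine (setIntegral_eq_integral_of_forall_compl_eq_zero fun z hz => ?_).symm
    rw [image_eq_zero_of_notMem_tsupport (fun hh => hz (hball (hφs hh))), zero_smul]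
  have hnull : volume {z | z ∈ halfPlane ∧ d z ≠ 0} = 0 := by
    refine measure_null_of_locally_null _ fun z hz => ?_
    obtain ⟨r, hr, hzr⟩ := hloc z hz.1
    refine ⟨_, inter_mem_nhdsWithin _ (Metric.ball_mem_nhds z hr), ?_⟩
    refine measure_mono_null (fun w hw => ?_) (ae_iff.1 hzr)
    exact fun hh => hw.1.2 (hh hw.2)
  rw [EventuallyEq, ae_restrict_iff' isOpen_halfPlane.measurableSet, ae_iff]
  convert hnull using 3
  simp

end IsHomogeneousSolution

lemma IsSolution.ae_eq {v u : ℂ → ℝ} (hv : IsSolution v) (hu : IsSolution u) :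
    v =ᵐ[volume.restrict halfPlane] u := by
  obtain ⟨H, h⟩ := hv.sub hu
  filter_upwards [h.ae_eq_zero] with z hz
  exact sub_eq_zero.1 hz

end

end NeelWall

theorem mainTheorem9 :
    InnerProductSpace.HarmonicOnNhd NeelWall.potential NeelWall.halfPlane ∧
    NeelWall.IsSolution NeelWall.potential ∧
    (∀ v : ℂ → ℝ, NeelWall.IsSolution v →
      v =ᵐ[volume.restrict NeelWall.halfPlane] NeelWall.potential) ∧
    (∀ z ∈ NeelWall.halfPlane, |NeelWall.potential z| ≤ Real.pi / 2) ∧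
    Tendsto NeelWall.potential (Bornology.cobounded ℂ ⊓ 𝓟 NeelWall.halfPlane) (𝓝 0) ∧
    (∀ x₁ x₂ : ℝ, 0 < x₂ →
      NeelWall.potential ⟨x₁, x₂⟩ = -NeelWall.potential ⟨-x₁, x₂⟩) ∧
    ∃ C : ℝ, ∀ z ∈ NeelWall.halfPlane ∩ Metric.ball (0 : ℂ) (1 / 2),
      ‖gradient NeelWall.potential z - (1 / ‖z‖ ^ 2) • NeelWall.perp z‖ ≤ C * ‖z‖ := by
  refine ⟨NeelWall.harmonicOnNhd_potential, NeelWall.isSolution_potential, ?_,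
    fun z hz => NeelWall.abs_potential_le hz, NeelWall.tendsto_potential,
    NeelWall.potential_odd, 2, fun z hz =>
    NeelWall.norm_gradient_potential_sub_le hz.1 (by simpa using hz.2)⟩
  exact fun v hv => NeelWall.IsSolution.ae_eq hv NeelWall.isSolution_potential
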